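/- **Setting.** Let $\gamma>0$, let $\Gamma\subset\mathbb{R}^d$ be a Borel set of locally finite, non-zero perimeter, let $u:\mathbb{R}^d\to\mathbb{R}$ be such that $1+u$ is integrable on $\mathbb{R}^d\setminus\overline\Gamma$, and let $V_0\ge0$ be a measurable function. Write $\partial_*\Gamma$ for the measure-theoretic boundary of $\Gamma$ and $\mathcal H^{d-1}$ for the Hausdorff measure (normalized to be surface area), and put $\pi(\mathrm dx):=(\gamma+V_0(x))\,\mathbf 1_{\partial_*\Gamma}(x)\,\mathcal H^{d-1}(\mathrm dx)$. Let $\mathcal Y$ be the set of all $1$-Lipschitz paths $y:[0,\infty)\to\mathbb{R}^d$ with $\theta=\theta(y):=\inf\{t\ge0:y_t\in\overline\Gamma\}<\infty$ and $y_t=y_\theta$ for $t\ge\theta$, with the metric $\|y-\hat y\|_\infty+|\theta(y)-\theta(\hat y)|$. We write $L^\pm$ for the positive and negative parts of $L$. *Equilibria.* For $T\in(0,\infty)$, $\mathcal E_T$ is the set of triples $(\kappa,\mathbb Q,L)$, where $\kappa\in(0,\infty)$, $\mathbb Q$ is a Borel probability measure on $\mathcal Y\times[0,\infty)=\{(y,\beta)\}$,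 and $L:\mathbb{R}^d\to\mathbb{R}\setminus\{0\}$ is upper semicontinuous, such that * $\mathbb Q$ minimizes $\hat{\mathbb Q}\mapsto\mathbb E^{\hat{\mathbb Q}}\big[\int_0^\theta L^+(y_t)\,\mathrm dt\big]$ over all $\hat{\mathbb Q}$ with $\hat{\mathbb Q}\circ y_0^{-1}=\mathbb Q\circ y_0^{-1}$; * $\mathbb Q$-almost surely, $\int_0^\theta L^+(y_t)\,\mathrm dt\le T$ and $\beta\le\theta$, and $y_\theta\in\partial_*\Gamma$ if $\beta=\theta$; * for all $\phi\in C_c^\infty(\mathbb{R}^d)$, $\;\kappa\,\mathbb E^{\mathbb Q}\big[\int_0^\beta\phi(y_t)L^+(y_t)\,\mathrm dt\big]=\int_{\mathbb{R}^d}\phi(x)(1+\gamma L(x))\,\mathrm dx$ and $\mathbb E^{\mathbb Q}\big[\int_0^\beta\phi(y_t)L^-(y_t)\,\mathrm dt\big]=0$, all these integrals being well defined. Let $\mathcal E:=\bigcup_{T>0}\mathcal E_T$. For $(\kappa,\mathbb Q,L)\in\mathcal E$ put $\iota_t:=\inf\{r\in[0,\theta]:\int_r^\theta L^+(y_z)\,\mathrm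 dz<t\}$ (with $\inf\emptyset=\infty$), let $D_t$ be the union of $\Gamma$ and the support of the measure $\mathbb E^{\mathbb Q}\big[\int_{\iota_t}^{\beta\vee\iota_t}\mathbf 1_{\{y_r\in\mathrm dx\}}\,\mathrm dr\big]$ (so $D_0=\Gamma$), and let $w^{\mathbb Q,L}(x):=\inf\{t\ge0:x\in D_t\}\in[0,\infty]$. Define the signed measure $$\mathbf e^{\kappa,\mathbb Q,L}(\mathrm dx):=\kappa\,\mathbb Q(y_0\in\mathrm dx,\theta=0)+\mathbf 1_{\{w^{\mathbb Q,L}<\infty\}\setminus\overline\Gamma}(x)\big(\kappa\,\mathbb Q(y_0\in\mathrm dx)-\kappa\,\mathbb Q(y_\beta\in\mathrm dx)-(1+u(x))\,\mathrm dx\big)$$ and $\mathbf E^{\kappa,\mathbb Q,L}_t:=\mathbf e^{\kappa,\mathbb Q,L}(\{w^{\mathbb Q,L}\le t\})$. *Minimal solutions.* A Lebesgue measurable function $w:\mathbb{R}^d\to[0,\infty]$ is a *minimal solution* of $$\mathrm{div}\Big(\frac{\nabla w}{|\nabla w|}\Big(\frac1{|\nabla w|}+\gamma\Big)\Big)=-1-u$$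 with initial domain $\Gamma$ and initial velocity $V_0$ if there are $(\kappa^n,\mathbb Q^n,L^n)\in\mathcal E$, $n\in\mathbb N$, such that for every $T>0$: 1. for every $n$, the measure $\pi^n:=\kappa^n\mathbb Q^n(y_\theta\in\mathrm dx,\beta=\theta)$ satisfies $\pi^n>\pi$, that is, $\pi^n\ge\pi$, and $\pi^n(A)>\pi(A)$ for every Borel set $A$ with $\pi^n(A)>0$; moreover $\mathbf e^{\kappa^n,\mathbb Q^n,L^n}\ge0$ for every $n$, $w^{\mathbb Q^n,L^n}\wedge T\to w\wedge T$ in $L^1_{\mathrm{loc}}(\mathbb{R}^d)$, and $\kappa^n\mathbb Q^n(\beta=\theta)\to\pi(\mathbb{R}^d)$; 2. for every sequence $(\hat\kappa^n,\hat{\mathbb Q}^n,\hat L^n)\in\mathcal E$ such that, for all $n$, $\hat\kappa^n\hat{\mathbb Q}^n(y_\theta\in\mathrm dx,\beta=\theta)=\pi^n$, $\mathbf e^{\hat\kappa^n,\hat{\mathbb Q}^n,\hat L^n}\ge0$ and $\mathbf E_t^{\hat\kappa^n,\hat{\mathbb Q}^n,\hat L^n}\le\mathbf E_t^{\kappa^n,\mathbb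 Q^n,L^n}$ for all $t\in[0,T]$, we have $\liminf_{n\to\infty}\big(\mathbf E_t^{\hat\kappa^n,\hat{\mathbb Q}^n,\hat L^n}-\mathbf E_r^{\kappa^n,\mathbb Q^n,L^n}\big)\ge0$ whenever $0\le r<t<T$. **Proposition 5.4.** Let $d\ge2$, $\gamma>0$, $R_0>0$, $\Gamma:=\mathbb{R}^d\setminus B(0,R_0)$ with $B(0,R_0)$ the open ball, let $V_0\ge0$ be a constant, and let $u(x)=u(|x|)$ be a bounded, measurable, radial function. Put $$F(r):=(\gamma+V_0)R_0^{d-1}-\int_r^{R_0}(1+u(z))\,z^{d-1}\,\mathrm dz-\gamma r^{d-1},\qquad R_*:=\sup\{0<r<R_0:F(r)<0\}\vee0$$ (with $\sup\emptyset=-\infty$). If $$\int_{R_*}^{R_0}\frac{r^{d-1}}{F(r)}\,\mathrm dr=\infty,$$ then the function $w:\mathbb{R}^d\to[0,\infty]$ given by $$w(x):=\begin{cases}0,&|x|\ge R_0,\\ \displaystyle\int_{|x|}^{R_0}\frac{r^{d-1}}{F(r)}\,\mathrm dr,&R_*\le|x|<R_0,\\ \infty,&|x|<R_*,\end{cases}$$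 is a minimal solution with initial domain $\Gamma$ and initial velocity $V_0$. Here the integrals take values in $[0,\infty]$ and the integrand is $\infty$ where $F$ vanishes (note that $F\ge0$ on $(R_*,R_0)$). -/

import Mathlib

open MeasureTheory Set Filter Topology
open scoped NNReal ENNReal ContDiff

namespace Cascade

/-- Euclidean space `ℝᵈ`. -/
abbrev E (d : ℕ) : Type := EuclideanSpace ℝ (Fin d)

/-- The measure theoretic boundary `∂_* A`: the points at which neither `A` nor its complement
has density zero. -/
def measBoundary {d : ℕ} (A : Set (E d)) : Set (E d) :=
  {x | 0 < limsup (fun r : ℝ => volume (Metric.closedBall x r ∩ A) /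
          volume (Metric.closedBall x r)) (𝓝[>] 0) ∧
       0 < limsup (fun r : ℝ => volume (Metric.closedBall x r \ A) /
          volume (Metric.closedBall x r)) (𝓝[>] 0)}

/-- The space `𝒴` of paths `y : [0,∞) → ℝᵈ` with `‖ẏ‖_∞ ≤ 1` that reach the closure of `Γ` in
finite time and are constant from that time on. -/
@[ext]
structure Path {d : ℕ} (Γ : Set (E d)) where
  toFun : ℝ≥0 → E d
  lipschitz : LipschitzWith 1 toFun
  hits : ∃ t, toFun t ∈ closure Γ
  stops : ∀ t, sInf {s | toFun s ∈ closure Γ} ≤ t →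
    toFun t = toFun (sInf {s | toFun s ∈ closure Γ})

namespace Path

variable {d : ℕ} {Γ : Set (E d)}

instance : CoeFun (Path Γ) (fun _ => ℝ≥0 → E d) := ⟨Path.toFun⟩

/-- The hitting time `θ` of the closure of `Γ`. -/
noncomputable def theta (y : Path Γ) : ℝ≥0 := sInf {s | y s ∈ closure Γ}

theorem dist_zero_le (y : Path Γ) (t : ℝ≥0) : dist (y t) (y 0) ≤ y.theta := by
  have h0 : ∀ s : ℝ≥0, dist (y s) (y 0) ≤ s := fun s => by
    simpa [NNReal.dist_eq] using y.lipschitz.dist_le_mul s 0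
  rcases le_total y.theta t with h | h
  · rw [y.stops t h]; exact h0 _
  · exact (h0 t).trans (by exact_mod_cast h)

theorem bddAbove_dist (y z : Path Γ) : BddAbove (range fun t => dist (y t) (z t)) := by
  refine ⟨y.theta + dist (y 0) (z 0) + z.theta, ?_⟩
  rintro _ ⟨t, rfl⟩
  have h1 := dist_triangle4 (y t) (y 0) (z 0) (z t)
  have h2 := y.dist_zero_le t
  have h3 := z.dist_zero_le t
  rw [dist_comm] at h3
  dsimp only
  linarith

/-- The metric `d_𝒴(y, z) = ‖y - z‖_∞ + |θ(y) - θ(z)|`. -/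
noncomputable instance : MetricSpace (Path Γ) where
  dist y z := (⨆ t, dist (y t) (z t)) + dist y.theta z.theta
  dist_self y := by simp
  dist_comm y z := by simp only [dist_comm]
  dist_triangle x y z := by
    have h : (⨆ t, dist (x t) (z t)) ≤ (⨆ t, dist (x t) (y t)) + ⨆ t, dist (y t) (z t) :=
      ciSup_le fun t => (dist_triangle _ (y t) _).trans
        (add_le_add (le_ciSup (bddAbove_dist x y) t) (le_ciSup (bddAbove_dist y z) t))
    have h' := dist_triangle x.theta y.theta z.theta
    linarith
  eq_of_dist_eq_zero := by
    intro y z h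
    have h1 : 0 ≤ ⨆ t, dist (y t) (z t) := Real.iSup_nonneg fun _ => dist_nonneg
    have h2 : 0 ≤ dist y.theta z.theta := dist_nonneg
    ext1
    funext t
    have h3 := le_ciSup (bddAbove_dist y z) t
    exact dist_le_zero.1 (by linarith)

noncomputable instance : MeasurableSpace (Path Γ) := borel _

instance : BorelSpace (Path Γ) := ⟨rfl⟩

/-- The cost `∫_r^θ L⁺(y_t) dt` (note that `ENNReal.ofReal` takes the positive part). -/
noncomputable def tailCost (L : E d → ℝ) (y : Path Γ) (r : ℝ≥0) : ℝ≥0∞ :=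
  ∫⁻ t in Ioc (r : ℝ) y.theta, ENNReal.ofReal (L (y t.toNNReal))

/-- The total cost `∫_0^θ L⁺(y_t) dt`. -/
noncomputable def cost (L : E d → ℝ) (y : Path Γ) : ℝ≥0∞ := y.tailCost L 0

/-- `ι(L,t) = inf {r ∈ [0,θ] : ∫_r^θ L⁺(y_z) dz < t}`, with `inf ∅ = ∞`. -/
noncomputable def iota (L : E d → ℝ) (t : ℝ≥0) (y : Path Γ) : ℝ≥0∞ :=
  ⨅ (r : ℝ≥0) (_ : r ≤ y.theta ∧ y.tailCost L r < t), (r : ℝ≥0∞)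

end Path

/-- The raw data `(κ, ℚ, L)`; the conditions on them are in `IsEquilibrium`. A point of
`Path Γ × ℝ≥0` is a path `y` together with a killing time `β`. -/
structure Triple {d : ℕ} (Γ : Set (E d)) where
  κ : ℝ
  Q : Measure (Path Γ × ℝ≥0)
  L : E d → ℝ

namespace Triple

variable {d : ℕ} {Γ : Set (E d)}

/-- `(κ, ℚ, L) ∈ 𝓔_T`: an equilibrium capped at `T`, for the surface tension coefficient `γ`.
In the last condition `φ L⁻` is replaced by its absolute value: as `L⁻ ≥ 0`, this says that
`𝔼^ℚ[∫_0^β φ(y_t) L⁻(y_t) dt]` is well defined and zero for every test function `φ`. -/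
structure IsEquilibrium (γ T : ℝ) (c : Triple Γ) : Prop where
  kappa_pos : 0 < c.κ
  prob : IsProbabilityMeasure c.Q
  usc : UpperSemicontinuous c.L
  ne_zero : ∀ x, c.L x ≠ 0
  optimal : ∀ Q' : Measure (Path Γ × ℝ≥0), IsProbabilityMeasure Q' →
    (∀ A : Set (E d), MeasurableSet A → Q' {p | p.1 0 ∈ A} = c.Q {p | p.1 0 ∈ A}) →
    ∫⁻ p, p.1.cost c.L ∂c.Q ≤ ∫⁻ p, p.1.cost c.L ∂Q'
  capped : ∀ᵐ p ∂c.Q, p.1.cost c.L ≤ ENNReal.ofReal T ∧ p.2 ≤ p.1.theta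
  endpoint : ∀ᵐ p ∂c.Q, p.2 = p.1.theta → p.1 p.1.theta ∈ measBoundary Γ
  fixedPoint : ∀ φ : E d → ℝ, ContDiff ℝ ∞ φ → HasCompactSupport φ →
    Integrable (fun x => φ x * (1 + γ * c.L x)) ∧
    c.κ * ∫ p, (∫ t in Ioc (0 : ℝ) p.2, φ (p.1 t.toNNReal) * max (c.L (p.1 t.toNNReal)) 0) ∂c.Q
      = ∫ x, φ x * (1 + γ * c.L x)
  negPart : ∀ φ : E d → ℝ, ContDiff ℝ ∞ φ → HasCompactSupport φ →
    ∫⁻ p, (∫⁻ t in Ioc (0 : ℝ) p.2,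
      ENNReal.ofReal (|φ (p.1 t.toNNReal)| * max (-c.L (p.1 t.toNNReal)) 0)) ∂c.Q = 0

/-- `(κ, ℚ, L) ∈ 𝓔 = ⋃_{T > 0} 𝓔_T`. -/
def IsAnyEquilibrium (γ : ℝ) (c : Triple Γ) : Prop := ∃ T : ℝ, 0 < T ∧ c.IsEquilibrium γ T

/-- The occupation measure
`A ↦ 𝔼^ℚ[∫_{ι(L,t)}^{β ∨ ι(L,t)} 1_{y_r ∈ A} dr]` of the particles up to the time `t`. -/
noncomputable def occupation (c : Triple Γ) (t : ℝ≥0) (A : Set (E d)) : ℝ≥0∞ :=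
  ∫⁻ p, volume {r : ℝ | 0 ≤ r ∧ p.1.iota c.L t ≤ ENNReal.ofReal r ∧ r < p.2 ∧
    p.1 r.toNNReal ∈ A} ∂c.Q

/-- The cascade `D_t = Γ ∪ supp (occupation measure up to time t)`. -/
def cascade (c : Triple Γ) (t : ℝ≥0) : Set (E d) :=
  Γ ∪ {x | ∀ ε : ℝ, 0 < ε → 0 < c.occupation t (Metric.ball x ε)}

/-- The arrival time function `w^{ℚ,L}(x) = inf {t ≥ 0 : x ∈ D_t} ∈ [0,∞]`. -/
noncomputable def arrival (c : Triple Γ) (x : E d) : ℝ≥0∞ :=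
  ⨅ (t : ℝ≥0) (_ : x ∈ c.cascade t), (t : ℝ≥0∞)

/-- The measure `A ↦ κ ℚ(y_θ ∈ A, β = θ)`. -/
noncomputable def boundaryMass (c : Triple Γ) (A : Set (E d)) : ℝ≥0∞ :=
  ENNReal.ofReal c.κ * c.Q {p | p.1 p.1.theta ∈ A ∧ p.2 = p.1.theta}

/-- The set `{w^{ℚ,L} < ∞} \ closure Γ`. -/
def frozen (c : Triple Γ) : Set (E d) := {x | c.arrival x < ⊤} \ closure Γ

/-- The excess loss of energy, a signed measure evaluated at `A`:
`κ ℚ(y_0 ∈ A, θ = 0) + κ ℚ(y_0 ∈ A ∩ F) - κ ℚ(y_β ∈ A ∩ F) - ∫_{A ∩ F} (1 + u) dx`,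
with `F = {w^{ℚ,L} < ∞} \ closure Γ`. Here `1 + u` is understood to be integrable outside `Γ`,
as it is when `u` is bounded and `Γ` has a bounded complement. -/
noncomputable def excess (u : E d → ℝ) (c : Triple Γ) (A : Set (E d)) : ℝ :=
  c.κ * c.Q.real {p | p.1 0 ∈ A ∧ p.1.theta = 0}
    + (c.κ * c.Q.real {p | p.1 0 ∈ A ∩ c.frozen}
      - c.κ * c.Q.real {p | p.1 p.2 ∈ A ∩ c.frozen}
      - ∫ x in A ∩ c.frozen, (1 + u x))

/-- The excess loss of energy is a nonnegative measure. -/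
def ExcessNonneg (u : E d → ℝ) (c : Triple Γ) : Prop :=
  ∀ A : Set (E d), MeasurableSet A → 0 ≤ c.excess u A

/-- The cumulative excess energy loss `𝐄_t`: the excess loss of energy on `{w^{ℚ,L} ≤ t}`. -/
noncomputable def cumExcess (u : E d → ℝ) (c : Triple Γ) (t : ℝ) : ℝ :=
  c.excess u {x | c.arrival x ≤ ENNReal.ofReal t}

end Triple

/-- The measure `(γ + V₀) 1_{∂_* Γ} ℋ^{d-1}`, with the Hausdorff measure normalized so that it
agrees with the `(d-1)`-dimensional surface area. -/
noncomputable def boundaryEnergy {d : ℕ} (γ : ℝ) (Γ : Set (E d)) (V₀ : E d → ℝ) : Measure (E d) :=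
  ((Measure.euclideanHausdorffMeasure (d - 1) : Measure (E d)).restrict
    (measBoundary Γ)).withDensity fun x => ENNReal.ofReal (γ + V₀ x)

/-- `w ∧ T` for `T ≥ 0`, as a real-valued function. -/
noncomputable def capped {d : ℕ} (w : E d → ℝ≥0∞) (T : ℝ) (x : E d) : ℝ :=
  (min (w x) (ENNReal.ofReal T)).toReal

/-- `w : ℝᵈ → [0,∞]` is a minimal solution of the cascade equation
`div ((∇w/|∇w|) (1/|∇w| + γ)) = -1 - u`, with initial domain `Γ` and initial velocity `V₀`. -/
def IsMinimalSolution {d : ℕ} (γ : ℝ) (Γ : Set (E d)) (u V₀ : E d → ℝ) (w : E d → ℝ≥0∞) : Prop :=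
  AEMeasurable w ∧
  ∃ c : ℕ → Triple Γ, (∀ n, (c n).IsAnyEquilibrium γ) ∧
    ∀ T : ℝ, 0 < T →
      -- (i)
      ((∀ n, ∀ A : Set (E d), MeasurableSet A →
          boundaryEnergy γ Γ V₀ A ≤ (c n).boundaryMass A ∧
          (0 < (c n).boundaryMass A → boundaryEnergy γ Γ V₀ A < (c n).boundaryMass A)) ∧
        (∀ n, (c n).ExcessNonneg u) ∧
        (∀ K : Set (E d), IsCompact K →
          Tendsto (fun n => ∫⁻ x in K, ‖capped (c n).arrival T x - capped w T x‖ₑ) atTop (𝓝 0)) ∧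
        Tendsto (fun n => (c n).boundaryMass univ) atTop (𝓝 (boundaryEnergy γ Γ V₀ univ))) ∧
      -- (ii)
      (∀ c' : ℕ → Triple Γ, (∀ n, (c' n).IsAnyEquilibrium γ) →
        (∀ n, ∀ A : Set (E d), MeasurableSet A → (c' n).boundaryMass A = (c n).boundaryMass A) →
        (∀ n, (c' n).ExcessNonneg u) →
        (∀ n, ∀ t ∈ Icc (0 : ℝ) T, (c' n).cumExcess u t ≤ (c n).cumExcess u t) →
        ∀ r t : ℝ, 0 ≤ r → r < t → t < T →
          0 ≤ liminf (fun n => (((c' n).cumExcess u t - (c n).cumExcess u r : ℝ) : EReal)) atTop)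

/-- `(γ + V₀) R₀^{d-1} - ∫_r^{R₀} (1 + u(z)) z^{d-1} dz - γ r^{d-1}`. -/
noncomputable def radialDenom (d : ℕ) (γ V₀ R₀ : ℝ) (u : ℝ → ℝ) (r : ℝ) : ℝ :=
  (γ + V₀) * R₀ ^ (d - 1) - (∫ z in r..R₀, (1 + u z) * z ^ (d - 1)) - γ * r ^ (d - 1)

/-- The radius `R_* = sup {0 < r < R₀ : ∫_r^{R₀} (1 + u(z)) z^{d-1} dz >
(γ + V₀) R₀^{d-1} - γ r^{d-1}} ∨ 0` (the supremum of the empty set of reals being `0` here). -/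
noncomputable def radiusStar (d : ℕ) (γ V₀ R₀ : ℝ) (u : ℝ → ℝ) : ℝ :=
  max (sSup {r : ℝ | 0 < r ∧ r < R₀ ∧
    (γ + V₀) * R₀ ^ (d - 1) - γ * r ^ (d - 1) < ∫ z in r..R₀, (1 + u z) * z ^ (d - 1)}) 0

/-- `∫_ρ^{R₀} r^{d-1} / radialDenom(r) dr ∈ [0,∞]`. It is used only for `ρ ≥ R_*`, where the
denominator is nonnegative; the integrand is `∞` where the denominator vanishes. -/
noncomputable def radialTime (d : ℕ) (γ V₀ R₀ : ℝ) (u : ℝ → ℝ) (ρ : ℝ) : ℝ≥0∞ :=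
  ∫⁻ r in Ioo ρ R₀, ENNReal.ofReal (r ^ (d - 1)) / ENNReal.ofReal (radialDenom d γ V₀ R₀ u r)

open Classical in
/-- The radial arrival time: the above integral from `|x|` to `R₀` if `R_* ≤ |x| < R₀`, `∞` if
`|x| < R_*`, and `0` if `|x| ≥ R₀`. -/
noncomputable def radialArrival (d : ℕ) (γ V₀ R₀ : ℝ) (u : ℝ → ℝ) (x : E d) : ℝ≥0∞ :=
  if R₀ ≤ ‖x‖ then 0
  else if radiusStar d γ V₀ R₀ u ≤ ‖x‖ then radialTime d γ V₀ R₀ u ‖x‖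
  else ⊤

end Cascade

/-! The approximating equilibria can be written down. Raise the initial velocity to `V₀ + ε` and
stop at a radius `ρ` slightly larger than `R_*`; then `F_ε := F + ε R₀^(d-1)` is positive on `[ρ,
R₀]`. Put `m(r) := F_ε(r) + γ r^(d-1)`, so that `m' = (1 + u) r^(d-1)` almost everywhere. Particles
run radially outward at unit speed and are killed at a constant rate `lam`. Per unit solid angle,
they start with mass `m(ρ)` on the sphere `|x| = ρ` and with radial density `m' + lam * m` outside
it. For large `lam` this density is nonnegative even where `1 + u < 0`, and the surviving flux
through the radius `r` is exactly `m(r)` (`FluxData.lintegral_start_survival`).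

The occupation density in space is `m / r^(d-1)`, so the fixed point equation reads `(m / r^(d-1)) L
= 1 + γ L` and gives `L = r^(d-1) / F_ε` on the annulus; elsewhere `L = -1/γ`. Since `L` is radial
and a 1-Lipschitz path cannot cross a set of radii faster than a radial one, radial paths are
optimal (`FluxData.time_le_cost`). Hence this is an equilibrium
(`FluxData.isAnyEquilibrium_triple`), and its arrival time at a point of the annulus is the integral
of `L` from `|x|` to `R₀` (`FluxData.arrival_of_mem`).

Births minus deaths inside the annulus have density `1 + u`, so the whole excess loss of energy is
the starting mass on the innermost sphere (`FluxData.triple_excess`), which the front reaches only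
at the time `∫_ρ^{R₀} L`. Let `ε ↓ 0` and `ρ ↓ R_*`. By monotone convergence the arrival times
converge to the claimed function, and by the divergence hypothesis the time at which the innermost
sphere is reached tends to infinity. Up to any fixed time the cumulative excess is therefore
eventually zero, and no competitor with nonnegative excess can be below that.

The boundary condition compares `(γ + V₀ + ε) R₀^(d-1)` with `(γ + V₀) R₀^(d-1)`, once the Hausdorff
measure on the unit sphere is identified with the surface measure from polar coordinates
(`euclideanHausdorffMeasure_sphere`). -/

namespace Cascade

/-! ### Polar coordinates and cones over subsets of the sphere. -/

/-- The surface measure on the unit sphere. -/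
noncomputable abbrev sphereMeasure (d : ℕ) : Measure (Metric.sphere (0 : E d) 1) :=
  (volume : Measure (E d)).toSphere

theorem norm_sphere {d : ℕ} (e : Metric.sphere (0 : E d) 1) : ‖(e : E d)‖ = 1 := by
  simp

theorem lintegral_polar {d : ℕ} (hd : 0 < d) {f : E d → ℝ≥0∞} (hf : Measurable f) :
    ∫⁻ x, f x = ∫⁻ e, (∫⁻ r in Ioi (0 : ℝ), ENNReal.ofReal (r ^ (d - 1)) * f (r • (e : E d)))
      ∂sphereMeasure d := by
  have : Nontrivial (E d) := Module.nontrivial_of_finrank_pos (R := ℝ) (by simpa using hd)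
  have h1 : ∫⁻ x, f x = ∫⁻ x : ({(0)}ᶜ : Set (E d)), f (x : E d) ∂(Measure.comap Subtype.val volume) := by
    rw [lintegral_subtype_comap (measurableSet_singleton _).compl f, restrict_compl_singleton]
  have h2 := (volume : Measure (E d)).measurePreserving_homeomorphUnitSphereProd.lintegral_comp_emb
    (Homeomorph.measurableEmbedding _) (fun z => f ((z.2 : ℝ) • (z.1 : E d)))
  have h3 : ∀ x : ({(0)}ᶜ : Set (E d)), f x = f (((homeomorphUnitSphereProd (E d) x).2 : ℝ) •
      ((homeomorphUnitSphereProd (E d) x).1 : E d)) := by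
    intro x
    have hx : ‖(x : E d)‖ ≠ 0 := norm_ne_zero_iff.2 x.2
    simp [smul_smul, mul_inv_cancel₀ hx]
  rw [h1, lintegral_congr h3, h2, lintegral_prod _ (by fun_prop)]
  refine lintegral_congr fun e => ?_
  rw [Measure.volumeIoiPow, lintegral_withDensity_eq_lintegral_mul _ (by fun_prop) (by fun_prop)]
  simp only [Pi.mul_apply]
  rw [lintegral_subtype_comap measurableSet_Ioi
    (fun r : ℝ => ENNReal.ofReal (r ^ (Module.finrank ℝ (E d) - 1)) * f (r • (e : E d)))]
  simp

open scoped Pointwise in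
theorem measurableSet_cone {d : ℕ} {s : Set (Metric.sphere (0 : E d) 1)} (hs : MeasurableSet s) :
    MeasurableSet (Ioo (0 : ℝ) 1 • (Subtype.val '' s : Set (E d))) := by
  have hA : MeasurableSet (Subtype.val '' s : Set (E d)) :=
    (MeasurableEmbedding.subtype_coe Metric.isClosed_sphere.measurableSet).measurableSet_image.2 hs
  have h : Ioo (0 : ℝ) 1 • (Subtype.val '' s : Set (E d)) =
      {x | 0 < ‖x‖} ∩ {x | ‖x‖ < 1} ∩ (fun x : E d => ‖x‖⁻¹ • x) ⁻¹' (Subtype.val '' s) := by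
    ext x
    constructor
    · rintro ⟨r, hr, _, ⟨a, ha, rfl⟩, rfl⟩
      have h1 : ‖r • (a : E d)‖ = r := by simp [norm_smul, abs_of_pos hr.1]
      refine ⟨⟨?_, ?_⟩, ?_⟩
      · simpa only [mem_ofPred_eq, h1] using hr.1
      · simpa only [mem_ofPred_eq, h1] using hr.2
      · rw [mem_preimage, h1, smul_smul, inv_mul_cancel₀ hr.1.ne', one_smul]
        exact ⟨a, ha, rfl⟩
    · rintro ⟨⟨h1, h2⟩, h3⟩
      refine ⟨‖x‖, ⟨h1, h2⟩, ‖x‖⁻¹ • x, h3, ?_⟩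
      simp [smul_smul, mul_inv_cancel₀ (show 0 < ‖x‖ from h1).ne']
  rw [h]
  refine ((measurableSet_lt measurable_const measurable_norm).inter
    (measurableSet_lt measurable_norm measurable_const)).inter (hA.preimage ?_)
  fun_prop

/-! ### Hausdorff measure on the sphere, by comparison with tangent planes. -/

/-- The gnomonic projection onto the tangent plane of the unit sphere at `v`. -/
noncomputable def gnomonic {d : ℕ} (v x : E d) : E d := (inner ℝ x v)⁻¹ • x

theorem inner_ge_of_dist_lt {d : ℕ} {v a : E d} {δ : ℝ} (hv : ‖v‖ = 1) (ha : ‖a‖ = 1)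
    (hδ1 : δ < 1) (h : dist a v < δ) : 1 - δ ≤ inner ℝ a v := by
  rw [dist_eq_norm] at h
  have h1 := norm_sub_sq_real a v
  rw [hv, ha] at h1
  nlinarith [norm_nonneg (a - v)]

theorem inner_le_one_of_norm {d : ℕ} {v a : E d} (hv : ‖v‖ = 1) (ha : ‖a‖ = 1) :
    inner ℝ a v ≤ 1 := by
  have := real_inner_le_norm a v
  rwa [hv, ha, one_mul] at this

/-- As `a - b` is orthogonal to `a + b`, the heights of `a` and `b` over the plane `vᗮ` differ by at
most `δ * ‖a - b‖` rather than `‖a - b‖`. This makes the Lipschitz constant tend to one as `δ → 0`.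
-/
theorem lipschitzOnWith_gnomonic {d : ℕ} {v : E d} {δ : ℝ} (hv : ‖v‖ = 1) (hδ : 0 < δ)
    (hδ1 : δ < 1) {A : Set (E d)} (hA : A ⊆ Metric.sphere 0 1 ∩ Metric.ball v δ) :
    LipschitzOnWith (Real.toNNReal ((1 - δ) ^ 2)⁻¹) (gnomonic v) A := by
  refine LipschitzOnWith.of_dist_le_mul fun a ha b hb => ?_
  have ha1 : ‖a‖ = 1 := by simpa using (hA ha).1
  have hb1 : ‖b‖ = 1 := by simpa using (hA hb).1
  have hα := inner_ge_of_dist_lt hv ha1 hδ1 (hA ha).2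
  have hβ := inner_ge_of_dist_lt hv hb1 hδ1 (hA hb).2
  have hc : 0 < 1 - δ := by linarith
  rw [Real.coe_toNNReal _ (by positivity)]
  simp only [gnomonic, dist_eq_norm]
  set α := inner ℝ a v with hαd
  set β := inner ℝ b v with hβd
  have hα0 : 0 < α := by linarith
  have hβ0 : 0 < β := by linarith
  have hαβ : |β - α| ≤ δ * ‖a - b‖ := by
    have h1 : β - α = inner ℝ (a - b) ((1 / 2 : ℝ) • (a - v) + (1 / 2 : ℝ) • (b - v)) := by
      have h2 : inner ℝ (a - b) (a + b) = 0 := by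
        rw [real_inner_comm, (real_inner_add_sub_eq_zero_iff a b).2 (by rw [ha1, hb1])]
      have h3 : (1 / 2 : ℝ) • (a - v) + (1 / 2 : ℝ) • (b - v) = (1 / 2 : ℝ) • (a + b) - v := by
        module
      rw [h3, inner_sub_right, inner_smul_right, h2, inner_sub_left]
      simp [hαd, hβd]
    rw [h1]
    refine (abs_real_inner_le_norm _ _).trans ?_
    rw [mul_comm]
    refine mul_le_mul_of_nonneg_right ?_ (norm_nonneg _)
    have h4 := (hA ha).2
    have h5 := (hA hb).2
    rw [Metric.mem_ball, dist_eq_norm] at h4 h5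
    refine (norm_add_le _ _).trans ?_
    rw [norm_smul, norm_smul]
    norm_num
    linarith
  have hdec : α⁻¹ • a - β⁻¹ • b = α⁻¹ • (a - b) + (α⁻¹ - β⁻¹) • b := by module
  have hinv : α⁻¹ - β⁻¹ = (β - α) * (α⁻¹ * β⁻¹) := by field_simp
  have hαi : α⁻¹ ≤ (1 - δ)⁻¹ := inv_anti₀ hc hα
  have hβi : β⁻¹ ≤ (1 - δ)⁻¹ := inv_anti₀ hc hβ
  calc ‖α⁻¹ • a - β⁻¹ • b‖ ≤ ‖α⁻¹ • (a - b)‖ + ‖(α⁻¹ - β⁻¹) • b‖ := by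
        rw [hdec]; exact norm_add_le _ _
    _ = α⁻¹ * ‖a - b‖ + |β - α| * (α⁻¹ * β⁻¹) := by
        rw [norm_smul, norm_smul, hb1, hinv, Real.norm_eq_abs, Real.norm_eq_abs, abs_mul,
          abs_of_pos (inv_pos.2 hα0), abs_of_pos (mul_pos (inv_pos.2 hα0) (inv_pos.2 hβ0)), mul_one]
    _ ≤ (1 - δ)⁻¹ * ‖a - b‖ + (δ * ‖a - b‖) * ((1 - δ)⁻¹ * (1 - δ)⁻¹) := by gcongr
    _ = ((1 - δ) ^ 2)⁻¹ * ‖a - b‖ := by field_simp; ring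

/-- The radial projection onto the unit sphere does not increase distances outside the ball. -/
theorem norm_normalize_sub_le {d : ℕ} {x y : E d} (hx : 1 ≤ ‖x‖) (hy : 1 ≤ ‖y‖) :
    ‖‖x‖⁻¹ • x - ‖y‖⁻¹ • y‖ ≤ ‖x - y‖ := by
  have hx0 : 0 < ‖x‖ := by linarith
  have hy0 : 0 < ‖y‖ := by linarith
  refine le_of_sq_le_sq ?_ (norm_nonneg _)
  rw [norm_sub_sq_real, norm_sub_sq_real, norm_smul, norm_smul, inner_smul_left, inner_smul_right]
  simp only [norm_inv, norm_norm, inv_mul_cancel₀ hx0.ne', inv_mul_cancel₀ hy0.ne', conj_trivial]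
  have h1 := real_inner_le_norm x y
  set i := inner ℝ x y
  have h2 : ‖x‖⁻¹ * (‖y‖⁻¹ * i) = i / (‖x‖ * ‖y‖) := by field_simp
  rw [h2]
  have h3 : i - ‖x‖ * ‖y‖ ≤ i / (‖x‖ * ‖y‖) - 1 := by
    rw [div_sub_one (by positivity), le_div_iff₀ (by positivity)]
    nlinarith [mul_le_mul hx hy zero_le_one hx0.le]
  nlinarith [sq_nonneg (‖x‖ - ‖y‖)]


theorem euclideanHausdorffMeasure_image_le {d k : ℕ} {f : E d → E d} {K : ℝ≥0} {A : Set (E d)}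
    (hf : LipschitzOnWith K f A) :
    Measure.euclideanHausdorffMeasure k (f '' A) ≤
      (K : ℝ≥0∞) ^ k * Measure.euclideanHausdorffMeasure k A := by
  have h := hf.hausdorffMeasure_image_le (d := (k : ℝ)) (by positivity)
  rw [Measure.euclideanHausdorffMeasure_def, Measure.smul_apply, Measure.smul_apply,
    ENNReal.smul_def, ENNReal.smul_def, smul_eq_mul, smul_eq_mul, mul_left_comm]
  gcongr
  simpa using h

/-- The gnomonic image lies outside the open unit ball, where the radial projection is 1-Lipschitz,
and there the radial projection inverts the gnomonic one. -/
theorem le_gnomonic_image {d : ℕ} {v : E d} {δ : ℝ} (k : ℕ) (hv : ‖v‖ = 1)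
    (hδ1 : δ < 1) {A : Set (E d)} (hA : A ⊆ Metric.sphere 0 1 ∩ Metric.ball v δ) :
    Measure.euclideanHausdorffMeasure k A ≤
      Measure.euclideanHausdorffMeasure k (gnomonic v '' A) := by
  have hG : ∀ a ∈ A, 1 ≤ ‖gnomonic v a‖ ∧ ‖gnomonic v a‖⁻¹ • gnomonic v a = a := by
    intro a ha
    have ha1 : ‖a‖ = 1 := by simpa using (hA ha).1
    have h1 := inner_ge_of_dist_lt hv ha1 hδ1 (hA ha).2
    have h2 := inner_le_one_of_norm hv ha1
    have h0 : 0 < inner ℝ a v := by linarith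
    have h3 : ‖gnomonic v a‖ = (inner ℝ a v)⁻¹ := by
      rw [gnomonic, norm_smul, ha1, mul_one, Real.norm_eq_abs, abs_of_pos (inv_pos.2 h0)]
    refine ⟨?_, ?_⟩
    · rw [h3]; exact (one_le_inv₀ h0).2 h2
    · rw [h3, gnomonic, inv_inv, smul_smul, mul_inv_cancel₀ h0.ne', one_smul]
  have hL : LipschitzOnWith 1 (fun x : E d => ‖x‖⁻¹ • x) (gnomonic v '' A) := by
    refine LipschitzOnWith.of_dist_le_mul ?_
    rintro _ ⟨a, ha, rfl⟩ _ ⟨b, hb, rfl⟩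
    rw [dist_eq_norm, dist_eq_norm, NNReal.coe_one, one_mul]
    exact norm_normalize_sub_le (hG a ha).1 (hG b hb).1
  have h := euclideanHausdorffMeasure_image_le (k := k) hL
  have hI : (fun x : E d => ‖x‖⁻¹ • x) '' (gnomonic v '' A) = A := by
    rw [image_image]
    exact (image_congr fun a ha => (hG a ha).2).trans (image_id' A)
  rw [hI] at h
  simpa using h

-- The point `r • a` of the cone has height `r * ⟨a, v⟩`, so at height `h` it is `h` times the
-- gnomonic image of `a`. Since `r < 1` and `1 - δ ≤ ⟨a, v⟩ ≤ 1`, the slice is complete for `0 < h <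
-- 1 - δ` and empty for `h` outside `(0, 1)`.
open scoped Pointwise in
theorem cone_inter_slice {d : ℕ} {v : E d} {δ : ℝ} (hv : ‖v‖ = 1)
    (hδ1 : δ < 1) {A : Set (E d)} (hA : A ⊆ Metric.sphere 0 1 ∩ Metric.ball v δ) (h : ℝ) :
    ((Ioo (0 : ℝ) 1 • A) ∩ AffineSubspace.mk' (h • v +ᵥ (0 : E d)) (Submodule.span ℝ {v})ᗮ ⊆
      h • (gnomonic v '' A)) ∧
    (h ∉ Ioo (0 : ℝ) 1 →
      (Ioo (0 : ℝ) 1 • A) ∩ AffineSubspace.mk' (h • v +ᵥ (0 : E d)) (Submodule.span ℝ {v})ᗮ = ∅) ∧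
    (h ∈ Ioo (0 : ℝ) (1 - δ) → h • (gnomonic v '' A) ⊆
      (Ioo (0 : ℝ) 1 • A) ∩ AffineSubspace.mk' (h • v +ᵥ (0 : E d)) (Submodule.span ℝ {v})ᗮ) := by
  have hmem : ∀ x : E d, x ∈ (AffineSubspace.mk' (h • v +ᵥ (0 : E d)) (Submodule.span ℝ {v})ᗮ :
      Set (E d)) ↔ inner ℝ x v = h := by
    intro x
    rw [SetLike.mem_coe, AffineSubspace.mem_mk', Submodule.mem_orthogonal_singleton_iff_inner_left]
    simp [inner_sub_left, inner_smul_left, hv, sub_eq_zero]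
  have hin : ∀ a ∈ A, 1 - δ ≤ inner ℝ a v ∧ inner ℝ a v ≤ 1 := by
    intro a ha
    have ha1 : ‖a‖ = 1 := by simpa using (hA ha).1
    exact ⟨inner_ge_of_dist_lt hv ha1 hδ1 (hA ha).2, inner_le_one_of_norm hv ha1⟩
  refine ⟨?_, ?_, ?_⟩
  · rintro _ ⟨⟨r, hr, a, ha, rfl⟩, hx⟩
    simp only [hmem, inner_smul_left, conj_trivial] at hx
    have h0 := hin a ha
    refine ⟨gnomonic v a, ⟨a, ha, rfl⟩, ?_⟩
    have : inner ℝ a v ≠ 0 := by linarith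
    simp only [gnomonic, smul_smul, ← hx]
    rw [mul_assoc, mul_inv_cancel₀ this, mul_one]
  · intro hh
    rw [eq_empty_iff_forall_notMem]
    rintro _ ⟨⟨r, hr, a, ha, rfl⟩, hx⟩
    simp only [hmem, inner_smul_left, conj_trivial] at hx
    have h0 := hin a ha
    exact hh ⟨by rw [← hx]; exact mul_pos hr.1 (by linarith), by rw [← hx]; nlinarith [hr.1, hr.2]⟩
  · rintro hh _ ⟨_, ⟨a, ha, rfl⟩, rfl⟩
    have h0 := hin a ha
    have hp : 0 < inner ℝ a v := by linarith
    refine ⟨⟨h * (inner ℝ a v)⁻¹, ⟨by have := hh.1; positivity, ?_⟩, a, ha, ?_⟩, ?_⟩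
    · rw [← div_eq_mul_inv, div_lt_one hp]; linarith [hh.2]
    · simp [gnomonic, smul_smul]
    · rw [hmem]
      simp only [gnomonic, smul_smul, inner_smul_left, conj_trivial]
      rw [mul_assoc, inv_mul_cancel₀ hp.ne', mul_one]

theorem lintegral_pow_Ioo {c : ℝ} (hc : 0 < c) (k : ℕ) :
    ∫⁻ h in Ioo (0 : ℝ) c, ENNReal.ofReal (h ^ k) = ENNReal.ofReal (c ^ (k + 1) / (k + 1)) := by
  rw [Measure.restrict_congr_set Ioo_ae_eq_Ioc, ← ofReal_integral_eq_lintegral_ofReal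
    (intervalIntegral.intervalIntegrable_pow _).1, ← intervalIntegral.integral_of_le hc.le]
  · simp
  · filter_upwards [ae_restrict_mem measurableSet_Ioc] with y hy
    exact pow_nonneg hy.1.le _

open scoped Pointwise in
theorem volume_cone_eq {d : ℕ} {v : E d} (hv : ‖v‖ = 1)
    {s : Set (Metric.sphere (0 : E d) 1)} (hs : MeasurableSet s) :
    volume (Ioo (0 : ℝ) 1 • (Subtype.val '' s : Set (E d))) = ∫⁻ h : ℝ,
      Measure.euclideanHausdorffMeasure (d - 1) ((Ioo (0 : ℝ) 1 • (Subtype.val '' s : Set (E d))) ∩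
        AffineSubspace.mk' (h • v +ᵥ (0 : E d)) (Submodule.span ℝ {v})ᗮ) := by
  have hv0 : v ≠ 0 := by rintro rfl; simp at hv
  have h := EuclideanGeometry.euclideanHausdorffMeasure_eq_lintegral (0 : E d) hv0
    (measurableSet_cone hs)
  rw [InnerProductSpace.euclideanHausdorffMeasure_eq_volume, finrank_euclideanSpace,
    Fintype.card_fin] at h
  rw [h, enorm_eq_nnnorm]
  have : ‖v‖₊ = 1 := NNReal.eq hv
  simp [this]

open scoped Pointwise in
theorem euclideanHausdorffMeasure_smul_eq {d k : ℕ} {h : ℝ} (hh : 0 < h) (A : Set (E d)) :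
    Measure.euclideanHausdorffMeasure k (h • A) =
      ENNReal.ofReal (h ^ k) * Measure.euclideanHausdorffMeasure k A := by
  rw [Measure.euclideanHausdorffMeasure_smul₀ k hh.ne', ENNReal.smul_def, smul_eq_mul]
  congr 1
  rw [ENNReal.ofReal, ENNReal.coe_inj]
  apply NNReal.eq
  simp [abs_of_pos hh, hh.le]

/-- The sphere measure is `d` times the volume of the cone, and Fubini over the heights expresses
this volume by slices of size `h ^ (d - 1) * H`. Since `d ∫_0^c h^(d-1) dh = c^d`, the two bounds
come from `c = 1` and `c = 1 - δ`. -/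
theorem sphereMeasure_le_gnomonic {d : ℕ} (hd : 0 < d) {v : E d} {δ : ℝ} (hv : ‖v‖ = 1)
    (hδ1 : δ < 1) {s : Set (Metric.sphere (0 : E d) 1)} (hs : MeasurableSet s)
    (hA : (Subtype.val '' s : Set (E d)) ⊆ Metric.sphere 0 1 ∩ Metric.ball v δ) :
    sphereMeasure d s ≤ Measure.euclideanHausdorffMeasure (d - 1) (gnomonic v '' (Subtype.val '' s))
    ∧ ENNReal.ofReal ((1 - δ) ^ d) *
      Measure.euclideanHausdorffMeasure (d - 1) (gnomonic v '' (Subtype.val '' s)) ≤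
      sphereMeasure d s := by
  set H := Measure.euclideanHausdorffMeasure (d - 1) (gnomonic v '' (Subtype.val '' s))
  have hd1 : d - 1 + 1 = d := Nat.sub_add_cancel hd
  have hdr : ((d - 1 : ℕ) : ℝ) + 1 = d := by exact_mod_cast hd1
  have hcoef : ∀ c : ℝ, (d : ℝ≥0∞) * ENNReal.ofReal (c ^ d / d) = ENNReal.ofReal (c ^ d) := by
    intro c
    have : (0 : ℝ) < d := by exact_mod_cast hd
    rw [← ENNReal.ofReal_natCast, ← ENNReal.ofReal_mul this.le]
    congr 1
    field_simp
  have hσ : sphereMeasure d s = d * ∫⁻ h : ℝ, _ :=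
    ((volume : Measure (E d)).toSphere_apply' hs).trans
      (by rw [finrank_euclideanSpace, Fintype.card_fin, volume_cone_eq hv hs])
  rw [hσ]
  constructor
  · calc _ ≤ (d : ℝ≥0∞) * ∫⁻ h : ℝ, (Ioo (0 : ℝ) 1).indicator
          (fun h => ENNReal.ofReal (h ^ (d - 1)) * H) h := by
          gcongr with h
          by_cases hh : h ∈ Ioo (0 : ℝ) 1
          · rw [indicator_of_mem hh, ← euclideanHausdorffMeasure_smul_eq hh.1]
            exact measure_mono (cone_inter_slice hv hδ1 hA h).1
          · rw [(cone_inter_slice hv hδ1 hA h).2.1 hh]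
            simp
      _ = H := by
          rw [lintegral_indicator measurableSet_Ioo, lintegral_mul_const _ (by fun_prop),
            lintegral_pow_Ioo one_pos, hd1, hdr, ← mul_assoc, hcoef]
          simp
  · calc _ = (d : ℝ≥0∞) * ∫⁻ h : ℝ, (Ioo (0 : ℝ) (1 - δ)).indicator
          (fun h => ENNReal.ofReal (h ^ (d - 1)) * H) h := by
          rw [lintegral_indicator measurableSet_Ioo, lintegral_mul_const _ (by fun_prop),
            lintegral_pow_Ioo (by linarith), hd1, hdr, ← mul_assoc, hcoef]
      _ ≤ _ := by
          gcongr with h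
          by_cases hh : h ∈ Ioo (0 : ℝ) (1 - δ)
          · rw [indicator_of_mem hh, ← euclideanHausdorffMeasure_smul_eq hh.1]
            exact measure_mono ((cone_inter_slice hv hδ1 hA h).2.2 hh)
          · rw [indicator_of_notMem hh]
            exact zero_le

/-- The factor `(1 - δ) ^ (2 * d)` covers both losses: the Lipschitz constant `(1 - δ)⁻²` to the
power `d - 1`, and the factor `(1 - δ) ^ d` from the heights beyond `1 - δ`. -/
theorem sphereMeasure_local_compare {d : ℕ} (hd : 0 < d) {v : E d} {δ : ℝ} (hv : ‖v‖ = 1)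
    (hδ : 0 < δ) (hδ1 : δ < 1) {s : Set (Metric.sphere (0 : E d) 1)} (hs : MeasurableSet s)
    (hA : (Subtype.val '' s : Set (E d)) ⊆ Metric.sphere 0 1 ∩ Metric.ball v δ) :
    ENNReal.ofReal ((1 - δ) ^ (2 * d)) * sphereMeasure d s ≤
        Measure.euclideanHausdorffMeasure (d - 1) (Subtype.val '' s : Set (E d)) ∧
    ENNReal.ofReal ((1 - δ) ^ (2 * d)) *
        Measure.euclideanHausdorffMeasure (d - 1) (Subtype.val '' s : Set (E d)) ≤
      sphereMeasure d s := by
  have hc : 0 < 1 - δ := by linarith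
  obtain ⟨h1, h2⟩ := sphereMeasure_le_gnomonic hd hv hδ1 hs hA
  have h3 := le_gnomonic_image (d - 1) hv hδ1 hA
  have h4 := euclideanHausdorffMeasure_image_le (k := d - 1) (lipschitzOnWith_gnomonic hv hδ hδ1 hA)
  constructor
  · have h5 := h1.trans h4
    calc _ ≤ ENNReal.ofReal ((1 - δ) ^ (2 * (d - 1))) * sphereMeasure d s := by
          gcongr ENNReal.ofReal ?_ * _
          exact pow_le_pow_of_le_one hc.le (by linarith) (by omega)
      _ ≤ _ := by
          refine (mul_le_mul_right h5 _).trans (le_of_eq ?_)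
          rw [← mul_assoc]
          convert one_mul _
          change _ * (ENNReal.ofReal _) ^ _ = _
          rw [← ENNReal.ofReal_pow (by positivity), ← ENNReal.ofReal_mul (by positivity),
            ← ENNReal.ofReal_one]
          congr 1
          rw [pow_mul, ← mul_pow, mul_inv_cancel₀ (by positivity), one_pow]
  · calc _ ≤ ENNReal.ofReal ((1 - δ) ^ d) *
          Measure.euclideanHausdorffMeasure (d - 1) (gnomonic v '' (Subtype.val '' s)) := by
          gcongr ENNReal.ofReal ?_ * ?_
          exact pow_le_pow_of_le_one hc.le (by linarith) (by omega)
      _ ≤ _ := h2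

/-- The surface measure on the unit sphere is the Hausdorff measure. -/
theorem euclideanHausdorffMeasure_sphere {d : ℕ} (hd : 0 < d)
    {s : Set (Metric.sphere (0 : E d) 1)} (hs : MeasurableSet s) :
    Measure.euclideanHausdorffMeasure (d - 1) (Subtype.val '' s : Set (E d)) =
      sphereMeasure d s := by
  set ν : Measure (Metric.sphere (0 : E d) 1) :=
    (Measure.euclideanHausdorffMeasure (d - 1) : Measure (E d)).comap Subtype.val with hν
  have hνs : ∀ t, MeasurableSet t → ν t =
      Measure.euclideanHausdorffMeasure (d - 1) (Subtype.val '' t : Set (E d)) := fun t _ =>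
    (MeasurableEmbedding.subtype_coe Metric.isClosed_sphere.measurableSet).comap_apply _ _
  -- Cut the sphere into countably many disjoint Borel pieces, each inside a ball of radius `δ`, and
  -- sum the local comparison; afterwards `δ → 0`.
  have key : ∀ δ : ℝ, 0 < δ → δ < 1 →
      ENNReal.ofReal ((1 - δ) ^ (2 * d)) * sphereMeasure d s ≤ ν s ∧
      ENNReal.ofReal ((1 - δ) ^ (2 * d)) * ν s ≤ sphereMeasure d s := by
    intro δ hδ hδ1
    obtain ⟨T, hTc, hT⟩ := TopologicalSpace.isOpen_iUnion_countable
      (fun v : Metric.sphere (0 : E d) 1 => Metric.ball v δ) (fun v => Metric.isOpen_ball)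
    have hTu : ⋃ v ∈ T, Metric.ball v δ = univ := by
      rw [hT, eq_univ_iff_forall]
      exact fun v => mem_iUnion.2 ⟨v, Metric.mem_ball_self hδ⟩
    rcases T.eq_empty_or_nonempty with rfl | hTne
    · have : s = ∅ := by
        have h0 : (univ : Set (Metric.sphere (0 : E d) 1)) = ∅ := by simpa using hTu.symm
        exact subset_empty_iff.1 (h0 ▸ subset_univ s)
      simp [this]
    obtain ⟨w, hw⟩ := hTc.exists_eq_range hTne
    set D := disjointed fun n => Metric.ball (w n) δ
    have hDm : ∀ n, MeasurableSet (D n) :=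
      fun n => MeasurableSet.disjointed (fun _ => Metric.isOpen_ball.measurableSet) n
    have hDu : ⋃ n, D n = univ := by
      rw [iUnion_disjointed, ← hTu, hw, biUnion_range]
    have hsD : s = ⋃ n, s ∩ D n := by rw [← inter_iUnion, hDu, inter_univ]
    have hdisj : Pairwise (Function.onFun Disjoint fun n => s ∩ D n) := fun i j hij =>
      ((disjoint_disjointed _ hij).mono inter_subset_right inter_subset_right)
    have hm : ∀ n, MeasurableSet (s ∩ D n) := fun n => hs.inter (hDm n)
    have hloc : ∀ n, (Subtype.val '' (s ∩ D n) : Set (E d)) ⊆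
        Metric.sphere 0 1 ∩ Metric.ball (w n : E d) δ := by
      rintro n _ ⟨a, ha, rfl⟩
      exact ⟨a.2, disjointed_subset (fun n => Metric.ball (w n) δ) n ha.2⟩
    have h1 : sphereMeasure d s = ∑' n, sphereMeasure d (s ∩ D n) := by
      conv_lhs => rw [hsD]
      exact measure_iUnion hdisj hm
    have h2 : ν s = ∑' n, ν (s ∩ D n) := by
      conv_lhs => rw [hsD]
      exact measure_iUnion hdisj hm
    have h3 := fun n => sphereMeasure_local_compare hd (norm_sphere (w n)) hδ hδ1 (hm n) (hloc n)
    rw [h1, h2, ← ENNReal.tsum_mul_left, ← ENNReal.tsum_mul_left]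
    constructor
    · exact ENNReal.tsum_le_tsum fun n => by rw [hνs _ (hm n)]; exact (h3 n).1
    · exact ENNReal.tsum_le_tsum fun n => by rw [hνs _ (hm n)]; exact (h3 n).2
  have hlim : Tendsto (fun δ : ℝ => ENNReal.ofReal ((1 - δ) ^ (2 * d))) (𝓝[>] 0) (𝓝 1) := by
    have : Tendsto (fun δ : ℝ => ENNReal.ofReal ((1 - δ) ^ (2 * d))) (𝓝 0)
        (𝓝 (ENNReal.ofReal ((1 - 0) ^ (2 * d)))) := by
      refine ENNReal.tendsto_ofReal ?_
      exact Continuous.tendsto (by fun_prop) 0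
    simpa using this.mono_left nhdsWithin_le_nhds
  have hev : ∀ᶠ δ : ℝ in 𝓝[>] 0, 0 < δ ∧ δ < 1 := Ioo_mem_nhdsGT one_pos
  have hl : ∀ a b : ℝ≥0∞, (∀ δ : ℝ, 0 < δ → δ < 1 → ENNReal.ofReal ((1 - δ) ^ (2 * d)) * a ≤ b) →
      a ≤ b := by
    intro a b hab
    have h1 : Tendsto (fun δ : ℝ => ENNReal.ofReal ((1 - δ) ^ (2 * d)) * a) (𝓝[>] 0) (𝓝 (1 * a)) :=
      ENNReal.Tendsto.mul_const hlim (Or.inl one_ne_zero)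
    rw [one_mul] at h1
    exact le_of_tendsto h1 (hev.mono fun δ hδ => hab δ hδ.1 hδ.2)
  rw [← hνs s hs]
  exact le_antisymm (hl _ _ fun δ h h' => (key δ h h').2) (hl _ _ fun δ h h' => (key δ h h').1)
-- The measure-theoretic boundary and the boundary energy of the exterior of a ball.
theorem limsup_pos_of_ball_subset {d : ℕ} (hd : 0 < d) {A : Set (E d)} {x v : E d} {c : ℝ}
    (hc : 0 < c) (hA : ∀ r : ℝ, 0 < r → r < c → Metric.ball (x + r • v) (r / 2) ⊆
      Metric.closedBall x r ∩ A) :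
    0 < limsup (fun r : ℝ => volume (Metric.closedBall x r ∩ A) /
      volume (Metric.closedBall x r)) (𝓝[>] 0) := by
  have : Nontrivial (E d) := Module.nontrivial_of_finrank_pos (R := ℝ) (by simpa using hd)
  have h1 : ∀ᶠ r : ℝ in 𝓝[>] 0, ENNReal.ofReal ((1 / 2) ^ d) ≤
      volume (Metric.closedBall x r ∩ A) / volume (Metric.closedBall x r) := by
    filter_upwards [Ioo_mem_nhdsGT hc] with r hr
    have h0 : volume (Metric.closedBall x r) ≠ 0 :=
      (Metric.measure_closedBall_pos _ _ hr.1).ne'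
    rw [ENNReal.le_div_iff_mul_le (Or.inl h0) (Or.inl measure_closedBall_lt_top.ne)]
    refine le_trans (le_of_eq ?_) (measure_mono (hA r hr.1 hr.2))
    rw [Measure.addHaar_closedBall _ _ hr.1.le, Measure.addHaar_ball _ (x + r • v) (r := r / 2) (by linarith [hr.1]),
      ← mul_assoc, ← ENNReal.ofReal_mul (by positivity), finrank_euclideanSpace, Fintype.card_fin,
      ← mul_pow]
    congr 3
    ring
  have h2 : 0 < ENNReal.ofReal ((1 / 2) ^ d) := ENNReal.ofReal_pos.2 (by positivity)
  refine h2.trans_le (le_limsup_of_le (by isBoundedDefault) fun b hb => ?_)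
  obtain ⟨r, hr1, hr2⟩ := (h1.and hb).exists
  exact hr1.trans hr2

theorem measBoundary_compl_ball {d : ℕ} (hd : 0 < d) {R : ℝ} (hR : 0 < R) :
    measBoundary (Metric.ball (0 : E d) R)ᶜ = Metric.sphere 0 R := by
  ext x
  constructor
  · rintro ⟨h1, h2⟩
    rw [mem_sphere_zero_iff_norm]
    by_contra hne
    rcases lt_or_gt_of_ne hne with h | h
    · refine h1.ne' ?_
      refine (limsup_congr (v := fun _ => ⊥) ?_).trans limsup_const_bot
      filter_upwards [Ioo_mem_nhdsGT (sub_pos.2 h)] with r hr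
      have : Metric.closedBall x r ∩ (Metric.ball (0 : E d) R)ᶜ = ∅ := by
        rw [eq_empty_iff_forall_notMem]
        rintro y ⟨hy1, hy2⟩
        apply hy2
        rw [mem_ball_zero_iff]
        rw [Metric.mem_closedBall, dist_eq_norm] at hy1
        have := norm_le_norm_add_norm_sub x y
        linarith [hr.2, norm_sub_rev x y]
      simp [this]
    · refine h2.ne' ?_
      refine (limsup_congr (v := fun _ => ⊥) ?_).trans limsup_const_bot
      filter_upwards [Ioo_mem_nhdsGT (sub_pos.2 h)] with r hr
      have : Metric.closedBall x r \ (Metric.ball (0 : E d) R)ᶜ = ∅ := by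
        rw [eq_empty_iff_forall_notMem]
        rintro y ⟨hy1, hy2⟩
        apply hy2
        rw [mem_compl_iff, mem_ball_zero_iff, not_lt]
        rw [Metric.mem_closedBall, dist_eq_norm] at hy1
        have := norm_le_norm_add_norm_sub y x
        linarith [hr.2]
      simp [this]
  · intro hx
    rw [mem_sphere_zero_iff_norm] at hx
    -- For `x` on the sphere, shift by `r / 2` along the outer or inner normal: as `‖x‖ = R`, this
    -- is `r • s • x` with `s = ± 1 / (2 * R)`. The ball of radius `r / 2` around the shifted point
    -- stays in the ball of radius `r` around `x` and on one side of the sphere.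
    have hballs : ∀ s : ℝ, |s| = 1 / (2 * R) → ∀ r : ℝ, 0 < r →
        Metric.ball (x + r • s • x) (r / 2) ⊆ Metric.closedBall x r := by
      intro s hs r hr y hy
      rw [mem_ball_iff_norm] at hy
      rw [mem_closedBall_iff_norm]
      have h1 : ‖r • s • x‖ = r / 2 := by
        rw [norm_smul, norm_smul, hx, Real.norm_eq_abs, Real.norm_eq_abs, hs, abs_of_pos hr]
        field_simp
      have h2 : y - x = (y - (x + r • s • x)) + r • s • x := by module
      rw [h2]
      linarith [norm_add_le (y - (x + r • s • x)) (r • s • x)]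
    have hnorm : ∀ s r : ℝ, 0 ≤ 1 + r * s → ‖x + r • s • x‖ = R + r * (s * R) := by
      intro s r h
      have : x + r • s • x = (1 + r * s) • x := by module
      rw [this, norm_smul, hx, Real.norm_eq_abs, abs_of_nonneg h]
      ring
    constructor
    · refine limsup_pos_of_ball_subset hd (v := (1 / (2 * R)) • x) one_pos fun r hr _ => ?_
      refine subset_inter (hballs _ (abs_of_pos (by positivity)) r hr) fun y hy => ?_
      rw [mem_compl_iff, mem_ball_zero_iff, not_lt]
      rw [mem_ball_iff_norm] at hy
      have h1 := hnorm (1 / (2 * R)) r (by positivity)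
      have h2 : 1 / (2 * R) * R = 1 / 2 := by field_simp
      rw [h2] at h1
      have := norm_le_norm_add_norm_sub y (x + r • (1 / (2 * R)) • x)
      linarith
    · have hR2 : 0 < 2 * R := by linarith
      refine limsup_pos_of_ball_subset (A := ((Metric.ball (0 : E d) R)ᶜ)ᶜ) hd
        (v := (-(1 / (2 * R))) • x) hR2 fun r hr hr2 => ?_
      refine subset_inter (hballs _ (by rw [abs_neg, abs_of_pos (by positivity)]) r hr)
        fun y hy => ?_
      rw [compl_compl, mem_ball_zero_iff]
      rw [mem_ball_iff_norm] at hy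
      have h3 : r * (1 / (2 * R)) < 1 := by rw [mul_one_div, div_lt_one hR2]; exact hr2
      have h1 := hnorm (-(1 / (2 * R))) r (by linarith)
      have h2 : -(1 / (2 * R)) * R = - (1 / 2) := by field_simp
      rw [h2] at h1
      have := norm_le_norm_add_norm_sub (x + r • (-(1 / (2 * R))) • x) y
      rw [norm_sub_rev] at this
      linarith

theorem euclideanHausdorffMeasure_inter_sphere {d : ℕ} (hd : 0 < d) {R : ℝ} (hR : 0 < R)
    {A : Set (E d)} (hA : MeasurableSet A) :
    Measure.euclideanHausdorffMeasure (d - 1) (A ∩ Metric.sphere 0 R) =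
      ENNReal.ofReal (R ^ (d - 1)) * sphereMeasure d {e | R • (e : E d) ∈ A} := by
  have hm : MeasurableSet {e : Metric.sphere (0 : E d) 1 | R • (e : E d) ∈ A} :=
    hA.preimage (by fun_prop)
  rw [← euclideanHausdorffMeasure_sphere hd hm, ← euclideanHausdorffMeasure_smul_eq hR]
  congr 1
  ext x
  constructor
  · rintro ⟨h1, h2⟩
    rw [mem_sphere_zero_iff_norm] at h2
    have h3 : R • (R⁻¹ • x) = x := by rw [smul_smul, mul_inv_cancel₀ hR.ne', one_smul]
    refine ⟨R⁻¹ • x, ⟨⟨R⁻¹ • x, ?_⟩, ?_, rfl⟩, h3⟩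
    · rw [mem_sphere_zero_iff_norm, norm_smul, h2, Real.norm_eq_abs, abs_of_pos (by positivity),
        inv_mul_cancel₀ hR.ne']
    · rw [mem_ofPred_eq]
      change R • (R⁻¹ • x) ∈ A
      rwa [h3]
  · rintro ⟨_, ⟨e, he, rfl⟩, rfl⟩
    refine ⟨he, ?_⟩
    rw [mem_sphere_zero_iff_norm]
    simp [norm_smul, abs_of_pos hR]

theorem boundaryEnergy_compl_ball {d : ℕ} (hd : 0 < d) {γ V R : ℝ} (hγ : 0 ≤ γ + V) (hR : 0 < R)
    {A : Set (E d)} (hA : MeasurableSet A) :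
    boundaryEnergy γ (Metric.ball (0 : E d) R)ᶜ (fun _ => V) A =
      ENNReal.ofReal ((γ + V) * R ^ (d - 1)) * sphereMeasure d {e | R • (e : E d) ∈ A} := by
  rw [boundaryEnergy, withDensity_const, Measure.smul_apply, Measure.restrict_apply hA,
    measBoundary_compl_ball hd hR, euclideanHausdorffMeasure_inter_sphere hd hR hA, smul_eq_mul,
    ← mul_assoc, ENNReal.ofReal_mul hγ]

/-! ### Measurability on path space, and radial paths. -/

namespace Path

variable {d : ℕ} {Γ : Set (E d)}

theorem dist_def (y z : Path Γ) : dist y z = (⨆ t, dist (y t) (z t)) + dist y.theta z.theta := rfl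

theorem dist_apply_le (y z : Path Γ) (t : ℝ≥0) : dist (y t) (z t) ≤ dist y z := by
  rw [dist_def]
  have := le_ciSup (bddAbove_dist y z) t
  have h2 : 0 ≤ dist y.theta z.theta := dist_nonneg
  linarith

theorem dist_theta_le (y z : Path Γ) : dist y.theta z.theta ≤ dist y z := by
  rw [dist_def]
  have : 0 ≤ ⨆ t, dist (y t) (z t) := Real.iSup_nonneg fun _ => dist_nonneg
  linarith

theorem continuous_theta : Continuous (theta : Path Γ → ℝ≥0) :=
  (LipschitzWith.of_dist_le_mul (K := 1) fun y z => by simpa using dist_theta_le y z).continuous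

theorem continuous_eval : Continuous fun p : Path Γ × ℝ≥0 => p.1 p.2 := by
  refine (LipschitzWith.of_dist_le_mul (K := 2) fun p q => ?_).continuous
  have h1 := dist_apply_le p.1 q.1 p.2
  have h2 : dist (q.1 p.2) (q.1 q.2) ≤ dist p.2 q.2 := by
    simpa using q.1.lipschitz.dist_le_mul p.2 q.2
  have h3 : dist p.1 q.1 ≤ dist p q := le_max_left _ _
  have h4 : dist p.2 q.2 ≤ dist p q := le_max_right _ _
  have h5 := dist_triangle (p.1 p.2) (q.1 p.2) (q.1 q.2)
  simp only [NNReal.coe_ofNat]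
  linarith

@[fun_prop]
theorem measurable_theta : Measurable (theta : Path Γ → ℝ≥0) := continuous_theta.measurable

theorem measurable_eval : Measurable fun p : Path Γ × ℝ≥0 => p.1 p.2 := continuous_eval.measurable

@[fun_prop]
theorem measurable_eval_comp {α : Type*} [MeasurableSpace α] {f : α → Path Γ} {g : α → ℝ≥0}
    (hf : Measurable f) (hg : Measurable g) : Measurable fun x => f x (g x) :=
  measurable_eval.comp (hf.prodMk hg)

theorem theta_mem (y : Path Γ) : y y.theta ∈ closure Γ := by
  have : IsClosed {s | y s ∈ closure Γ} := isClosed_closure.preimage y.lipschitz.continuous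
  exact this.csInf_mem y.hits (OrderBot.bddBelow _)

theorem measurable_lintegral_path {f : E d → ℝ≥0∞} (hf : Measurable f) {α : Type*}
    [MeasurableSpace α] {y : α → Path Γ} {a b : α → ℝ} (hy : Measurable y) (ha : Measurable a)
    (hb : Measurable b) :
    Measurable fun x => ∫⁻ t in Ioc (a x) (b x), f (y x t.toNNReal) := by
  have h : ∀ x, ∫⁻ t in Ioc (a x) (b x), f (y x t.toNNReal) =
      ∫⁻ t : ℝ, {q : α × ℝ | a q.1 < q.2 ∧ q.2 ≤ b q.1}.indicator
        (fun q => f (y q.1 q.2.toNNReal)) (x, t) := by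
    intro x
    rw [← lintegral_indicator measurableSet_Ioc]
    rfl
  simp_rw [h]
  refine Measurable.lintegral_prod_right' (f := {q : α × ℝ | a q.1 < q.2 ∧ q.2 ≤ b q.1}.indicator
        (fun q => f (y q.1 q.2.toNNReal))) ?_
  refine Measurable.indicator (by fun_prop) ?_
  have h1 : MeasurableSet {q : α × ℝ | a q.1 < q.2} :=
    measurableSet_lt (ha.comp measurable_fst) measurable_snd
  have h2 : MeasurableSet {q : α × ℝ | q.2 ≤ b q.1} :=
    measurableSet_le measurable_snd (hb.comp measurable_fst)
  exact h1.inter h2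

theorem measurable_cost {L : E d → ℝ} (hL : Measurable L) :
    Measurable fun y : Path Γ => y.cost L :=
  measurable_lintegral_path (f := fun x => ENNReal.ofReal (L x)) (by fun_prop) measurable_id
    measurable_const (by fun_prop)

/-- The time a path spends at given radii between `‖y 0‖` and `‖y θ‖` is at least the length
of the set of radii. -/
theorem lintegral_norm_le (y : Path Γ) {g : ℝ → ℝ≥0∞} (hg : Measurable g) :
    ∫⁻ r in Ioc ‖y 0‖ ‖y y.theta‖, g r ≤ ∫⁻ t in Ioc (0 : ℝ) y.theta, g ‖y t.toNNReal‖ := by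
  set ψ : ℝ → ℝ := fun t => ‖y t.toNNReal‖ with hψ
  have hψL : LipschitzWith 1 ψ := by
    have h := (lipschitzWith_one_norm (E := E d)).comp (y.lipschitz.comp Real.lipschitzWith_toNNReal)
    rwa [one_mul, one_mul] at h
  have hψm : Measurable ψ := hψL.continuous.measurable
  have hle : volume.restrict (Ioc ‖y 0‖ ‖y y.theta‖) ≤
      (volume.restrict (Ioc (0 : ℝ) y.theta)).map ψ := by
    refine Measure.le_iff.2 fun B hB => ?_
    rw [Measure.map_apply hψm hB, Measure.restrict_apply hB,
      Measure.restrict_apply (hψm hB)]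
    -- Every radius in the range is attained, by the intermediate value theorem, and a 1-Lipschitz
    -- map does not increase one-dimensional measure.
    have hsub : B ∩ Ioc ‖y 0‖ ‖y y.theta‖ ⊆ ψ '' (ψ ⁻¹' B ∩ Ioc (0 : ℝ) y.theta) := by
      rintro b ⟨hb, hb1, hb2⟩
      have h0 : ψ 0 = ‖y 0‖ := by simp [hψ]
      have h1 : ψ y.theta = ‖y y.theta‖ := by simp [hψ]
      have hmem : b ∈ Icc (ψ 0) (ψ y.theta) := ⟨by rw [h0]; exact hb1.le, by rwa [h1]⟩
      obtain ⟨t, ht, htb⟩ := intermediate_value_Icc y.theta.coe_nonneg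
        hψL.continuous.continuousOn hmem
      refine ⟨t, ⟨by rw [mem_preimage, htb]; exact hb, lt_of_le_of_ne ht.1 ?_, ht.2⟩, htb⟩
      rintro rfl
      rw [h0] at htb
      exact hb1.ne htb
    refine (measure_mono hsub).trans ?_
    have := (hψL.lipschitzOnWith (s := ψ ⁻¹' B ∩ Ioc (0 : ℝ) y.theta)).hausdorffMeasure_image_le
      zero_le_one
    simpa [hausdorffMeasure_real] using this
  calc ∫⁻ r in Ioc ‖y 0‖ ‖y y.theta‖, g r
      ≤ ∫⁻ r, g r ∂((volume.restrict (Ioc (0 : ℝ) y.theta)).map ψ) := lintegral_mono' hle le_rfl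
    _ = _ := lintegral_map hg hψm

/-- The path that runs from `a • e` radially outward to the sphere of radius `R`. -/
noncomputable def radial {R : ℝ} (hR : 0 < R) (e : Metric.sphere (0 : E d) 1) (a : ℝ) :
    Path (Metric.ball (0 : E d) R)ᶜ where
  -- The cutoff `max a 0` makes the path defined for every real `a`, jointly continuously in `e` and
  -- `a`; the particles only use `0 < a < R`.
  toFun t := min (max a 0 + t) R • (e : E d)
  lipschitz := by
    refine LipschitzWith.of_dist_le_mul fun s t => ?_
    rw [dist_eq_norm, ← sub_smul, norm_smul, norm_sphere, mul_one, NNReal.coe_one, one_mul,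
      NNReal.dist_eq, Real.norm_eq_abs]
    refine (abs_min_sub_min_le_max _ _ _ _).trans ?_
    simp
  hits := by
    refine ⟨R.toNNReal, subset_closure ?_⟩
    have : min (max a 0 + R.toNNReal) R = R := by
      rw [Real.coe_toNNReal _ hR.le]
      exact min_eq_right (by linarith [le_max_right a 0])
    rw [mem_compl_iff, mem_ball_zero_iff, not_lt, this, norm_smul, norm_sphere, mul_one,
      Real.norm_eq_abs, abs_of_pos hR]
  stops := by
    have h : ∀ s : ℝ≥0, min (max a 0 + s) R • (e : E d) ∈ closure (Metric.ball (0 : E d) R)ᶜ ↔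
        R ≤ max a 0 + s := by
      intro s
      have h0 : 0 ≤ min (max a 0 + s) R := le_min (by positivity) hR.le
      rw [Metric.isOpen_ball.isClosed_compl.closure_eq, mem_compl_iff, mem_ball_zero_iff, not_lt,
        norm_smul, norm_sphere, mul_one, Real.norm_eq_abs, abs_of_nonneg h0]
      simp
    intro t ht
    have h1 : sInf {s : ℝ≥0 | min (max a 0 + s) R • (e : E d) ∈ closure (Metric.ball (0 : E d) R)ᶜ}
        = (R - max a 0).toNNReal := by
      have : {s : ℝ≥0 | min (max a 0 + s) R • (e : E d) ∈ closure (Metric.ball (0 : E d) R)ᶜ} =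
          Ici (R - max a 0).toNNReal := by
        ext s
        rw [mem_ofPred_eq, h, mem_Ici, Real.toNNReal_le_iff_le_coe, sub_le_iff_le_add']
      rw [this, csInf_Ici]
    rw [h1] at ht ⊢
    have h2 : R - max a 0 ≤ t := Real.toNNReal_le_iff_le_coe.1 ht
    rw [min_eq_right (by linarith), min_eq_right]
    linarith [Real.le_coe_toNNReal (R - max a 0)]

section radial

variable {R : ℝ} (hR : 0 < R) (e : Metric.sphere (0 : E d) 1) (a : ℝ)

theorem radial_apply (t : ℝ≥0) : radial hR e a t = min (max a 0 + t) R • (e : E d) := rfl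

theorem radial_theta : (radial hR e a).theta = (R - max a 0).toNNReal := by
  have : {s : ℝ≥0 | radial hR e a s ∈ closure (Metric.ball (0 : E d) R)ᶜ} =
      Ici (R - max a 0).toNNReal := by
    ext s
    have h0 : 0 ≤ min (max a 0 + s) R := le_min (by positivity) hR.le
    rw [mem_ofPred_eq, radial_apply, Metric.isOpen_ball.isClosed_compl.closure_eq, mem_compl_iff,
      mem_ball_zero_iff, not_lt, norm_smul, norm_sphere, mul_one, Real.norm_eq_abs,
      abs_of_nonneg h0, mem_Ici, Real.toNNReal_le_iff_le_coe, sub_le_iff_le_add']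
    simp
  rw [theta, this, csInf_Ici]

theorem continuous_radial :
    Continuous fun p : Metric.sphere (0 : E d) 1 × ℝ => radial hR p.1 p.2 := by
  refine (LipschitzWith.of_dist_le_mul (K := R.toNNReal + 2) fun p q => ?_).continuous
  have h3 : dist p.1 q.1 ≤ dist p q := le_max_left _ _
  have h4 : |p.2 - q.2| ≤ dist p q := le_max_right _ _
  have hm : |max p.2 0 - max q.2 0| ≤ |p.2 - q.2| := by
    simpa using abs_max_sub_max_le_max p.2 0 q.2 0
  rw [dist_def]
  have h1 : (⨆ t, dist (radial hR p.1 p.2 t) (radial hR q.1 q.2 t)) ≤ (R + 1) * dist p q := by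
    refine ciSup_le fun t => ?_
    have h5 : radial hR p.1 p.2 t - radial hR q.1 q.2 t =
        min (max p.2 0 + t) R • ((p.1 : E d) - q.1) +
        (min (max p.2 0 + t) R - min (max q.2 0 + t) R) • (q.1 : E d) := by
      simp only [radial_apply]; module
    have h0 : 0 ≤ min (max p.2 0 + t) R := le_min (by positivity) hR.le
    have h6 : |min (max p.2 0 + t) R - min (max q.2 0 + t) R| ≤ dist p q := by
      refine (abs_min_sub_min_le_max _ _ _ _).trans ?_
      simpa using hm.trans h4
    rw [dist_eq_norm, h5]
    refine (norm_add_le _ _).trans ?_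
    rw [norm_smul, norm_smul, norm_sphere, mul_one, Real.norm_eq_abs, Real.norm_eq_abs,
      abs_of_nonneg h0, ← dist_eq_norm, ← Subtype.dist_eq]
    have h7 := min_le_right (max p.2 0 + t) R
    nlinarith [dist_nonneg (x := p.1) (y := q.1)]
  have h2 : dist (radial hR p.1 p.2).theta (radial hR q.1 q.2).theta ≤ dist p q := by
    rw [radial_theta, radial_theta]
    have := Real.lipschitzWith_toNNReal.dist_le_mul (R - max p.2 0) (R - max q.2 0)
    refine this.trans ?_
    rw [NNReal.coe_one, one_mul, Real.dist_eq, sub_sub_sub_cancel_left, abs_sub_comm]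
    exact hm.trans h4
  rw [NNReal.coe_add, Real.coe_toNNReal _ hR.le, NNReal.coe_ofNat]
  linarith

@[fun_prop]
theorem measurable_radial {α : Type*} [MeasurableSpace α] {f : α → Metric.sphere (0 : E d) 1}
    {g : α → ℝ} (hf : Measurable f) (hg : Measurable g) :
    Measurable fun x => radial hR (f x) (g x) :=
  (continuous_radial hR).measurable.comp (hf.prodMk hg)

end radial

end Path

/-! ### One-dimensional particle flux with exponential killing. -/

/-- Data of a radial particle flux between the radii `ρ` and `R`: the flux is `m0` at `ρ`, its
derivative is `g`, and it exceeds `γ r ^ k` at the radius `r`. The rate `lam` is large enough for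
the flux to be produced by particles that are killed at this rate. -/
structure FluxData where
  k : ℕ
  ρ : ℝ
  R : ℝ
  γ : ℝ
  lam : ℝ
  m0 : ℝ
  g : ℝ → ℝ
  ρ_pos : 0 < ρ
  ρ_lt : ρ < R
  γ_pos : 0 < γ
  lam_pos : 0 < lam
  measurable_g : Measurable g
  int_g : ∀ a b, IntervalIntegrable g volume a b
  flux_gt : ∀ r ∈ Icc ρ R, γ * r ^ k < m0 + ∫ z in ρ..r, g z
  rate : ∀ r ∈ Icc ρ R, 0 ≤ g r + lam * (m0 + ∫ z in ρ..r, g z)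

namespace FluxData

variable (D : FluxData)

/-- The flux through the sphere of radius `r`. -/
noncomputable def m (r : ℝ) : ℝ := D.m0 + ∫ z in D.ρ..r, D.g z

theorem R_pos : 0 < D.R := D.ρ_pos.trans D.ρ_lt

theorem continuous_m : Continuous D.m :=
  continuous_const.add (intervalIntegral.continuous_primitive D.int_g D.ρ)

@[fun_prop]
theorem measurable_m : Measurable D.m := D.continuous_m.measurable

theorem m_ρ : D.m D.ρ = D.m0 := by simp [m]

theorem m_gt {r : ℝ} (hr : r ∈ Icc D.ρ D.R) : D.γ * r ^ D.k < D.m r := D.flux_gt r hr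

theorem m_pos {r : ℝ} (hr : r ∈ Icc D.ρ D.R) : 0 < D.m r := by
  have h1 := D.m_gt hr
  have h2 : 0 < r := D.ρ_pos.trans_le hr.1
  have := D.γ_pos
  exact lt_trans (by positivity) h1

theorem rate_nonneg {r : ℝ} (hr : r ∈ Icc D.ρ D.R) : 0 ≤ D.g r + D.lam * D.m r := D.rate r hr

theorem m0_pos : 0 < D.m0 := by
  rw [← D.m_ρ]
  exact D.m_pos ⟨le_rfl, D.ρ_lt.le⟩

/-- The law of the starting radii. -/
noncomputable def start : Measure ℝ :=
  ENNReal.ofReal D.m0 • Measure.dirac D.ρ +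
    (volume.restrict (Ioo D.ρ D.R)).withDensity fun r => ENNReal.ofReal (D.g r + D.lam * D.m r)

theorem measurable_rate : Measurable fun r => ENNReal.ofReal (D.g r + D.lam * D.m r) := by
  have := D.measurable_g
  fun_prop

theorem lintegral_start {h : ℝ → ℝ≥0∞} (hh : Measurable h) :
    ∫⁻ a, h a ∂D.start = ENNReal.ofReal D.m0 * h D.ρ +
      ∫⁻ r in Ioo D.ρ D.R, ENNReal.ofReal (D.g r + D.lam * D.m r) * h r := by
  rw [start, lintegral_add_measure, lintegral_smul_measure, lintegral_dirac' _ hh,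
    lintegral_withDensity_eq_lintegral_mul _ D.measurable_rate hh]
  rfl

theorem int_rate (a b : ℝ) :
    IntervalIntegrable (fun r => D.g r + D.lam * D.m r) volume a b :=
  (D.int_g a b).add ((D.continuous_m.const_mul _).intervalIntegrable a b)

theorem ae_deriv_m {r : ℝ} : ∀ᵐ x, x ∈ uIcc D.ρ r → deriv D.m x = D.g x := by
  filter_upwards [(D.int_g D.ρ r).ae_hasDerivAt_integral] with x hx hmem
  exact ((hx hmem D.ρ left_mem_uIcc).const_add D.m0).deriv

/-- The integrand is the derivative of `m(a) * exp (lam * a)`. As `g` is merely integrable, `m` is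
only absolutely continuous, and the product rule is used in integrated form. -/
theorem integral_rate_exp (r : ℝ) :
    ∫ a in D.ρ..r, (D.g a + D.lam * D.m a) * Real.exp (D.lam * a) =
      D.m r * Real.exp (D.lam * r) - D.m0 * Real.exp (D.lam * D.ρ) := by
  have h1 : AbsolutelyContinuousOnInterval D.m D.ρ r := by
    have hc : AbsolutelyContinuousOnInterval (fun _ : ℝ => D.m0) D.ρ r :=
      (contDiff_const (n := 1)).contDiffOn.absolutelyContinuousOnInterval
    exact hc.add ((D.int_g D.ρ r).absolutelyContinuousOnInterval_intervalIntegral left_mem_uIcc)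
  have h2 : AbsolutelyContinuousOnInterval (fun a => Real.exp (D.lam * a)) D.ρ r := by
    refine ContDiffOn.absolutelyContinuousOnInterval (ContDiff.contDiffOn ?_)
    fun_prop
  rw [← D.m_ρ, ← h1.integral_deriv_mul_eq_sub h2]
  refine intervalIntegral.integral_congr_ae ?_
  filter_upwards [D.ae_deriv_m (r := r)] with x hx hmem
  have h3 : deriv (fun a => Real.exp (D.lam * a)) x = D.lam * Real.exp (D.lam * x) := by
    have := ((hasDerivAt_id x).const_mul D.lam).exp
    rw [mul_comm]
    simpa using this.deriv
  rw [hx (uIoc_subset_uIcc hmem), h3]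
  ring

theorem lintegral_start_Iio_of_le {r : ℝ} (hr : r ≤ D.ρ) {h : ℝ → ℝ≥0∞} (hh : Measurable h) :
    ∫⁻ a, (Iio r).indicator h a ∂D.start = 0 := by
  rw [D.lintegral_start (hh.indicator measurableSet_Iio),
    indicator_of_notMem (by simpa using hr), mul_zero, zero_add]
  refine (setLIntegral_congr_fun measurableSet_Ioo fun a ha => ?_).trans lintegral_zero
  have : a ∉ Iio r := by simpa using hr.trans ha.1.le
  simp only [indicator_of_notMem this, mul_zero]

/-- The flux of the particles that are killed at the rate `lam`. -/
theorem lintegral_start_survival {r : ℝ} (hr : D.ρ < r) (hr' : r ≤ D.R) :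
    ∫⁻ a, (Iio r).indicator (fun a => ENNReal.ofReal (Real.exp (-(D.lam * (r - a))))) a ∂D.start =
      ENNReal.ofReal (D.m r) := by
  rw [D.lintegral_start (Measurable.indicator (by fun_prop) measurableSet_Iio),
    indicator_of_mem (by simpa using hr)]
  have h1 : ∫⁻ a in Ioo D.ρ D.R, ENNReal.ofReal (D.g a + D.lam * D.m a) *
      (Iio r).indicator (fun a => ENNReal.ofReal (Real.exp (-(D.lam * (r - a))))) a =
      ∫⁻ a in Ioo D.ρ r,
        ENNReal.ofReal ((D.g a + D.lam * D.m a) * Real.exp (-(D.lam * (r - a)))) := by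
    rw [← lintegral_indicator measurableSet_Ioo, ← lintegral_indicator measurableSet_Ioo]
    refine lintegral_congr fun a => ?_
    by_cases ha : a ∈ Ioo D.ρ r
    · have ha2 : a ∈ Ioo D.ρ D.R := ⟨ha.1, ha.2.trans_le hr'⟩
      rw [indicator_of_mem ha, indicator_of_mem ha2, indicator_of_mem (by simpa using ha.2),
        ENNReal.ofReal_mul (D.rate_nonneg ⟨ha.1.le, ha2.2.le⟩)]
    · rw [indicator_of_notMem ha]
      by_cases ha2 : a ∈ Ioo D.ρ D.R
      · rw [indicator_of_mem ha2, indicator_of_notMem (show a ∉ Iio r from fun h => ha ⟨ha2.1, h⟩), mul_zero]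
      · rw [indicator_of_notMem ha2]
  have hexp : ∀ a, Real.exp (-(D.lam * (r - a))) =
      Real.exp (D.lam * a) * Real.exp (-(D.lam * r)) := by
    intro a; rw [← Real.exp_add]; ring_nf
  have hint : IntervalIntegrable
      (fun a => (D.g a + D.lam * D.m a) * Real.exp (-(D.lam * (r - a)))) volume D.ρ r :=
    (D.int_rate _ _).mul_continuousOn (by fun_prop)
  have hnn : ∀ a ∈ Ioc D.ρ r, 0 ≤ (D.g a + D.lam * D.m a) * Real.exp (-(D.lam * (r - a))) :=
    fun a ha => mul_nonneg (D.rate_nonneg ⟨ha.1.le, ha.2.trans hr'⟩) (Real.exp_pos _).le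
  rw [h1, Measure.restrict_congr_set Ioo_ae_eq_Ioc, ← ofReal_integral_eq_lintegral_ofReal hint.1
    (by filter_upwards [ae_restrict_mem measurableSet_Ioc] with a ha using hnn a ha),
    ← ENNReal.ofReal_mul D.m0_pos.le, ← ENNReal.ofReal_add
      (mul_nonneg D.m0_pos.le (Real.exp_pos _).le)
      (setIntegral_nonneg measurableSet_Ioc hnn), ← intervalIntegral.integral_of_le hr.le]
  simp_rw [hexp, ← mul_assoc]
  rw [intervalIntegral.integral_mul_const, integral_rate_exp, ← add_mul, add_sub_cancel, mul_assoc,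
    ← Real.exp_add]
  simp

instance : SFinite D.start := by unfold start; infer_instance

theorem start_lt_top : D.start univ < ⊤ := by
  have h := D.lintegral_start (h := 1) measurable_one
  simp only [Pi.one_apply, lintegral_one, mul_one] at h
  rw [h, Measure.restrict_congr_set Ioo_ae_eq_Ioc]
  refine ENNReal.add_lt_top.2 ⟨ENNReal.ofReal_lt_top, ?_⟩
  exact (D.int_rate D.ρ D.R).1.lintegral_lt_top

instance : IsFiniteMeasure D.start := ⟨D.start_lt_top⟩

theorem ae_start : ∀ᵐ a ∂D.start, a ∈ Ico D.ρ D.R := by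
  rw [ae_iff, ← lintegral_indicator_one (by measurability : MeasurableSet {a | ¬ a ∈ Ico D.ρ D.R}),
    D.lintegral_start (measurable_one.indicator (by measurability)),
    indicator_of_notMem (by simpa using D.ρ_lt), mul_zero, zero_add]
  refine (setLIntegral_congr_fun measurableSet_Ioo fun a ha => ?_).trans lintegral_zero
  have : a ∉ {a | ¬ a ∈ Ico D.ρ D.R} := fun h => h ⟨ha.1.le, ha.2⟩
  simp only [indicator_of_notMem this, mul_zero]

/-- By Tonelli the inner integral at fixed `r` counts the particles started below `r`, each weighted
with its probability of surviving up to `r`; this is the flux `m r`. -/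
theorem lintegral_flux {h : ℝ → ℝ≥0∞} (hh : Measurable h) :
    ∫⁻ a, (∫⁻ r in Ioo a D.R, ENNReal.ofReal (Real.exp (-(D.lam * (r - a)))) * h r) ∂D.start =
      ∫⁻ r in Ioo D.ρ D.R, ENNReal.ofReal (D.m r) * h r := by
  have h1 : ∀ a, ∫⁻ r in Ioo a D.R, ENNReal.ofReal (Real.exp (-(D.lam * (r - a)))) * h r =
      ∫⁻ r in Iio D.R, (Iio r).indicator
        (fun a => ENNReal.ofReal (Real.exp (-(D.lam * (r - a))))) a * h r := by
    intro a
    rw [← lintegral_indicator measurableSet_Ioo, ← lintegral_indicator measurableSet_Iio]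
    refine lintegral_congr fun r => ?_
    by_cases h1 : a < r <;> by_cases h2 : r < D.R <;> simp [indicator, h1, h2]
  have hm : Measurable fun p : ℝ × ℝ => (Iio p.2).indicator
      (fun a => ENNReal.ofReal (Real.exp (-(D.lam * (p.2 - a))))) p.1 := by
    have : (fun p : ℝ × ℝ => (Iio p.2).indicator
      (fun a => ENNReal.ofReal (Real.exp (-(D.lam * (p.2 - a))))) p.1) =
      {p : ℝ × ℝ | p.1 < p.2}.indicator
        fun p => ENNReal.ofReal (Real.exp (-(D.lam * (p.2 - p.1)))) := by
      ext p; simp [indicator]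
    rw [this]
    exact Measurable.indicator (by fun_prop) (measurableSet_lt measurable_fst measurable_snd)
  simp_rw [h1]
  rw [lintegral_lintegral_swap (Measurable.aemeasurable (hm.mul (hh.comp measurable_snd)))]
  rw [← lintegral_indicator measurableSet_Iio, ← lintegral_indicator measurableSet_Ioo]
  refine lintegral_congr fun r => ?_
  by_cases h2 : r < D.R
  · rw [indicator_of_mem (by simpa using h2), lintegral_mul_const _
      (Measurable.indicator (by fun_prop) measurableSet_Iio)]
    by_cases h3 : D.ρ < r
    · rw [indicator_of_mem (by exact ⟨h3, h2⟩), D.lintegral_start_survival h3 h2.le]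
    · rw [indicator_of_notMem (fun h => h3 h.1), D.lintegral_start_Iio_of_le (not_lt.1 h3)
        (by fun_prop), zero_mul]
  · rw [indicator_of_notMem (by simpa using h2), indicator_of_notMem (fun h => h2 h.2)]

/-- The law of the exponential clocks. -/
noncomputable abbrev clock : Measure ℝ := ProbabilityTheory.expMeasure D.lam

instance : IsProbabilityMeasure D.clock :=
  ProbabilityTheory.isProbabilityMeasure_expMeasure D.lam_pos

theorem clock_eq : D.clock = volume.withDensity (ProbabilityTheory.exponentialPDF D.lam) := rfl

theorem lintegral_clock {h : ℝ → ℝ≥0∞} (hh : Measurable h) :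
    ∫⁻ s, h s ∂D.clock =
      ∫⁻ s in Ioi 0, ENNReal.ofReal (D.lam * Real.exp (-(D.lam * s))) * h s := by
  have hp : Measurable (ProbabilityTheory.exponentialPDF D.lam) :=
    (ProbabilityTheory.measurable_exponentialPDFReal D.lam).ennreal_ofReal
  rw [clock_eq, lintegral_withDensity_eq_lintegral_mul _ hp hh,
    Measure.restrict_congr_set Ioi_ae_eq_Ici, ← lintegral_indicator measurableSet_Ici]
  refine lintegral_congr fun s => ?_
  rw [Pi.mul_apply]
  by_cases hs : 0 ≤ s
  · rw [indicator_of_mem (by simpa using hs), ProbabilityTheory.exponentialPDF_of_nonneg hs]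
  · rw [indicator_of_notMem (by simpa using hs), ProbabilityTheory.exponentialPDF_of_neg
      (not_le.1 hs), zero_mul]

theorem ae_clock : ∀ᵐ s ∂D.clock, 0 < s := by
  have hms : MeasurableSet {s : ℝ | ¬ 0 < s} := (measurableSet_lt measurable_const measurable_id).compl
  rw [ae_iff, ← lintegral_indicator_one hms, D.lintegral_clock (measurable_one.indicator hms)]
  refine (setLIntegral_congr_fun measurableSet_Ioi fun a ha => ?_).trans lintegral_zero
  have : a ∉ {s : ℝ | ¬ 0 < s} := fun h => h ha
  simp only [indicator_of_notMem this, mul_zero]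

theorem clock_Ici {t : ℝ} (ht : 0 ≤ t) :
    D.clock (Ici t) = ENNReal.ofReal (Real.exp (-(D.lam * t))) := by
  have h1 : D.clock (Ici t) = D.clock (Ioi t) := by
    have hac : D.clock ≪ volume := by rw [clock_eq]; exact withDensity_absolutelyContinuous _ _
    exact (measure_congr (hac.ae_eq Ioi_ae_eq_Ici)).symm
  have h2 := ProbabilityTheory.ofReal_cdf D.clock t
  rw [ProbabilityTheory.cdf_expMeasure_eq D.lam_pos, if_pos ht] at h2
  have h3 := prob_compl_eq_one_sub (μ := D.clock) (measurableSet_Iic (a := t))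
  rw [h1, ← compl_Iic, h3, ← h2, ← ENNReal.ofReal_one, ← ENNReal.ofReal_sub]
  · simp
  · have : Real.exp (-(D.lam * t)) ≤ 1 :=
      Real.exp_le_one_iff.2 (by have := D.lam_pos; nlinarith)
    linarith

/-- At unit speed, time is radius: a particle started at `a` is still alive at `a + t` with
probability `exp (-lam * t)`. So the occupation density in the radius equals the flux. -/
theorem lintegral_occupation {h : ℝ → ℝ≥0∞} (hh : Measurable h) :
    ∫⁻ a, ∫⁻ s, (∫⁻ t in Ioc 0 (min s (D.R - a)), h (a + t)) ∂D.clock ∂D.start =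
      ∫⁻ r in Ioo D.ρ D.R, ENNReal.ofReal (D.m r) * h r := by
  rw [← D.lintegral_flux hh]
  refine lintegral_congr fun a => ?_
  have h1 : ∀ s, ∫⁻ t in Ioc 0 (min s (D.R - a)), h (a + t) =
      ∫⁻ t in Ioc 0 (D.R - a), (Iic s).indicator (fun t => h (a + t)) t := by
    intro s
    rw [← lintegral_indicator measurableSet_Ioc, ← lintegral_indicator measurableSet_Ioc]
    refine lintegral_congr fun t => ?_
    by_cases h1 : 0 < t <;> by_cases h2 : t ≤ s <;> by_cases h3 : t ≤ D.R - a <;>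
      simp [indicator, h1, h2, h3]
  simp_rw [h1]
  have hm : Measurable fun p : ℝ × ℝ => (Iic p.1).indicator (fun t => h (a + t)) p.2 := by
    have : (fun p : ℝ × ℝ => (Iic p.1).indicator (fun t => h (a + t)) p.2) =
      {p : ℝ × ℝ | p.2 ≤ p.1}.indicator fun p => h (a + p.2) := by
      ext p; simp [indicator]
    rw [this]
    exact Measurable.indicator (by fun_prop) (measurableSet_le measurable_snd measurable_fst)
  rw [lintegral_lintegral_swap hm.aemeasurable]
  have h2 : ∀ t ∈ Ioc 0 (D.R - a), ∫⁻ s, (Iic s).indicator (fun t => h (a + t)) t ∂D.clock =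
      ENNReal.ofReal (Real.exp (-(D.lam * t))) * h (a + t) := by
    intro t ht
    have : ∀ s, (Iic s).indicator (fun t => h (a + t)) t =
        (Ici t).indicator (fun _ => h (a + t)) s := by
      intro s; simp [indicator]
    simp_rw [this]
    rw [lintegral_indicator measurableSet_Ici, setLIntegral_const, D.clock_Ici ht.1.le, mul_comm]
  rw [setLIntegral_congr_fun measurableSet_Ioc h2, ← Measure.restrict_congr_set Ioo_ae_eq_Ioc,
    ← lintegral_indicator measurableSet_Ioo, ← lintegral_indicator measurableSet_Ioo,
    ← lintegral_add_left_eq_self (μ := volume) ((Ioo a D.R).indicator _) a]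
  refine lintegral_congr fun t => ?_
  by_cases h3 : 0 < t <;> by_cases h4 : t < D.R - a <;>
    simp [indicator, h3, h4, ← lt_sub_iff_add_lt']

/-- Killing at the constant rate `lam` turns the occupation density `m` into the density `lam * m`
of the places of death; a clock longer than `R - a` never kills. -/
theorem lintegral_killed {h : ℝ → ℝ≥0∞} (hh : Measurable h) :
    ∫⁻ a, ∫⁻ s, (Iio (D.R - a)).indicator (fun s => h (a + s)) s ∂D.clock ∂D.start =
      ENNReal.ofReal D.lam * ∫⁻ r in Ioo D.ρ D.R, ENNReal.ofReal (D.m r) * h r := by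
  rw [← D.lintegral_flux hh, ← lintegral_const_mul']
  swap
  · exact ENNReal.ofReal_ne_top
  refine lintegral_congr fun a => ?_
  rw [D.lintegral_clock (Measurable.indicator (by fun_prop) measurableSet_Iio),
    ← lintegral_const_mul' _ _ ENNReal.ofReal_ne_top, ← lintegral_indicator measurableSet_Ioo,
    ← lintegral_indicator measurableSet_Ioi, ← lintegral_add_left_eq_self (μ := volume) ((Ioo a D.R).indicator _) a]
  refine lintegral_congr fun t => ?_
  by_cases h3 : 0 < t <;> by_cases h4 : t < D.R - a <;>
    simp [indicator, h3, h4, ← lt_sub_iff_add_lt', ENNReal.ofReal_mul D.lam_pos.le, mul_assoc]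

theorem lintegral_survive :
    ∫⁻ a, D.clock (Ici (D.R - a)) ∂D.start = ENNReal.ofReal (D.m D.R) := by
  rw [← D.lintegral_start_survival D.ρ_lt le_rfl]
  refine lintegral_congr_ae ?_
  filter_upwards [D.ae_start] with a ha
  rw [D.clock_Ici (by linarith [ha.2]), indicator_of_mem (by simpa using ha.2)]

end FluxData

/-! ### The slowness profile and the travel time of the front. -/

namespace FluxData

variable (D : FluxData)

open Classical in
/-- The radial profile of the function `L`: the inverse speed of the front between the radii `ρ`
and `R`, and `-1 / γ` elsewhere. -/
noncomputable def profile (r : ℝ) : ℝ :=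
  -- The value `-1 / γ` makes `1 + γ L` vanish where there are no particles. The positive values
  -- occupy a closed set of radii, as upper semicontinuity of `L` requires.
  if r ∈ Icc D.ρ D.R then r ^ D.k / (D.m r - D.γ * r ^ D.k) else -1 / D.γ

theorem profile_of_mem {r : ℝ} (hr : r ∈ Icc D.ρ D.R) :
    D.profile r = r ^ D.k / (D.m r - D.γ * r ^ D.k) := if_pos hr

theorem profile_of_notMem {r : ℝ} (hr : r ∉ Icc D.ρ D.R) : D.profile r = -1 / D.γ := if_neg hr

@[fun_prop]
theorem measurable_profile : Measurable D.profile := by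
  unfold profile
  refine Measurable.ite measurableSet_Icc ?_ measurable_const
  fun_prop

theorem profile_pos {r : ℝ} (hr : r ∈ Icc D.ρ D.R) : 0 < D.profile r := by
  rw [D.profile_of_mem hr]
  have h1 := D.m_gt hr
  have h2 : 0 < r := D.ρ_pos.trans_le hr.1
  exact div_pos (by positivity) (by linarith)

theorem profile_neg {r : ℝ} (hr : r ∉ Icc D.ρ D.R) : D.profile r < 0 := by
  rw [D.profile_of_notMem hr]
  exact div_neg_of_neg_of_pos (by norm_num) D.γ_pos

theorem continuousOn_profile : ContinuousOn D.profile (Icc D.ρ D.R) := by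
  have h : ContinuousOn (fun r => r ^ D.k / (D.m r - D.γ * r ^ D.k)) (Icc D.ρ D.R) := by
    refine ContinuousOn.div (by fun_prop) (D.continuous_m.continuousOn.sub (by fun_prop)) ?_
    intro r hr
    have h1 := D.m_gt hr
    exact (by linarith : 0 < D.m r - D.γ * r ^ D.k).ne'
  exact h.congr fun r hr => D.profile_of_mem hr

theorem exists_profile_bound : ∃ B : ℝ, ∀ r, |D.profile r| ≤ B := by
  obtain ⟨B, hB⟩ := isCompact_Icc.exists_bound_of_continuousOn D.continuousOn_profile
  refine ⟨max B |-1 / D.γ|, fun r => ?_⟩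
  by_cases hr : r ∈ Icc D.ρ D.R
  · exact (hB r hr).trans (le_max_left _ _)
  · rw [D.profile_of_notMem hr]; exact le_max_right _ _

/-- The time at which the front reaches the radius `r`. -/
noncomputable def time (r : ℝ) : ℝ≥0∞ := ∫⁻ z in Ioc r D.R, ENNReal.ofReal (D.profile z)

theorem antitone_time : Antitone D.time := fun _ _ h =>
  lintegral_mono_set (Ioc_subset_Ioc_left h)

@[fun_prop]
theorem measurable_time : Measurable D.time := D.antitone_time.measurable

theorem time_lt_top (r : ℝ) : D.time r < ⊤ := by
  obtain ⟨B, hB⟩ := D.exists_profile_bound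
  refine (setLIntegral_mono measurable_const fun z _ =>
    ENNReal.ofReal_le_ofReal ((le_abs_self _).trans (hB z))).trans_lt ?_
  rw [setLIntegral_const, Real.volume_Ioc]
  exact ENNReal.mul_lt_top ENNReal.ofReal_lt_top ENNReal.ofReal_lt_top

/-- The intervals `(r + 1/(n+1), R]` increase to `(r, R]`. The strict room in the radius later shows
that a whole neighbourhood of a point has not been reached. -/
theorem exists_lt_time {r : ℝ} {t : ℝ≥0∞} (h : t < D.time r) : ∃ r' > r, t < D.time r' := by
  have h1 : Ioc r D.R = ⋃ n : ℕ, Ioc (r + 1 / ((n : ℝ) + 1)) D.R := by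
    ext z
    simp only [mem_iUnion, mem_Ioc, exists_and_right]
    refine and_congr_left fun _ => ⟨fun hz => ?_, fun ⟨n, hn⟩ => ?_⟩
    · obtain ⟨n, hn⟩ := exists_nat_one_div_lt (sub_pos.2 hz)
      exact ⟨n, by linarith⟩
    · have : (0 : ℝ) < 1 / ((n : ℝ) + 1) := by positivity
      linarith
  have hmono : Monotone fun n : ℕ => Ioc (r + 1 / ((n : ℝ) + 1)) D.R := fun i j hij =>
    Ioc_subset_Ioc_left (by
      have := one_div_le_one_div_of_le (α := ℝ) (by positivity : (0 : ℝ) < (i : ℝ) + 1)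
        (by gcongr : (i : ℝ) + 1 ≤ (j : ℝ) + 1)
      linarith)
  rw [time, h1, setLIntegral_iUnion_of_directed _ hmono.directed_le, lt_iSup_iff] at h
  obtain ⟨n, hn⟩ := h
  have : (0 : ℝ) < 1 / ((n : ℝ) + 1) := by positivity
  exact ⟨r + 1 / ((n : ℝ) + 1), by linarith, hn⟩

theorem time_eq_Ioo {r : ℝ} (hr : D.ρ ≤ r) : D.time r = ∫⁻ z in Ioo r D.R,
    ENNReal.ofReal (z ^ D.k) / ENNReal.ofReal (D.m z - D.γ * z ^ D.k) := by
  rw [time, ← Measure.restrict_congr_set Ioo_ae_eq_Ioc]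
  refine setLIntegral_congr_fun measurableSet_Ioo fun z hz => ?_
  have hz' : z ∈ Icc D.ρ D.R := ⟨hr.trans hz.1.le, hz.2.le⟩
  have h1 := D.m_gt hz'
  rw [D.profile_of_mem hz', ENNReal.ofReal_div_of_pos (by linarith)]

/-! ### The particle system in space. -/

section space

variable (d : ℕ)

/-- The function `L` of the radial equilibrium. -/
noncomputable def slowness (x : E d) : ℝ := D.profile ‖x‖

@[fun_prop]
theorem measurable_slowness : Measurable (D.slowness d) :=
  D.measurable_profile.comp measurable_norm

/-- Extending the profile continuously by its end values gives a positive continuous majorant `G`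
that agrees with `L` on the closed annulus; on the open complement `L` is a negative constant. -/
theorem upperSemicontinuous_slowness : UpperSemicontinuous (D.slowness d) := by
  set G : E d → ℝ := fun x => D.profile (projIcc D.ρ D.R D.ρ_lt.le ‖x‖) with hG
  have hGc : Continuous G :=
    (continuousOn_iff_continuous_domRestrict.1 D.continuousOn_profile).comp
      (continuous_projIcc.comp continuous_norm)
  have hmem : ∀ x : E d, ‖x‖ ∈ Icc D.ρ D.R → G x = D.slowness d x := by
    intro x hx
    simp only [hG, slowness, projIcc_of_mem D.ρ_lt.le hx]
  have hle : ∀ x, D.slowness d x ≤ G x := by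
    intro x
    by_cases hx : ‖x‖ ∈ Icc D.ρ D.R
    · rw [hmem x hx]
    · exact (D.profile_neg hx).le.trans (D.profile_pos (Subtype.prop _)).le
  intro x y hy
  by_cases hx : ‖x‖ ∈ Icc D.ρ D.R
  · rw [← hmem x hx] at hy
    filter_upwards [hGc.continuousAt.eventually_lt continuousAt_const hy] with z hz
    exact (hle z).trans_lt hz
  · have ho : ∀ᶠ z : E d in 𝓝 x, ‖z‖ ∉ Icc D.ρ D.R :=
      (isClosed_Icc.preimage continuous_norm).isOpen_compl.mem_nhds hx
    filter_upwards [ho] with z hz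
    rw [slowness, D.profile_of_notMem hz]
    rwa [slowness, D.profile_of_notMem hx] at hy

/-- The joint law of the directions, the starting radii and the clocks. -/
noncomputable def law : Measure (Metric.sphere (0 : E d) 1 × ℝ × ℝ) :=
  (sphereMeasure d).prod (D.start.prod D.clock)

/-- The path and the killing time of a particle with given direction, starting radius and clock. -/
noncomputable def particle (q : Metric.sphere (0 : E d) 1 × ℝ × ℝ) :
    Path (Metric.ball (0 : E d) D.R)ᶜ × ℝ≥0 :=
  (Path.radial D.R_pos q.1 q.2.1,
    min q.2.2.toNNReal (Path.radial D.R_pos q.1 q.2.1).theta)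

theorem measurable_particle : Measurable (D.particle d) := by
  unfold particle
  fun_prop

/-- The law of the particles, not normalized. -/
noncomputable def mass : Measure (Path (Metric.ball (0 : E d) D.R)ᶜ × ℝ≥0) :=
  (D.law d).map (D.particle d)

instance : IsFiniteMeasure (D.law d) := by unfold law; infer_instance

instance : IsFiniteMeasure (D.mass d) := by unfold mass; infer_instance

theorem lintegral_mass {f : Path (Metric.ball (0 : E d) D.R)ᶜ × ℝ≥0 → ℝ≥0∞} (hf : Measurable f) :
    ∫⁻ p, f p ∂D.mass d =
      ∫⁻ e, ∫⁻ a, ∫⁻ s, f (D.particle d (e, a, s)) ∂D.clock ∂D.start ∂sphereMeasure d := by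
  have h : Measurable fun q => f (D.particle d q) := hf.comp (D.measurable_particle d)
  rw [mass, lintegral_map hf (D.measurable_particle d), law, lintegral_prod _ h.aemeasurable]
  refine lintegral_congr fun e => ?_
  rw [lintegral_prod]
  exact (h.comp measurable_prodMk_left).aemeasurable

theorem ae_law : ∀ᵐ q ∂D.law d, q.2.1 ∈ Ico D.ρ D.R ∧ 0 < q.2.2 := by
  have h1 : ∀ᵐ q ∂D.start.prod D.clock, q.1 ∈ Ico D.ρ D.R ∧ 0 < q.2 := by
    filter_upwards [Measure.quasiMeasurePreserving_fst.ae D.ae_start,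
      Measure.quasiMeasurePreserving_snd.ae D.ae_clock] with q h1 h2 using ⟨h1, h2⟩
  exact Measure.quasiMeasurePreserving_snd.ae h1

theorem ae_mass {P : Path (Metric.ball (0 : E d) D.R)ᶜ × ℝ≥0 → Prop} (hP : MeasurableSet {p | P p})
    (h : ∀ e a s, a ∈ Ico D.ρ D.R → 0 < s → P (D.particle d (e, a, s))) :
    ∀ᵐ p ∂D.mass d, P p := by
  rw [mass, ae_map_iff (D.measurable_particle d).aemeasurable hP]
  filter_upwards [D.ae_law d] with q hq
  exact h q.1 q.2.1 q.2.2 hq.1 hq.2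

variable {d}

theorem particle_theta {e : Metric.sphere (0 : E d) 1} {a s : ℝ} (ha : a ∈ Ico D.ρ D.R) :
    ((D.particle d (e, a, s)).1.theta : ℝ) = D.R - a := by
  have h0 : 0 < a := D.ρ_pos.trans_le ha.1
  rw [particle, Path.radial_theta, max_eq_left h0.le, Real.coe_toNNReal _ (by linarith [ha.2])]

theorem particle_snd {e : Metric.sphere (0 : E d) 1} {a s : ℝ} (ha : a ∈ Ico D.ρ D.R)
    (hs : 0 < s) : ((D.particle d (e, a, s)).2 : ℝ) = min s (D.R - a) := by
  rw [← D.particle_theta (e := e) (s := s) ha, particle]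
  simp [hs.le]

theorem particle_apply {e : Metric.sphere (0 : E d) 1} {a s : ℝ} (ha : a ∈ Ico D.ρ D.R) {t : ℝ≥0}
    (ht : t ≤ D.R - a) : (D.particle d (e, a, s)).1 t = (a + t) • (e : E d) := by
  have h0 : 0 < a := D.ρ_pos.trans_le ha.1
  rw [particle, Path.radial_apply, max_eq_left h0.le, min_eq_left (by linarith)]

theorem particle_zero {e : Metric.sphere (0 : E d) 1} {a s : ℝ} (ha : a ∈ Ico D.ρ D.R) :
    (D.particle d (e, a, s)).1 0 = a • (e : E d) := by
  rw [D.particle_apply ha (by rw [NNReal.coe_zero]; linarith [ha.2]), NNReal.coe_zero, add_zero]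

theorem particle_end {e : Metric.sphere (0 : E d) 1} {a s : ℝ} (ha : a ∈ Ico D.ρ D.R) :
    (D.particle d (e, a, s)).1 (D.particle d (e, a, s)).1.theta = D.R • (e : E d) := by
  rw [D.particle_apply ha (D.particle_theta ha).le, D.particle_theta ha, add_sub_cancel]

theorem norm_smul_sphere {e : Metric.sphere (0 : E d) 1} {r : ℝ} (hr : 0 ≤ r) :
    ‖r • (e : E d)‖ = r := by
  rw [norm_smul, norm_sphere, mul_one, Real.norm_eq_abs, abs_of_nonneg hr]

theorem particle_tailCost {e : Metric.sphere (0 : E d) 1} {a s : ℝ} (ha : a ∈ Ico D.ρ D.R)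
    (t : ℝ≥0) : (D.particle d (e, a, s)).1.tailCost (D.slowness d) t = D.time (a + t) := by
  have h0 : 0 < a := D.ρ_pos.trans_le ha.1
  rw [Path.tailCost, time, D.particle_theta ha, ← lintegral_indicator measurableSet_Ioc,
    ← lintegral_indicator measurableSet_Ioc,
    ← lintegral_add_left_eq_self (μ := volume) ((Ioc (a + (t : ℝ)) D.R).indicator _) a]
  refine lintegral_congr fun z => ?_
  by_cases hz : z ∈ Ioc (t : ℝ) (D.R - a)
  · have hz2 : a + z ∈ Ioc (a + (t : ℝ)) D.R := ⟨by linarith [hz.1], by linarith [hz.2]⟩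
    have hz0 : 0 ≤ z := t.coe_nonneg.trans hz.1.le
    rw [indicator_of_mem hz, indicator_of_mem hz2, D.particle_apply ha
      (by rw [Real.coe_toNNReal _ hz0]; exact hz.2), Real.coe_toNNReal _ hz0, slowness,
      norm_smul_sphere (by linarith)]
  · have hz2 : a + z ∉ Ioc (a + (t : ℝ)) D.R :=
      fun h => hz ⟨by linarith [h.1], by linarith [h.2]⟩
    rw [indicator_of_notMem hz, indicator_of_notMem hz2]

theorem particle_cost {e : Metric.sphere (0 : E d) 1} {a s : ℝ} (ha : a ∈ Ico D.ρ D.R) :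
    (D.particle d (e, a, s)).1.cost (D.slowness d) =
      D.time ‖(D.particle d (e, a, s)).1 0‖ := by
  rw [Path.cost, D.particle_tailCost ha, D.particle_zero ha,
    norm_smul_sphere (D.ρ_pos.le.trans ha.1), NNReal.coe_zero, add_zero]

/-- No path reaches the boundary at a smaller cost than the radial one. -/
theorem time_le_cost (y : Path (Metric.ball (0 : E d) D.R)ᶜ) :
    D.time ‖y 0‖ ≤ y.cost (D.slowness d) := by
  have h1 := y.lintegral_norm_le (g := fun r => ENNReal.ofReal (D.profile r)) (by fun_prop)
  have h2 : D.R ≤ ‖y y.theta‖ := by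
    have := y.theta_mem
    rwa [Metric.isOpen_ball.isClosed_compl.closure_eq, mem_compl_iff, mem_ball_zero_iff,
      not_lt] at this
  exact (lintegral_mono_set (Ioc_subset_Ioc_right h2)).trans h1

theorem lintegral_annulus (hd : 0 < d) (hk : D.k = d - 1) {f : E d → ℝ≥0∞} (hf : Measurable f) :
    ∫⁻ x in {x | D.ρ ≤ ‖x‖ ∧ ‖x‖ < D.R}, f x =
      ∫⁻ e, (∫⁻ r in Ioo D.ρ D.R, ENNReal.ofReal (r ^ D.k) * f (r • (e : E d)))
        ∂sphereMeasure d := by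
  have hm : MeasurableSet {x : E d | D.ρ ≤ ‖x‖ ∧ ‖x‖ < D.R} :=
    (measurableSet_le measurable_const measurable_norm).inter
      (measurableSet_lt measurable_norm measurable_const)
  rw [← lintegral_indicator hm, lintegral_polar hd (hf.indicator hm), ← hk]
  refine lintegral_congr fun e => ?_
  rw [Measure.restrict_congr_set Ioo_ae_eq_Ico, ← lintegral_indicator measurableSet_Ioi,
    ← lintegral_indicator measurableSet_Ico]
  refine lintegral_congr fun r => ?_
  by_cases hr : r ∈ Ico D.ρ D.R
  · have h0 : 0 < r := D.ρ_pos.trans_le hr.1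
    rw [indicator_of_mem hr, indicator_of_mem (by simpa using h0), indicator_of_mem]
    rw [mem_ofPred_eq, norm_smul_sphere h0.le]
    exact hr
  · rw [indicator_of_notMem hr]
    by_cases h0 : 0 < r
    · rw [indicator_of_mem (by simpa using h0), indicator_of_notMem, mul_zero]
      rw [mem_ofPred_eq, norm_smul_sphere h0.le]
      exact hr
    · rw [indicator_of_notMem (by simpa using h0)]

/-- Per direction the occupation density in the radius is `m r`, and dividing by the polar Jacobian
`r ^ k` gives the density in space. -/
theorem lintegral_occupation_mass (hd : 0 < d) (hk : D.k = d - 1) {f : E d → ℝ≥0∞}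
    (hf : Measurable f) :
    ∫⁻ p, (∫⁻ t in Ioc (0 : ℝ) p.2, f (p.1 t.toNNReal)) ∂D.mass d =
      ∫⁻ x in {x | D.ρ ≤ ‖x‖ ∧ ‖x‖ < D.R}, ENNReal.ofReal (D.m ‖x‖ / ‖x‖ ^ D.k) * f x := by
  rw [D.lintegral_mass d (Path.measurable_lintegral_path hf (by fun_prop) measurable_const
    (by fun_prop)), D.lintegral_annulus hd hk (by fun_prop)]
  refine lintegral_congr fun e => ?_
  have h1 : ∫⁻ r in Ioo D.ρ D.R, ENNReal.ofReal (r ^ D.k) *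
      (ENNReal.ofReal (D.m ‖r • (e : E d)‖ / ‖r • (e : E d)‖ ^ D.k) * f (r • (e : E d))) =
      ∫⁻ r in Ioo D.ρ D.R, ENNReal.ofReal (D.m r) * f (r • (e : E d)) := by
    refine setLIntegral_congr_fun measurableSet_Ioo fun r hr => ?_
    have h0 : 0 < r := D.ρ_pos.trans hr.1
    rw [norm_smul_sphere h0.le, ← mul_assoc, ← ENNReal.ofReal_mul (by positivity)]
    congr 2
    field_simp
  rw [h1, ← D.lintegral_occupation (h := fun r => f (r • (e : E d))) (by fun_prop)]
  refine lintegral_congr_ae ?_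
  filter_upwards [D.ae_start] with a ha
  refine lintegral_congr_ae ?_
  filter_upwards [D.ae_clock] with s hs
  rw [D.particle_snd ha hs]
  refine setLIntegral_congr_fun measurableSet_Ioc fun t ht => ?_
  rw [D.particle_apply ha, Real.coe_toNNReal _ ht.1.le]
  rw [Real.coe_toNNReal _ ht.1.le]
  exact ht.2.trans (min_le_right _ _)

end space

end FluxData

/-! ### The radial system is an equilibrium. -/

namespace FluxData

variable (D : FluxData) (d : ℕ)

/-- The equilibrium of the radial particle system. -/
noncomputable def triple : Triple (Metric.ball (0 : E d) D.R)ᶜ where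
  κ := (D.mass d univ).toReal
  Q := (D.mass d univ)⁻¹ • D.mass d
  L := D.slowness d

theorem start_singleton : ENNReal.ofReal D.m0 ≤ D.start {D.ρ} := by
  rw [start, Measure.add_apply, Measure.smul_apply, Measure.dirac_apply_of_mem (mem_singleton _),
    smul_eq_mul, mul_one]
  exact le_self_add

variable {d}

theorem mass_univ_pos (hd : 0 < d) : 0 < D.mass d univ := by
  have : Nontrivial (E d) := Module.nontrivial_of_finrank_pos (R := ℝ) (by simpa using hd)
  have h1 : (sphereMeasure d) univ ≠ 0 := by
    rw [Ne, Measure.measure_univ_eq_zero]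
    exact Measure.toSphere_ne_zero _
  have h2 : 0 < D.start univ := (ENNReal.ofReal_pos.2 D.m0_pos).trans_le
    (D.start_singleton.trans (measure_mono (subset_univ _)))
  rw [mass, Measure.map_apply (D.measurable_particle d) .univ, preimage_univ, law,
    ← univ_prod_univ, Measure.prod_prod, ← univ_prod_univ, Measure.prod_prod,
    measure_univ (μ := D.clock), mul_one]
  exact ENNReal.mul_pos h1 h2.ne'

theorem kappa_smul_Q (hd : 0 < d) :
    ENNReal.ofReal (D.triple d).κ • (D.triple d).Q = D.mass d := by
  simp only [triple]
  rw [ENNReal.ofReal_toReal (measure_ne_top _ _), smul_smul,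
    ENNReal.mul_inv_cancel (D.mass_univ_pos hd).ne' (measure_ne_top _ _), one_smul]

theorem kappa_pos (hd : 0 < d) : 0 < (D.triple d).κ :=
  ENNReal.toReal_pos (D.mass_univ_pos hd).ne' (measure_ne_top _ _)

theorem isProbabilityMeasure_Q (hd : 0 < d) : IsProbabilityMeasure (D.triple d).Q := by
  constructor
  simp only [triple, Measure.smul_apply, smul_eq_mul]
  exact ENNReal.inv_mul_cancel (D.mass_univ_pos hd).ne' (measure_ne_top _ _)

theorem ae_Q {P : Path (Metric.ball (0 : E d) D.R)ᶜ × ℝ≥0 → Prop}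
    (h : ∀ᵐ p ∂D.mass d, P p) : ∀ᵐ p ∂(D.triple d).Q, P p :=
  Measure.ae_smul_measure h _

theorem mass_real (hd : 0 < d) (S : Set (Path (Metric.ball (0 : E d) D.R)ᶜ × ℝ≥0)) :
    (D.triple d).κ * (D.triple d).Q.real S = (D.mass d).real S := by
  rw [← D.kappa_smul_Q hd, measureReal_ennreal_smul_apply,
    ENNReal.toReal_ofReal (D.kappa_pos hd).le]

theorem measurableSet_annulus : MeasurableSet {x : E d | D.ρ ≤ ‖x‖ ∧ ‖x‖ < D.R} :=
  (measurableSet_le measurable_const measurable_norm).inter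
    (measurableSet_lt measurable_norm measurable_const)

/-- The radial particles attain the lower bound `time ‖y 0‖`, which holds for every path and whose
expectation depends only on the law of `y 0`. -/
theorem triple_optimal (Q' : Measure (Path (Metric.ball (0 : E d) D.R)ᶜ × ℝ≥0))
    (h : ∀ A : Set (E d), MeasurableSet A →
      Q' {p | p.1 0 ∈ A} = (D.triple d).Q {p | p.1 0 ∈ A}) :
    ∫⁻ p, p.1.cost (D.triple d).L ∂(D.triple d).Q ≤ ∫⁻ p, p.1.cost (D.triple d).L ∂Q' := by
  have hm : Measurable fun p : Path (Metric.ball (0 : E d) D.R)ᶜ × ℝ≥0 => p.1 0 := by fun_prop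
  have hmap : Q'.map (fun p => p.1 0) = (D.triple d).Q.map (fun p => p.1 0) := by
    ext A hA
    rw [Measure.map_apply hm hA, Measure.map_apply hm hA]
    exact h A hA
  have hL : Measurable (D.triple d).L := D.measurable_slowness d
  have h1 : ∀ᵐ p ∂(D.triple d).Q, p.1.cost (D.triple d).L = D.time ‖p.1 0‖ := by
    refine D.ae_Q (D.ae_mass d ?_ fun e a s ha _ => D.particle_cost ha)
    exact measurableSet_eq_fun ((Path.measurable_cost hL).comp measurable_fst)
      (D.measurable_time.comp hm.norm)
  calc ∫⁻ p, p.1.cost (D.triple d).L ∂(D.triple d).Q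
      = ∫⁻ p, D.time ‖p.1 0‖ ∂(D.triple d).Q := lintegral_congr_ae h1
    _ = ∫⁻ x, D.time ‖x‖ ∂((D.triple d).Q.map (fun p => p.1 0)) :=
        (lintegral_map (f := fun x : E d => D.time ‖x‖) (by fun_prop) hm).symm
    _ = ∫⁻ p, D.time ‖p.1 0‖ ∂Q' := by
        rw [← hmap]; exact lintegral_map (f := fun x : E d => D.time ‖x‖) (by fun_prop) hm
    _ ≤ _ := lintegral_mono fun p => D.time_le_cost p.1

theorem ae_mass_theta : ∀ᵐ p ∂D.mass d, p.2 ≤ p.1.theta := by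
  refine D.ae_mass d (measurableSet_le measurable_snd
    (Path.measurable_theta.comp measurable_fst)) fun e a s ha hs => ?_
  exact min_le_right _ _

theorem ae_mass_cost :
    ∀ᵐ p ∂D.mass d, p.1.cost (D.slowness d) ≤ D.time D.ρ := by
  refine D.ae_mass d (measurableSet_le
    ((Path.measurable_cost (D.measurable_slowness d)).comp measurable_fst) measurable_const)
    fun e a s ha hs => ?_
  rw [D.particle_cost ha, D.particle_zero ha, norm_smul_sphere (D.ρ_pos.le.trans ha.1)]
  exact D.antitone_time ha.1

theorem ae_mass_end : ∀ᵐ p ∂D.mass d, p.1 p.1.theta ∈ Metric.sphere (0 : E d) D.R := by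
  refine D.ae_mass d ?_ fun e a s ha hs => ?_
  · exact Metric.isClosed_sphere.measurableSet.preimage (by fun_prop)
  · rw [D.particle_end ha, mem_sphere_zero_iff_norm, norm_smul_sphere D.R_pos.le]

/-- The density of the occupation measure of the particles. -/
theorem occupation_density (hd : 0 < d) (hk : D.k = d - 1) :
    (((D.mass d).prod volume).restrict
      {q : (Path (Metric.ball (0 : E d) D.R)ᶜ × ℝ≥0) × ℝ | 0 < q.2 ∧ q.2 ≤ q.1.2}).map
        (fun q => q.1.1 q.2.toNNReal) =
      (volume.restrict {x : E d | D.ρ ≤ ‖x‖ ∧ ‖x‖ < D.R}).withDensity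
        fun x => ENNReal.ofReal (D.m ‖x‖ / ‖x‖ ^ D.k) := by
  have hS : MeasurableSet
      {q : (Path (Metric.ball (0 : E d) D.R)ᶜ × ℝ≥0) × ℝ | 0 < q.2 ∧ q.2 ≤ q.1.2} :=
    (measurableSet_lt measurable_const measurable_snd).inter
      (measurableSet_le measurable_snd (by fun_prop))
  refine Measure.ext_of_lintegral _ fun f hf => ?_
  rw [lintegral_map hf (by fun_prop), lintegral_withDensity_eq_lintegral_mul _ (by fun_prop) hf,
    ← lintegral_indicator hS, lintegral_prod _
      (Measurable.aemeasurable (Measurable.indicator (by fun_prop) hS))]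
  refine Eq.trans ?_ (D.lintegral_occupation_mass hd hk hf)
  refine lintegral_congr fun p => ?_
  rw [← lintegral_indicator measurableSet_Ioc]
  rfl

theorem integrableOn_density :
    IntegrableOn (fun x : E d => D.m ‖x‖ / ‖x‖ ^ D.k) {x : E d | D.ρ ≤ ‖x‖ ∧ ‖x‖ < D.R} := by
  have hc : ContinuousOn (fun x : E d => D.m ‖x‖ / ‖x‖ ^ D.k)
      (Metric.closedBall 0 D.R \ Metric.ball 0 D.ρ) := by
    refine ContinuousOn.div (D.continuous_m.comp continuous_norm).continuousOn
      (by fun_prop) fun x hx => ?_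
    have : D.ρ ≤ ‖x‖ := by simpa using hx.2
    have := D.ρ_pos
    exact pow_ne_zero _ (by linarith)
  have hK : IsCompact (Metric.closedBall (0 : E d) D.R \ Metric.ball 0 D.ρ) :=
    (isCompact_closedBall _ _).diff Metric.isOpen_ball
  have hi : IntegrableOn _ _ volume := hc.integrableOn_compact hK
  exact hi.mono_set fun x hx => ⟨by simpa using hx.2.le, by simpa using hx.1⟩

/-- A signed version of the occupation formula: the space-time law of the living particles is
finite, so bounded functions may be integrated against its image and Fubini applies. -/
theorem integral_occupation (hd : 0 < d) (hk : D.k = d - 1) {f : E d → ℝ} (hf : Measurable f)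
    {B : ℝ} (hB : ∀ x, |f x| ≤ B) :
    ∫ p, (∫ t in Ioc (0 : ℝ) p.2, f (p.1 t.toNNReal)) ∂D.mass d =
      ∫ x in {x : E d | D.ρ ≤ ‖x‖ ∧ ‖x‖ < D.R}, D.m ‖x‖ / ‖x‖ ^ D.k * f x := by
  have hS : MeasurableSet
      {q : (Path (Metric.ball (0 : E d) D.R)ᶜ × ℝ≥0) × ℝ | 0 < q.2 ∧ q.2 ≤ q.1.2} :=
    (measurableSet_lt measurable_const measurable_snd).inter
      (measurableSet_le measurable_snd (by fun_prop))
  have hev : Measurable fun q : (Path (Metric.ball (0 : E d) D.R)ᶜ × ℝ≥0) × ℝ =>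
    q.1.1 q.2.toNNReal := by fun_prop
  have hocc := D.occupation_density hd hk
  set N := (((D.mass d).prod volume).restrict
      {q : (Path (Metric.ball (0 : E d) D.R)ᶜ × ℝ≥0) × ℝ | 0 < q.2 ∧ q.2 ≤ q.1.2}).map
        (fun q => q.1.1 q.2.toNNReal) with hN
  have hpos : ∀ x : E d, x ∈ {x : E d | D.ρ ≤ ‖x‖ ∧ ‖x‖ < D.R} → 0 ≤ D.m ‖x‖ / ‖x‖ ^ D.k :=
    fun x hx => div_nonneg (D.m_pos ⟨hx.1, hx.2.le⟩).le (by positivity)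
  have hfin : IsFiniteMeasure N := by
    rw [hocc]
    refine isFiniteMeasure_withDensity_ofReal ?_
    exact (D.integrableOn_density).hasFiniteIntegral
  have hfN : Integrable f N :=
    Integrable.of_bound hf.aestronglyMeasurable B (Eventually.of_forall hB)
  have h1 : ∫ x, f x ∂N = ∫ p, (∫ t in Ioc (0 : ℝ) p.2, f (p.1 t.toNNReal)) ∂D.mass d := by
    have hfI : Integrable (fun q : (Path (Metric.ball (0 : E d) D.R)ᶜ × ℝ≥0) × ℝ =>
        f (q.1.1 q.2.toNNReal)) _ := (integrable_map_measure hf.aestronglyMeasurable hev.aemeasurable).1 hfN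
    rw [hN, integral_map hev.aemeasurable hf.aestronglyMeasurable, ← integral_indicator hS,
      integral_prod _ ((integrable_indicator_iff hS).2 hfI)]
    refine integral_congr_ae (Eventually.of_forall fun p => ?_)
    simp only
    rw [← integral_indicator measurableSet_Ioc]
    rfl
  rw [← h1, hocc, integral_withDensity_eq_integral_toReal_smul (by fun_prop)
    (Eventually.of_forall fun x => ENNReal.ofReal_lt_top)]
  refine setIntegral_congr_fun D.measurableSet_annulus fun x hx => ?_
  simp only [smul_eq_mul]
  rw [ENNReal.toReal_ofReal (hpos x hx)]

/-- On the annulus `L = r^k / (m - γ r^k)` is the solution of `(m / r^k) L = 1 + γ L`, with `m /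
r^k` the occupation density; off it both sides vanish. -/
theorem triple_fixedPoint (hd : 0 < d) (hk : D.k = d - 1) {φ : E d → ℝ} (hφ : Continuous φ)
    (hφc : HasCompactSupport φ) :
    Integrable (fun x => φ x * (1 + D.γ * (D.triple d).L x)) ∧
    (D.triple d).κ * ∫ p, (∫ t in Ioc (0 : ℝ) p.2,
        φ (p.1 t.toNNReal) * max ((D.triple d).L (p.1 t.toNNReal)) 0) ∂(D.triple d).Q
      = ∫ x, φ x * (1 + D.γ * (D.triple d).L x) := by
  obtain ⟨B, hB⟩ := D.exists_profile_bound
  obtain ⟨C, hC⟩ := hφ.bounded_above_of_compact_support hφc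
  have hL : (D.triple d).L = D.slowness d := rfl
  have hLm := D.measurable_slowness d
  have hφm := hφ.measurable
  rw [hL]
  have hint : Integrable (fun x => φ x * (1 + D.γ * D.slowness d x)) := by
    refine (hφ.integrable_of_hasCompactSupport hφc).mul_bdd (c := 1 + D.γ * B)
      (by fun_prop) (Eventually.of_forall fun x => ?_)
    refine (norm_add_le _ _).trans ?_
    rw [norm_one, norm_mul, Real.norm_eq_abs, abs_of_pos D.γ_pos]
    have := mul_le_mul_of_nonneg_left (hB ‖x‖) D.γ_pos.le
    simpa [slowness] using this
  refine ⟨hint, ?_⟩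
  have hB0 : 0 ≤ B := (abs_nonneg _).trans (hB 0)
  have h1 := D.integral_occupation hd hk (f := fun x => φ x * max (D.slowness d x) 0)
    (by fun_prop) (B := C * B) (fun x => by
      rw [abs_mul]
      have h2 : |max (D.slowness d x) 0| ≤ B := by
        rw [abs_of_nonneg (le_max_right _ _)]
        exact max_le ((le_abs_self _).trans (hB _)) hB0
      exact mul_le_mul (hC x) h2 (abs_nonneg _) ((norm_nonneg _).trans (hC x)))
  rw [← D.kappa_smul_Q hd, integral_smul_measure, ENNReal.toReal_ofReal (D.kappa_pos hd).le,
    smul_eq_mul] at h1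
  rw [h1]
  have h3 : ∀ x : E d, ‖x‖ ∈ Icc D.ρ D.R → D.m ‖x‖ / ‖x‖ ^ D.k * (φ x * max (D.slowness d x) 0) =
      φ x * (1 + D.γ * D.slowness d x) := by
    intro x hx
    have h4 := D.m_gt hx
    have h5 : 0 < ‖x‖ := D.ρ_pos.trans_le hx.1
    have h6 : D.m ‖x‖ - D.γ * ‖x‖ ^ D.k ≠ 0 := by linarith
    rw [slowness, max_eq_left (D.profile_pos hx).le, D.profile_of_mem hx]
    obtain ⟨F, hF⟩ : ∃ F, F = D.m ‖x‖ - D.γ * ‖x‖ ^ D.k := ⟨_, rfl⟩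
    have h7 : D.m ‖x‖ = F + D.γ * ‖x‖ ^ D.k := by rw [hF]; ring
    rw [← hF] at h6
    rw [← hF, h7]
    field_simp
  have h7 : ∫ x in {x : E d | D.ρ ≤ ‖x‖ ∧ ‖x‖ < D.R},
      D.m ‖x‖ / ‖x‖ ^ D.k * (φ x * max (D.slowness d x) 0) =
      ∫ x in {x : E d | D.ρ ≤ ‖x‖ ∧ ‖x‖ < D.R}, φ x * (1 + D.γ * D.slowness d x) :=
    setIntegral_congr_fun D.measurableSet_annulus fun x hx => h3 x ⟨hx.1, hx.2.le⟩
  have : Nontrivial (E d) := Module.nontrivial_of_finrank_pos (R := ℝ) (by simpa using hd)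
  -- On the sphere of radius `R` the function `L` is positive, but the annulus of the occupation
  -- formula omits this sphere.
  have hnull : ∀ᵐ x : E d, x ∉ Metric.sphere (0 : E d) D.R :=
    measure_eq_zero_iff_ae_notMem.1 (Measure.addHaar_sphere _ _ _)
  rw [h7, ← integral_indicator D.measurableSet_annulus]
  refine integral_congr_ae ?_
  filter_upwards [hnull] with x hx
  by_cases hxa : x ∈ {x : E d | D.ρ ≤ ‖x‖ ∧ ‖x‖ < D.R}
  · rw [indicator_of_mem hxa]
  · rw [indicator_of_notMem hxa, slowness, D.profile_of_notMem]
    · have := D.γ_pos.ne'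
      field_simp
      simp
    · intro h
      refine hxa ⟨h.1, lt_of_le_of_ne h.2 ?_⟩
      simpa using hx

theorem triple_negPart (hd : 0 < d) (hk : D.k = d - 1) {φ : E d → ℝ} (hφ : Continuous φ) :
    ∫⁻ p, (∫⁻ t in Ioc (0 : ℝ) p.2, ENNReal.ofReal
      (|φ (p.1 t.toNNReal)| * max (-(D.triple d).L (p.1 t.toNNReal)) 0)) ∂(D.triple d).Q = 0 := by
  have hLm := D.measurable_slowness d
  have hφm := hφ.measurable
  have h1 := D.lintegral_occupation_mass hd hk
    (f := fun x => ENNReal.ofReal (|φ x| * max (-D.slowness d x) 0)) (by fun_prop)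
  simp only [triple, lintegral_smul_measure]
  rw [h1]
  have h2 : ∫⁻ x in {x : E d | D.ρ ≤ ‖x‖ ∧ ‖x‖ < D.R}, ENNReal.ofReal (D.m ‖x‖ / ‖x‖ ^ D.k) *
      ENNReal.ofReal (|φ x| * max (-D.slowness d x) 0) = 0 := by
    refine (setLIntegral_congr_fun D.measurableSet_annulus fun x hx => ?_).trans lintegral_zero
    have : 0 < D.slowness d x := D.profile_pos ⟨hx.1, hx.2.le⟩
    rw [max_eq_right (by linarith)]
    simp
  rw [h2]
  simp

theorem isAnyEquilibrium_triple (hd : 0 < d) (hk : D.k = d - 1) :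
    (D.triple d).IsAnyEquilibrium D.γ := by
  -- The costliest particles start at `ρ`; the summand one only makes the cap positive.
  refine ⟨(D.time D.ρ).toReal + 1, by positivity, ?_⟩
  exact {
    kappa_pos := D.kappa_pos hd
    prob := D.isProbabilityMeasure_Q hd
    usc := D.upperSemicontinuous_slowness d
    ne_zero := fun x => by
      by_cases hx : ‖x‖ ∈ Icc D.ρ D.R
      · exact (D.profile_pos hx).ne'
      · exact (D.profile_neg hx).ne
    optimal := fun Q' _ h => D.triple_optimal Q' h
    capped := by
      refine D.ae_Q ?_
      filter_upwards [D.ae_mass_theta, D.ae_mass_cost] with p h1 h2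
      refine ⟨h2.trans ?_, h1⟩
      rw [ENNReal.le_ofReal_iff_toReal_le (D.time_lt_top _).ne (by positivity)]
      linarith
    endpoint := by
      refine D.ae_Q ?_
      filter_upwards [D.ae_mass_end] with p h _
      rwa [measBoundary_compl_ball hd D.R_pos]
    fixedPoint := fun φ hφ hφc => D.triple_fixedPoint hd hk hφ.continuous hφc
    negPart := fun φ hφ _ => D.triple_negPart hd hk hφ.continuous }

/-- A particle from radius `a` reaches the boundary alive exactly when its clock is at least `R -
a`. In each direction the surviving mass is the flux `m R`, deposited at `R • e`. -/
theorem triple_boundaryMass (hd : 0 < d) {A : Set (E d)} (hA : MeasurableSet A) :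
    (D.triple d).boundaryMass A =
      ENNReal.ofReal (D.m D.R) * sphereMeasure d {e | D.R • (e : E d) ∈ A} := by
  have hS : MeasurableSet {p : Path (Metric.ball (0 : E d) D.R)ᶜ × ℝ≥0 |
      p.1 p.1.theta ∈ A ∧ p.2 = p.1.theta} := by
    refine MeasurableSet.inter (hA.preimage (by fun_prop)) ?_
    exact measurableSet_eq_fun measurable_snd (by fun_prop)
  have hA' : MeasurableSet {e : Metric.sphere (0 : E d) 1 | D.R • (e : E d) ∈ A} :=
    hA.preimage (by fun_prop)
  have h0 : (D.triple d).boundaryMass A =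
      (ENNReal.ofReal (D.triple d).κ • (D.triple d).Q)
        {p | p.1 p.1.theta ∈ A ∧ p.2 = p.1.theta} := rfl
  rw [h0, D.kappa_smul_Q hd, ← lintegral_indicator_one hS, D.lintegral_mass d
    (measurable_one.indicator hS)]
  have h1 : ∀ e : Metric.sphere (0 : E d) 1, ∫⁻ a, ∫⁻ s, ({p : Path (Metric.ball (0 : E d) D.R)ᶜ × ℝ≥0 |
      p.1 p.1.theta ∈ A ∧ p.2 = p.1.theta}).indicator 1 (D.particle d (e, a, s)) ∂D.clock ∂D.start =
      {e : Metric.sphere (0 : E d) 1 | D.R • (e : E d) ∈ A}.indicator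
        (fun _ => ENNReal.ofReal (D.m D.R)) e := by
    intro e
    by_cases he : D.R • (e : E d) ∈ A
    · rw [indicator_of_mem (by exact he), ← D.lintegral_survive]
      refine lintegral_congr_ae ?_
      filter_upwards [D.ae_start] with a ha
      rw [← lintegral_indicator_one measurableSet_Ici]
      refine lintegral_congr_ae ?_
      filter_upwards [D.ae_clock] with s hs
      have h2 : D.particle d (e, a, s) ∈ {p : Path (Metric.ball (0 : E d) D.R)ᶜ × ℝ≥0 |
          p.1 p.1.theta ∈ A ∧ p.2 = p.1.theta} ↔ s ∈ Ici (D.R - a) := by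
        rw [mem_ofPred_eq, D.particle_end ha, ← NNReal.coe_inj, D.particle_snd ha hs,
          D.particle_theta ha, mem_Ici, min_eq_right_iff]
        exact and_iff_right he
      by_cases h3 : s ∈ Ici (D.R - a)
      · rw [indicator_of_mem h3, indicator_of_mem (h2.2 h3)]
        rfl
      · rw [indicator_of_notMem h3, indicator_of_notMem (fun h => h3 (h2.1 h))]
    · rw [indicator_of_notMem (by exact he), ← lintegral_zero (μ := D.start)]
      refine lintegral_congr_ae ?_
      filter_upwards [D.ae_start] with a ha
      refine (lintegral_congr fun s => ?_).trans lintegral_zero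
      refine indicator_of_notMem (fun h => he ?_) _
      have := h.1
      rwa [D.particle_end ha] at this
  simp_rw [h1]
  rw [lintegral_indicator hA', setLIntegral_const]

end FluxData

/-! ### Cascades and arrival times. -/

theorem Path.iota_le {d : ℕ} {Γ : Set (E d)} {L : E d → ℝ} {t : ℝ≥0} {y : Path Γ} {r : ℝ≥0}
    (hr : r ≤ y.theta) (h : y.tailCost L r < t) : y.iota L t ≤ r :=
  iInf₂_le r ⟨hr, h⟩

theorem Path.iota_anti {d : ℕ} {Γ : Set (E d)} (L : E d → ℝ) (y : Path Γ) {s t : ℝ≥0}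
    (h : s ≤ t) : y.iota L t ≤ y.iota L s :=
  le_iInf₂ fun _ hr => iInf₂_le _ ⟨hr.1, hr.2.trans_le (by exact_mod_cast h)⟩

namespace Triple

variable {d : ℕ} {Γ : Set (E d)} (c : Triple Γ)

theorem occupation_mono {s t : ℝ≥0} (h : s ≤ t) {A B : Set (E d)} (hAB : A ⊆ B) :
    c.occupation s A ≤ c.occupation t B := by
  refine lintegral_mono fun p => measure_mono ?_
  rintro r ⟨h1, h2, h3, h4⟩
  exact ⟨h1, (Path.iota_anti c.L p.1 h).trans h2, h3, hAB h4⟩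

theorem cascade_mono {s t : ℝ≥0} (h : s ≤ t) : c.cascade s ⊆ c.cascade t :=
  union_subset_union_right _ fun _ hx ε hε =>
    (hx ε hε).trans_le (c.occupation_mono h subset_rfl)

theorem isClosed_cascade (hΓ : IsClosed Γ) (t : ℝ≥0) : IsClosed (c.cascade t) := by
  refine hΓ.union ?_
  rw [← isOpen_compl_iff, Metric.isOpen_iff]
  intro x hx
  simp only [mem_compl_iff, mem_ofPred_eq, not_forall, not_lt, nonpos_iff_eq_zero] at hx
  obtain ⟨ε, hε, h0⟩ := hx
  refine ⟨ε / 2, by positivity, fun y hy hy' => ?_⟩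
  have h1 := hy' (ε / 2) (by positivity)
  have h2 : Metric.ball y (ε / 2) ⊆ Metric.ball x ε :=
    Metric.ball_subset_ball' (by rw [Metric.mem_ball] at hy; linarith)
  exact (h1.trans_le (c.occupation_mono le_rfl h2)).ne' h0

theorem arrival_lt_iff {x : E d} {b : ℝ≥0∞} :
    c.arrival x < b ↔ ∃ t : ℝ≥0, x ∈ c.cascade t ∧ (t : ℝ≥0∞) < b := by
  simp only [arrival, iInf_lt_iff, exists_prop]

/-- The cascade is increasing in time and consists of closed sets, so each strict sublevel set is a
union of cascades over countably many rational times. -/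
theorem measurable_arrival (hΓ : IsClosed Γ) : Measurable c.arrival := by
  refine measurable_of_Iio fun b => ?_
  have : c.arrival ⁻¹' Iio b =
      ⋃ q : {q : ℚ≥0 // ((q : ℝ≥0) : ℝ≥0∞) < b}, c.cascade (q : ℚ≥0) := by
    ext x
    rw [mem_preimage, mem_Iio, arrival_lt_iff, mem_iUnion]
    constructor
    · rintro ⟨t, hx, ht⟩
      obtain ⟨q, hq1, hq2⟩ := ENNReal.lt_iff_exists_nnreal_btwn.1 ht
      obtain ⟨z, hz1, hz2⟩ := exists_rat_btwn (NNReal.coe_lt_coe.2 (ENNReal.coe_lt_coe.1 hq1))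
      have hz0 : 0 ≤ z := by
        have : (0 : ℝ) < z := t.coe_nonneg.trans_lt hz1
        exact_mod_cast this.le
      lift z to ℚ≥0 using hz0
      have hz3 : ((z : ℝ≥0) : ℝ) = ((z : ℚ) : ℝ) := by norm_cast
      rw [← hz3, NNReal.coe_lt_coe] at hz1 hz2
      exact ⟨⟨z, (ENNReal.coe_lt_coe.2 hz2).trans hq2⟩, c.cascade_mono hz1.le hx⟩
    · rintro ⟨⟨q, hq⟩, hx⟩
      exact ⟨q, hx, hq⟩
  rw [this]
  exact MeasurableSet.iUnion fun q => (c.isClosed_cascade hΓ _).measurableSet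

end Triple

namespace FluxData

variable (D : FluxData) {d : ℕ}

theorem isClosed_domain : IsClosed (Metric.ball (0 : E d) D.R)ᶜ := Metric.isOpen_ball.isClosed_compl

/-- Up to time `t` only the final stretch of each path counts, where the remaining cost is below
`t`. On it the radius exceeds some `r' > ‖x‖`, either by the choice of `r'` or because all particles
start at `ρ` or beyond, so the ball of radius `r' - ‖x‖` around `x` is never visited. -/
theorem notMem_cascade {x : E d} (hx : ‖x‖ < D.R) {t : ℝ≥0}
    (h : ‖x‖ < D.ρ ∨ (t : ℝ≥0∞) < D.time ‖x‖) : x ∉ (D.triple d).cascade t := by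
  obtain ⟨r', hr', hr2⟩ : ∃ r' > ‖x‖, r' ≤ D.ρ ∨ (t : ℝ≥0∞) < D.time r' := by
    rcases h with h | h
    · exact ⟨D.ρ, h, Or.inl le_rfl⟩
    · obtain ⟨r', h1, h2⟩ := D.exists_lt_time h
      exact ⟨r', h1, Or.inr h2⟩
  rintro (hx' | hx')
  · exact hx' (by simpa using hx)
  · have h1 := hx' (r' - ‖x‖) (by linarith)
    refine h1.ne' ?_
    rw [Triple.occupation, triple, lintegral_smul_measure]
    refine smul_eq_zero_of_right _ ?_
    rw [← nonpos_iff_eq_zero, mass]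
    refine (lintegral_map_le _ _).trans (le_of_eq ?_)
    rw [lintegral_eq_zero_of_ae_eq_zero]
    filter_upwards [D.ae_law d] with q hq
    obtain ⟨e, a, s⟩ := q
    obtain ⟨ha, hs⟩ := hq
    simp only at ha hs
    rw [Pi.zero_apply, ← nonpos_iff_eq_zero, ← measure_empty (μ := (volume : Measure ℝ))]
    refine measure_mono ?_
    rintro r ⟨h0, h2, h3, h4⟩
    have ha0 : 0 < a := D.ρ_pos.trans_le ha.1
    rw [D.particle_snd ha hs] at h3
    have h5 : r ≤ D.R - a := h3.le.trans (min_le_right _ _)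
    rw [D.particle_apply ha (by rwa [Real.coe_toNNReal _ h0]), Real.coe_toNNReal _ h0,
      mem_ball_iff_norm] at h4
    have h6 : a + r < r' := by
      have h7 := norm_le_norm_add_norm_sub x ((a + r) • (e : E d))
      rw [norm_smul_sphere (by linarith), norm_sub_rev] at h7
      linarith [norm_sub_rev x ((a + r) • (e : E d))]
    rcases hr2 with hr2 | hr2
    · linarith [ha.1]
    · have h8 : ENNReal.ofReal (r' - a) ≤ (D.particle d (e, a, s)).1.iota (D.slowness d) t := by
        refine le_iInf₂ fun z hz => ?_
        rw [D.particle_tailCost ha] at hz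
        have h9 : r' < a + z := by
          by_contra hcon
          exact absurd (D.antitone_time (not_lt.1 hcon)) (not_le.2 (hz.2.trans hr2))
        rw [ENNReal.ofReal_le_iff_le_toReal ENNReal.coe_ne_top, ENNReal.coe_toReal]
        linarith
      have h10 := (ENNReal.ofReal_le_ofReal_iff h0).1 (h8.trans h2)
      linarith

/-- The particles that start on the innermost sphere in directions near that of `x` and survive up
to `R` have positive mass. After passing the radius `‖x‖` each of them is within `ε` of `x` for a
time at least `δ`, and this part of its path already counts at time `t`. -/
theorem mem_cascade (hd : 0 < d) {x : E d} (hx : ‖x‖ ∈ Ico D.ρ D.R) {t : ℝ≥0}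
    (h : D.time ‖x‖ < t) : x ∈ (D.triple d).cascade t := by
  have : Nontrivial (E d) := Module.nontrivial_of_finrank_pos (R := ℝ) (by simpa using hd)
  refine Or.inr fun ε hε => ?_
  set r₀ := ‖x‖ with hr₀
  have hr0 : 0 < r₀ := D.ρ_pos.trans_le hx.1
  have hρ : D.ρ ∈ Ico D.ρ D.R := ⟨le_rfl, D.ρ_lt⟩
  let e₀ : Metric.sphere (0 : E d) 1 := ⟨r₀⁻¹ • x, by
    rw [mem_sphere_zero_iff_norm, norm_smul, Real.norm_eq_abs, abs_of_pos (by positivity), ← hr₀,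
      inv_mul_cancel₀ hr0.ne']⟩
  have he₀ : r₀ • (e₀ : E d) = x := by
    change r₀ • r₀⁻¹ • x = x
    rw [smul_smul, mul_inv_cancel₀ hr0.ne', one_smul]
  -- The angular deviation contributes at most `r₀ * η = ε / 2` to the distance from `x`, the radial
  -- one less than `δ ≤ ε / 2`; moreover `δ ≤ R - r₀` keeps the particle inside the ball of radius
  -- `R`.
  set η := ε / (2 * r₀) with hη
  have hη0 : 0 < η := by positivity
  set δ := min (ε / 2) (D.R - r₀) with hδ
  have hδ0 : 0 < δ := lt_min (by positivity) (by linarith [hx.2])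
  -- Closed balls of directions are compact, so their image in path space is closed and hence
  -- measurable.
  set K : Set (Path (Metric.ball (0 : E d) D.R)ᶜ) :=
    (fun e => Path.radial D.R_pos e D.ρ) '' Metric.closedBall e₀ η with hK
  have hKm : MeasurableSet K := by
    refine (IsCompact.image (isCompact_closedBall _ _) ?_).isClosed.measurableSet
    exact (Path.continuous_radial D.R_pos).comp (by fun_prop : Continuous fun e => (e, D.ρ))
  set G : Set (Path (Metric.ball (0 : E d) D.R)ᶜ × ℝ≥0) := K ×ˢ {(D.R - D.ρ).toNNReal} with hG
  have hGm : MeasurableSet G := hKm.prod (measurableSet_singleton _)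
  have hGpos : 0 < D.mass d G := by
    have hsub : Metric.ball e₀ η ×ˢ ({D.ρ} ×ˢ Ici (D.R - D.ρ)) ⊆ D.particle d ⁻¹' G := by
      rintro ⟨e, a, s⟩ ⟨he, ha, hs⟩
      obtain rfl : a = D.ρ := ha
      have hs0 : 0 < s := (sub_pos.2 D.ρ_lt).trans_le hs
      refine ⟨⟨e, Metric.ball_subset_closedBall he, rfl⟩, ?_⟩
      rw [mem_singleton_iff, ← NNReal.coe_inj, D.particle_snd hρ hs0,
        Real.coe_toNNReal _ (sub_nonneg.2 D.ρ_lt.le)]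
      exact min_eq_right hs
    rw [mass, Measure.map_apply (D.measurable_particle d) hGm]
    refine lt_of_lt_of_le ?_ (measure_mono hsub)
    rw [law, Measure.prod_prod, Measure.prod_prod, D.clock_Ici (sub_nonneg.2 D.ρ_lt.le)]
    refine ENNReal.mul_pos ?_ (ENNReal.mul_pos ?_ ?_).ne'
    · exact (Metric.isOpen_ball.measure_pos _ ⟨e₀, Metric.mem_ball_self hη0⟩).ne'
    · exact ((ENNReal.ofReal_pos.2 D.m0_pos).trans_le D.start_singleton).ne'
    · exact (ENNReal.ofReal_pos.2 (Real.exp_pos _)).ne'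
  have hle : ∀ p ∈ G, ENNReal.ofReal δ ≤ volume {r : ℝ | 0 ≤ r ∧
      p.1.iota (D.slowness d) t ≤ ENNReal.ofReal r ∧ r < p.2 ∧
      p.1 r.toNNReal ∈ Metric.ball x ε} := by
    rintro ⟨y, b⟩ ⟨⟨e, he, rfl⟩, hb⟩
    obtain rfl : b = (D.R - D.ρ).toNNReal := hb
    have hy : Path.radial D.R_pos e D.ρ = (D.particle d (e, D.ρ, 1)).1 := rfl
    have hvol : ENNReal.ofReal δ = volume (Ioo (r₀ - D.ρ) (r₀ - D.ρ + δ)) := by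
      rw [Real.volume_Ioo, add_sub_cancel_left]
    rw [hvol]
    refine measure_mono fun r hr => ?_
    have h0 : 0 ≤ r₀ - D.ρ := sub_nonneg.2 hx.1
    have h1 : 0 ≤ r := h0.trans hr.1.le
    have h2 : r < D.R - D.ρ := by
      have := min_le_right (ε / 2) (D.R - r₀)
      linarith [hr.2]
    have h3 : r < r₀ - D.ρ + ε / 2 := by
      have := min_le_left (ε / 2) (D.R - r₀)
      linarith [hr.2]
    refine ⟨h1, ?_, ?_, ?_⟩
    · have h4 : (D.particle d (e, D.ρ, 1)).1.iota (D.slowness d) t ≤ (r₀ - D.ρ).toNNReal := by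
        refine Path.iota_le ?_ ?_
        · rw [← NNReal.coe_le_coe, D.particle_theta hρ, Real.coe_toNNReal _ h0]
          linarith [hx.2]
        · rw [D.particle_tailCost hρ, Real.coe_toNNReal _ h0, add_sub_cancel]
          exact h
      exact h4.trans (ENNReal.ofReal_le_ofReal hr.1.le)
    · simpa only [Real.coe_toNNReal _ (sub_nonneg.2 D.ρ_lt.le)] using h2
    · simp only
      rw [hy, D.particle_apply hρ (by rw [Real.coe_toNNReal _ h1]; exact h2.le),
        Real.coe_toNNReal _ h1, mem_ball_iff_norm]
      have h5 : (D.ρ + r) • (e : E d) - x =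
          (D.ρ + r - r₀) • (e : E d) + r₀ • ((e : E d) - e₀) := by
        rw [smul_sub, he₀]; module
      rw [h5]
      refine (norm_add_le _ _).trans_lt ?_
      rw [norm_smul_sphere (by linarith [hr.1]), norm_smul, Real.norm_eq_abs, abs_of_pos hr0,
        ← dist_eq_norm, ← Subtype.dist_eq]
      have h6 : r₀ * dist e e₀ ≤ r₀ * η := mul_le_mul_of_nonneg_left he hr0.le
      have h7 : r₀ * η = ε / 2 := by rw [hη]; field_simp
      linarith
  rw [Triple.occupation]
  have hQ : 0 < (D.triple d).Q G := by
    simp only [triple, Measure.smul_apply, smul_eq_mul]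
    exact ENNReal.mul_pos (ENNReal.inv_ne_zero.2 (measure_ne_top _ _)) hGpos.ne'
  calc (0 : ℝ≥0∞) < ENNReal.ofReal δ * (D.triple d).Q G :=
        ENNReal.mul_pos (ENNReal.ofReal_pos.2 hδ0).ne' hQ.ne'
    _ = ∫⁻ p in G, ENNReal.ofReal δ ∂(D.triple d).Q := (setLIntegral_const _ _).symm
    _ ≤ ∫⁻ p in G, _ ∂(D.triple d).Q := setLIntegral_mono' hGm hle
    _ ≤ _ := setLIntegral_le_lintegral _ _

theorem arrival_of_ge {x : E d} (hx : D.R ≤ ‖x‖) : (D.triple d).arrival x = 0 := by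
  rw [← nonpos_iff_eq_zero]
  exact iInf₂_le (0 : ℝ≥0) (Or.inl (by simpa using hx))

theorem arrival_of_lt {x : E d} (hx : ‖x‖ < D.ρ) : (D.triple d).arrival x = ⊤ := by
  rw [← not_lt_top_iff, Triple.arrival_lt_iff]
  rintro ⟨t, ht, -⟩
  exact D.notMem_cascade (hx.trans D.ρ_lt) (Or.inl hx) ht

theorem arrival_of_mem (hd : 0 < d) {x : E d} (hx : ‖x‖ ∈ Ico D.ρ D.R) :
    (D.triple d).arrival x = D.time ‖x‖ := by
  refine le_antisymm (le_of_forall_gt fun b hb => ?_) (le_of_not_gt fun h => ?_)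
  · obtain ⟨q, hq1, hq2⟩ := ENNReal.lt_iff_exists_nnreal_btwn.1 hb
    exact (D.triple d).arrival_lt_iff.2 ⟨q, D.mem_cascade hd hx hq1, hq2⟩
  · obtain ⟨t, ht1, ht2⟩ := (D.triple d).arrival_lt_iff.1 h
    exact D.notMem_cascade hx.2 (Or.inr ht2) ht1

theorem frozen_eq (hd : 0 < d) :
    (D.triple d).frozen = {x : E d | D.ρ ≤ ‖x‖ ∧ ‖x‖ < D.R} := by
  ext x
  rw [Triple.frozen, D.isClosed_domain.closure_eq]
  simp only [Set.mem_sdiff, mem_ofPred_eq, mem_compl_iff, mem_ball_zero_iff, not_not]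
  constructor
  · rintro ⟨h1, h2⟩
    refine ⟨?_, h2⟩
    by_contra hcon
    rw [D.arrival_of_lt (not_le.1 hcon)] at h1
    exact lt_irrefl _ h1
  · rintro ⟨h1, h2⟩
    rw [D.arrival_of_mem hd ⟨h1, h2⟩]
    exact ⟨D.time_lt_top _, h2⟩

end FluxData

/-! ### The excess loss of energy. -/

namespace FluxData

variable (D : FluxData) {d : ℕ}

theorem mass_theta_eq_zero (A : Set (E d)) :
    D.mass d {p | p.1 0 ∈ A ∧ p.1.theta = 0} = 0 := by
  have h : ∀ᵐ p ∂D.mass d, p.1.theta ≠ 0 := by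
    refine D.ae_mass d ?_ fun e a s ha hs => ?_
    · exact (measurableSet_eq_fun (Path.measurable_theta.comp measurable_fst)
        measurable_const).compl
    · rw [← NNReal.coe_ne_zero, D.particle_theta ha]
      linarith [ha.2]
  exact measure_mono_null (fun p hp => not_not.2 hp.2) (ae_iff.1 h)

theorem density_mul {r : ℝ} (hr : 0 < r) :
    D.m r / r ^ D.k * r ^ D.k = D.m r := by field_simp

/-- The atom of the starting law at `ρ` gives the sphere term. Dividing the radial density `g + lam
* m` by `r ^ k` gives the density in space. -/
theorem mass_start (hd : 0 < d) (hk : D.k = d - 1) {u : ℝ → ℝ} (hu : Measurable u)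
    (hg : ∀ r, D.g r = (1 + u r) * r ^ D.k) {A : Set (E d)} (hA : MeasurableSet A) :
    D.mass d {p | p.1 0 ∈ A ∩ {x : E d | D.ρ ≤ ‖x‖ ∧ ‖x‖ < D.R}} =
      ENNReal.ofReal D.m0 * sphereMeasure d {e | D.ρ • (e : E d) ∈ A} +
      ∫⁻ x in A ∩ {x : E d | D.ρ ≤ ‖x‖ ∧ ‖x‖ < D.R},
        ENNReal.ofReal ((1 + u ‖x‖) + D.lam * (D.m ‖x‖ / ‖x‖ ^ D.k)) := by
  have hS : MeasurableSet (A ∩ {x : E d | D.ρ ≤ ‖x‖ ∧ ‖x‖ < D.R}) :=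
    hA.inter D.measurableSet_annulus
  have hS' : MeasurableSet {p : Path (Metric.ball (0 : E d) D.R)ᶜ × ℝ≥0 |
      p.1 0 ∈ A ∩ {x : E d | D.ρ ≤ ‖x‖ ∧ ‖x‖ < D.R}} := hS.preimage (by fun_prop)
  have hA' : MeasurableSet {e : Metric.sphere (0 : E d) 1 | D.ρ • (e : E d) ∈ A} :=
    hA.preimage (by fun_prop)
  have hAe : ∀ e : Metric.sphere (0 : E d) 1, MeasurableSet {r : ℝ | r • (e : E d) ∈ A} :=
    fun e => hA.preimage (by fun_prop)
  have h1 : ∀ e : Metric.sphere (0 : E d) 1, ∫⁻ a, ∫⁻ s,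
      {p : Path (Metric.ball (0 : E d) D.R)ᶜ × ℝ≥0 |
        p.1 0 ∈ A ∩ {x : E d | D.ρ ≤ ‖x‖ ∧ ‖x‖ < D.R}}.indicator 1
          (D.particle d (e, a, s)) ∂D.clock ∂D.start =
      {e : Metric.sphere (0 : E d) 1 | D.ρ • (e : E d) ∈ A}.indicator
        (fun _ => ENNReal.ofReal D.m0) e +
      ∫⁻ r in Ioo D.ρ D.R, ENNReal.ofReal (r ^ D.k) * A.indicator (fun x => ENNReal.ofReal
        ((1 + u ‖x‖) + D.lam * (D.m ‖x‖ / ‖x‖ ^ D.k))) (r • (e : E d)) := by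
    intro e
    have h2 : ∫⁻ a, ∫⁻ s, {p : Path (Metric.ball (0 : E d) D.R)ᶜ × ℝ≥0 |
        p.1 0 ∈ A ∩ {x : E d | D.ρ ≤ ‖x‖ ∧ ‖x‖ < D.R}}.indicator 1
          (D.particle d (e, a, s)) ∂D.clock ∂D.start =
        ∫⁻ a, {r : ℝ | r • (e : E d) ∈ A}.indicator 1 a ∂D.start := by
      refine lintegral_congr_ae ?_
      filter_upwards [D.ae_start] with a ha
      have ha0 : 0 < a := D.ρ_pos.trans_le ha.1
      have h3 : ∀ s, {p : Path (Metric.ball (0 : E d) D.R)ᶜ × ℝ≥0 |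
          p.1 0 ∈ A ∩ {x : E d | D.ρ ≤ ‖x‖ ∧ ‖x‖ < D.R}}.indicator (1 : Path (Metric.ball (0 : E d) D.R)ᶜ × ℝ≥0 → ℝ≥0∞)
          (D.particle d (e, a, s)) = {r : ℝ | r • (e : E d) ∈ A}.indicator 1 a := by
        intro s
        have hz := D.particle_zero (e := e) (s := s) ha
        have hn := norm_smul_sphere (e := e) ha0.le
        by_cases h : a • (e : E d) ∈ A
        · rw [indicator_of_mem, indicator_of_mem (by exact h)]
          · rfl
          · rw [mem_ofPred_eq, hz]
            exact ⟨h, by rw [mem_ofPred_eq, hn]; exact ha⟩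
        · rw [indicator_of_notMem, indicator_of_notMem (by exact h)]
          rw [mem_ofPred_eq, hz]
          exact fun h' => h h'.1
      simp_rw [h3]
      rw [lintegral_const, measure_univ, mul_one]
    rw [h2, D.lintegral_start (measurable_one.indicator (hAe e))]
    congr 1
    · by_cases h : D.ρ • (e : E d) ∈ A
      · rw [indicator_of_mem (by exact h), indicator_of_mem (by exact h), Pi.one_apply, mul_one]
      · rw [indicator_of_notMem (by exact h), indicator_of_notMem (by exact h), mul_zero]
    · refine setLIntegral_congr_fun measurableSet_Ioo fun r hr => ?_
      have hr0 : 0 < r := D.ρ_pos.trans hr.1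
      by_cases h : r • (e : E d) ∈ A
      · rw [indicator_of_mem (by exact h), indicator_of_mem h, Pi.one_apply, mul_one,
          norm_smul_sphere hr0.le, ← ENNReal.ofReal_mul (by positivity), hg]
        congr 1
        have := D.density_mul hr0
        linear_combination (-D.lam) * this
      · rw [indicator_of_notMem (by exact h), indicator_of_notMem h, mul_zero, mul_zero]
  rw [← lintegral_indicator_one hS', D.lintegral_mass d (measurable_one.indicator hS')]
  simp_rw [h1]
  rw [lintegral_add_left (measurable_const.indicator hA'), lintegral_indicator hA',
    setLIntegral_const, ← D.lintegral_annulus hd hk (Measurable.indicator (by fun_prop) hA),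
    setLIntegral_indicator hA]

/-- Survivors end on the sphere of radius `R`, outside the half-open annulus, so only particles
killed on the way are counted. -/
theorem mass_killed (hd : 0 < d) (hk : D.k = d - 1) {A : Set (E d)} (hA : MeasurableSet A) :
    D.mass d {p | p.1 p.2 ∈ A ∩ {x : E d | D.ρ ≤ ‖x‖ ∧ ‖x‖ < D.R}} =
      ∫⁻ x in A ∩ {x : E d | D.ρ ≤ ‖x‖ ∧ ‖x‖ < D.R},
        ENNReal.ofReal (D.lam * (D.m ‖x‖ / ‖x‖ ^ D.k)) := by
  have hS : MeasurableSet (A ∩ {x : E d | D.ρ ≤ ‖x‖ ∧ ‖x‖ < D.R}) :=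
    hA.inter D.measurableSet_annulus
  have hS' : MeasurableSet {p : Path (Metric.ball (0 : E d) D.R)ᶜ × ℝ≥0 |
      p.1 p.2 ∈ A ∩ {x : E d | D.ρ ≤ ‖x‖ ∧ ‖x‖ < D.R}} := hS.preimage (by fun_prop)
  have hAe : ∀ e : Metric.sphere (0 : E d) 1, MeasurableSet {r : ℝ | r • (e : E d) ∈ A} :=
    fun e => hA.preimage (by fun_prop)
  rw [← lintegral_indicator_one hS', D.lintegral_mass d (measurable_one.indicator hS'),
    ← setLIntegral_indicator hA, D.lintegral_annulus hd hk (Measurable.indicator (by fun_prop) hA)]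
  refine lintegral_congr fun e => ?_
  have h1 : ∫⁻ r in Ioo D.ρ D.R, ENNReal.ofReal (r ^ D.k) * A.indicator (fun x => ENNReal.ofReal
        (D.lam * (D.m ‖x‖ / ‖x‖ ^ D.k))) (r • (e : E d)) =
      ∫⁻ r in Ioo D.ρ D.R, ENNReal.ofReal D.lam * (ENNReal.ofReal (D.m r) *
        {r : ℝ | r • (e : E d) ∈ A}.indicator 1 r) := by
    refine setLIntegral_congr_fun measurableSet_Ioo fun r hr => ?_
    have hr0 : 0 < r := D.ρ_pos.trans hr.1
    by_cases h : r • (e : E d) ∈ A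
    · rw [indicator_of_mem (by exact h), indicator_of_mem (by exact h), Pi.one_apply, mul_one,
        norm_smul_sphere hr0.le, ← ENNReal.ofReal_mul (by positivity),
        ← ENNReal.ofReal_mul D.lam_pos.le]
      congr 1
      have := D.density_mul hr0
      linear_combination D.lam * this
    · rw [indicator_of_notMem (by exact h), indicator_of_notMem (by exact h), mul_zero, mul_zero,
        mul_zero]
  rw [h1, lintegral_const_mul' _ _ ENNReal.ofReal_ne_top,
    ← D.lintegral_killed (measurable_one.indicator (hAe e))]
  refine lintegral_congr_ae ?_
  filter_upwards [D.ae_start] with a ha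
  refine lintegral_congr_ae ?_
  filter_upwards [D.ae_clock] with s hs
  have ha0 : 0 < a := D.ρ_pos.trans_le ha.1
  have hpos : (D.particle d (e, a, s)).1 (D.particle d (e, a, s)).2 =
      (a + min s (D.R - a)) • (e : E d) := by
    rw [D.particle_apply ha (by rw [D.particle_snd ha hs]; exact min_le_right _ _),
      D.particle_snd ha hs]
  have hmin : 0 < min s (D.R - a) := lt_min hs (by linarith [ha.2])
  have hn : ‖(a + min s (D.R - a)) • (e : E d)‖ = a + min s (D.R - a) :=
    norm_smul_sphere (by linarith)
  by_cases h2 : s < D.R - a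
  · rw [min_eq_left h2.le] at hpos hn
    rw [indicator_of_mem (show s ∈ Iio (D.R - a) from h2)]
    by_cases h : (a + s) • (e : E d) ∈ A
    · rw [indicator_of_mem, indicator_of_mem (by exact h)]
      · rfl
      · rw [mem_ofPred_eq, hpos]
        refine ⟨h, ?_⟩
        rw [mem_ofPred_eq, hn]
        exact ⟨by linarith [ha.1], by linarith⟩
    · rw [indicator_of_notMem, indicator_of_notMem (by exact h)]
      rw [mem_ofPred_eq, hpos]
      exact fun h' => h h'.1
  · rw [min_eq_right (not_lt.1 h2)] at hpos hn
    rw [indicator_of_notMem (show s ∉ Iio (D.R - a) from h2), indicator_of_notMem]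
    rw [mem_ofPred_eq, hpos]
    rintro ⟨-, h3⟩
    rw [mem_ofPred_eq, hn] at h3
    linarith [h3.2]

/-- The only excess loss of energy of the radial equilibrium is on the innermost sphere. -/
theorem triple_excess (hd : 0 < d) (hk : D.k = d - 1) {u : ℝ → ℝ} (hu : Measurable u) {C : ℝ}
    (hC : ∀ r, |u r| ≤ C) (hg : ∀ r, D.g r = (1 + u r) * r ^ D.k) {A : Set (E d)}
    (hA : MeasurableSet A) :
    (D.triple d).excess (fun x => u ‖x‖) A =
      D.m0 * (sphereMeasure d).real {e | D.ρ • (e : E d) ∈ A} := by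
  have hS : MeasurableSet (A ∩ {x : E d | D.ρ ≤ ‖x‖ ∧ ‖x‖ < D.R}) :=
    hA.inter D.measurableSet_annulus
  have hpos : ∀ x ∈ A ∩ {x : E d | D.ρ ≤ ‖x‖ ∧ ‖x‖ < D.R},
      0 < ‖x‖ ∧ 0 < D.m ‖x‖ ∧ 0 ≤ (1 + u ‖x‖) + D.lam * (D.m ‖x‖ / ‖x‖ ^ D.k) := by
    intro x hx
    have hx0 : 0 < ‖x‖ := D.ρ_pos.trans_le hx.2.1
    have hI : ‖x‖ ∈ Icc D.ρ D.R := ⟨hx.2.1, hx.2.2.le⟩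
    refine ⟨hx0, D.m_pos hI, ?_⟩
    have h1 := D.rate_nonneg hI
    rw [hg] at h1
    have h2 : (1 + u ‖x‖) + D.lam * (D.m ‖x‖ / ‖x‖ ^ D.k) =
        ((1 + u ‖x‖) * ‖x‖ ^ D.k + D.lam * D.m ‖x‖) / ‖x‖ ^ D.k := by field_simp
    rw [h2]
    exact div_nonneg h1 (by positivity)
  have hi1 : IntegrableOn (fun x : E d => D.lam * (D.m ‖x‖ / ‖x‖ ^ D.k))
      (A ∩ {x : E d | D.ρ ≤ ‖x‖ ∧ ‖x‖ < D.R}) :=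
    Integrable.const_mul (D.integrableOn_density.mono_set inter_subset_right) _
  have hi2 : IntegrableOn (fun x : E d => 1 + u ‖x‖)
      (A ∩ {x : E d | D.ρ ≤ ‖x‖ ∧ ‖x‖ < D.R}) := by
    refine Measure.integrableOn_of_bounded (M := 1 + C) ?_ ?_ ?_
    · have : A ∩ {x : E d | D.ρ ≤ ‖x‖ ∧ ‖x‖ < D.R} ⊆ Metric.ball 0 D.R :=
        fun x hx => by simpa using hx.2.2
      exact ((measure_mono this).trans_lt measure_ball_lt_top).ne
    · exact Measurable.aestronglyMeasurable (by fun_prop)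
    · refine Eventually.of_forall fun x => (norm_add_le _ _).trans ?_
      rw [norm_one]
      exact add_le_add_right (hC _) _
  have h2 : (D.mass d).real {p | p.1 0 ∈ A ∩ {x : E d | D.ρ ≤ ‖x‖ ∧ ‖x‖ < D.R}} =
      D.m0 * (sphereMeasure d).real {e | D.ρ • (e : E d) ∈ A} +
      ∫ x in A ∩ {x : E d | D.ρ ≤ ‖x‖ ∧ ‖x‖ < D.R},
        ((1 + u ‖x‖) + D.lam * (D.m ‖x‖ / ‖x‖ ^ D.k)) := by
    rw [measureReal_def, D.mass_start hd hk hu hg hA, ← ofReal_integral_eq_lintegral_ofReal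
      (Integrable.fun_add hi2 hi1), ENNReal.toReal_add (ENNReal.mul_ne_top ENNReal.ofReal_ne_top
        (measure_ne_top _ _)) ENNReal.ofReal_ne_top, ENNReal.toReal_mul,
      ENNReal.toReal_ofReal D.m0_pos.le, ENNReal.toReal_ofReal
        (setIntegral_nonneg hS fun x hx => (hpos x hx).2.2), measureReal_def]
    filter_upwards [ae_restrict_mem hS] with x hx using (hpos x hx).2.2
  have hnn : ∀ x ∈ A ∩ {x : E d | D.ρ ≤ ‖x‖ ∧ ‖x‖ < D.R},
      0 ≤ D.lam * (D.m ‖x‖ / ‖x‖ ^ D.k) := fun x hx =>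
    mul_nonneg D.lam_pos.le (div_nonneg (hpos x hx).2.1.le (by positivity))
  have h3 : (D.mass d).real {p | p.1 p.2 ∈ A ∩ {x : E d | D.ρ ≤ ‖x‖ ∧ ‖x‖ < D.R}} =
      ∫ x in A ∩ {x : E d | D.ρ ≤ ‖x‖ ∧ ‖x‖ < D.R}, D.lam * (D.m ‖x‖ / ‖x‖ ^ D.k) := by
    rw [measureReal_def, D.mass_killed hd hk hA, ← ofReal_integral_eq_lintegral_ofReal hi1,
      ENNReal.toReal_ofReal (setIntegral_nonneg hS hnn)]
    filter_upwards [ae_restrict_mem hS] with x hx using hnn x hx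
  have h1 : (D.mass d).real {p | p.1 0 ∈ A ∧ p.1.theta = 0} = 0 := by
    rw [measureReal_def, D.mass_theta_eq_zero, ENNReal.toReal_zero]
  -- No particle starts on the closure of `Γ`. In the annulus births exceed deaths by exactly `1 +
  -- u`, which leaves the atom on the innermost sphere.
  rw [Triple.excess, D.frozen_eq hd, D.mass_real hd, D.mass_real hd, D.mass_real hd, h1, h2, h3,
    integral_add hi2 hi1]
  ring

/-- The excess sits on the sphere of radius `ρ`, whose arrival time `time ρ` is still larger than
`t`. -/
theorem cumExcess_eq_zero (hd : 0 < d) (hk : D.k = d - 1) {u : ℝ → ℝ} (hu : Measurable u) {C : ℝ}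
    (hC : ∀ r, |u r| ≤ C) (hg : ∀ r, D.g r = (1 + u r) * r ^ D.k) {t : ℝ}
    (ht : ENNReal.ofReal t < D.time D.ρ) :
    (D.triple d).cumExcess (fun x => u ‖x‖) t = 0 := by
  have hA : MeasurableSet {x | (D.triple d).arrival x ≤ ENNReal.ofReal t} :=
    measurableSet_le ((D.triple d).measurable_arrival D.isClosed_domain) measurable_const
  have h1 : {e : Metric.sphere (0 : E d) 1 | D.ρ • (e : E d) ∈
      {x | (D.triple d).arrival x ≤ ENNReal.ofReal t}} = ∅ := by
    rw [eq_empty_iff_forall_notMem]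
    intro e he
    rw [mem_ofPred_eq, mem_ofPred_eq, D.arrival_of_mem hd, norm_smul_sphere D.ρ_pos.le] at he
    · exact absurd he (not_le.2 ht)
    · rw [norm_smul_sphere D.ρ_pos.le]
      exact ⟨le_rfl, D.ρ_lt⟩
  rw [Triple.cumExcess, D.triple_excess hd hk hu hC hg hA, h1]
  simp

end FluxData

/-! ### The flux of the radial problem and its limit. -/

section radial

variable {d : ℕ} {γ V R ρ C : ℝ} {u : ℝ → ℝ}

theorem intervalIntegrable_source (hu : Measurable u) (hC : ∀ r, |u r| ≤ C) (k : ℕ) (a b : ℝ) :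
    IntervalIntegrable (fun z => (1 + u z) * z ^ k) volume a b := by
  have h : IntervalIntegrable (fun z => 1 + u z) volume a b := by
    rw [intervalIntegrable_iff]
    refine Measure.integrableOn_of_bounded (M := 1 + C) (by simp) (by fun_prop) ?_
    refine Eventually.of_forall fun x => (norm_add_le _ _).trans ?_
    rw [norm_one]
    exact add_le_add_right (hC _) _
  exact h.mul_continuousOn (by fun_prop)

theorem radialDenom_eq (hu : Measurable u) (hC : ∀ r, |u r| ≤ C) (ρ r : ℝ) :
    radialDenom d γ V R u r =
      ((γ + V) * R ^ (d - 1) - ∫ z in ρ..R, (1 + u z) * z ^ (d - 1)) +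
        (∫ z in ρ..r, (1 + u z) * z ^ (d - 1)) - γ * r ^ (d - 1) := by
  rw [radialDenom, ← intervalIntegral.integral_add_adjacent_intervals
    (intervalIntegrable_source hu hC (d - 1) ρ r) (intervalIntegrable_source hu hC (d - 1) r R)]
  ring

/-- The flux of the radial solution with the initial velocity `V`, started at the radius `ρ`. -/
noncomputable def radialFlux (d : ℕ) (hγ : 0 < γ) (hρ : 0 < ρ) (hρR : ρ < R) (hu : Measurable u)
    (hC : ∀ r, |u r| ≤ C) (hF : ∀ r ∈ Icc ρ R, 0 < radialDenom d γ V R u r) : FluxData where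
  k := d - 1
  ρ := ρ
  R := R
  γ := γ
  -- Since `m r > γ * r ^ (d - 1) ≥ γ * ρ ^ (d - 1)` and `|g| ≤ (1 + C) * R ^ (d - 1)` on `[ρ, R]`,
  -- this rate makes `g + lam * m` nonnegative.
  lam := (1 + C) * R ^ (d - 1) / (γ * ρ ^ (d - 1))
  m0 := (γ + V) * R ^ (d - 1) - ∫ z in ρ..R, (1 + u z) * z ^ (d - 1)
  g z := (1 + u z) * z ^ (d - 1)
  ρ_pos := hρ
  ρ_lt := hρR
  γ_pos := hγ
  lam_pos := by
    have h1 : 0 ≤ C := (abs_nonneg _).trans (hC 0)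
    have h2 : 0 < R := hρ.trans hρR
    positivity
  measurable_g := by fun_prop
  int_g := intervalIntegrable_source hu hC _
  flux_gt r hr := by
    have h := hF r hr
    rw [radialDenom_eq hu hC ρ] at h
    linarith
  rate r hr := by
    have h := hF r hr
    rw [radialDenom_eq hu hC ρ] at h
    have h1 : 0 ≤ C := (abs_nonneg _).trans (hC 0)
    have h2 : 0 < R := hρ.trans hρR
    have h3 : 0 < r := hρ.trans_le hr.1
    have h4 : γ * ρ ^ (d - 1) ≤ γ * r ^ (d - 1) := by
      have := hr.1
      gcongr
    have h5 : -((1 + C) * R ^ (d - 1)) ≤ (1 + u r) * r ^ (d - 1) := by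
      have h6 : |(1 + u r) * r ^ (d - 1)| ≤ (1 + C) * R ^ (d - 1) := by
        rw [abs_mul, abs_of_pos (pow_pos h3 _)]
        have h7 : |1 + u r| ≤ 1 + C := (abs_add_le _ _).trans (by rw [abs_one]; linarith [hC r])
        have := hr.2
        gcongr
      exact (abs_le.1 h6).1
    have h8 : 0 < γ * ρ ^ (d - 1) := by positivity
    set m := (γ + V) * R ^ (d - 1) - (∫ z in ρ..R, (1 + u z) * z ^ (d - 1)) +
      ∫ z in ρ..r, (1 + u z) * z ^ (d - 1)
    have h9 : (1 + C) * R ^ (d - 1) ≤ (1 + C) * R ^ (d - 1) / (γ * ρ ^ (d - 1)) * m := by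
      rw [div_mul_eq_mul_div, le_div_iff₀ h8]
      have : γ * ρ ^ (d - 1) ≤ m := by linarith
      gcongr
    linarith

variable (hγ : 0 < γ) (hρ : 0 < ρ) (hρR : ρ < R) (hu : Measurable u)
    (hC : ∀ r, |u r| ≤ C) (hF : ∀ r ∈ Icc ρ R, 0 < radialDenom d γ V R u r)

theorem radialFlux_m (r : ℝ) : (radialFlux d hγ hρ hρR hu hC hF).m r =
    radialDenom d γ V R u r + γ * r ^ (d - 1) := by
  rw [radialDenom_eq hu hC ρ, sub_add_cancel]
  rfl

theorem radialFlux_m_R : (radialFlux d hγ hρ hρR hu hC hF).m R = (γ + V) * R ^ (d - 1) := by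
  rw [radialFlux_m, radialDenom, intervalIntegral.integral_same]
  ring

theorem radialFlux_time {r : ℝ} (hr : ρ ≤ r) : (radialFlux d hγ hρ hρR hu hC hF).time r =
    radialTime d γ V R u r := by
  rw [FluxData.time_eq_Ioo _ hr, radialTime]
  refine setLIntegral_congr_fun measurableSet_Ioo fun z _ => ?_
  rw [radialFlux_m]
  simp [radialFlux]

theorem radialDenom_add (V ε : ℝ) (r : ℝ) :
    radialDenom d γ (V + ε) R u r = radialDenom d γ V R u r + ε * R ^ (d - 1) := by
  rw [radialDenom, radialDenom]; ring

theorem measurable_radialDenom (hu : Measurable u) (hC : ∀ r, |u r| ≤ C) :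
    Measurable (radialDenom d γ V R u) := by
  have h : Continuous fun r => ∫ z in R..r, (1 + u z) * z ^ (d - 1) :=
    intervalIntegral.continuous_primitive (intervalIntegrable_source hu hC (d - 1)) R
  have h2 : radialDenom d γ V R u = fun r => (γ + V) * R ^ (d - 1) +
      (∫ z in R..r, (1 + u z) * z ^ (d - 1)) - γ * r ^ (d - 1) := by
    funext r
    rw [radialDenom, intervalIntegral.integral_symm]
    ring
  rw [h2]
  exact (by fun_prop : Continuous _).measurable

theorem radialDenom_nonneg (hV : 0 ≤ V) (hR : 0 < R) {r : ℝ}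
    (hr : r ∈ Ioc (radiusStar d γ V R u) R) : 0 ≤ radialDenom d γ V R u r := by
  have hr0 : 0 < r := (le_max_right _ _).trans_lt hr.1
  rcases hr.2.eq_or_lt with h | h
  · rw [h, radialDenom, intervalIntegral.integral_same]
    have : 0 ≤ V * R ^ (d - 1) := by positivity
    linarith
  · by_contra hcon
    have hbdd : BddAbove {r : ℝ | 0 < r ∧ r < R ∧ (γ + V) * R ^ (d - 1) - γ * r ^ (d - 1) <
        ∫ z in r..R, (1 + u z) * z ^ (d - 1)} := ⟨R, fun x hx => hx.2.1.le⟩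
    have h1 := le_csSup hbdd (a := r) ⟨hr0, h, by rw [radialDenom] at hcon; linarith⟩
    exact absurd (h1.trans (le_max_left _ 0)) (not_le.2 hr.1)

theorem radialTime_antitone : Antitone (radialTime d γ V R u) := fun _ _ h =>
  lintegral_mono_set (Ioo_subset_Ioo_left h)

/-- Monotone convergence of the arrival times as the initial velocity decreases. -/
theorem tendsto_radialTime (hR : 0 < R) (hu : Measurable u) (hC : ∀ r, |u r| ≤ C)
    {ε ρ : ℕ → ℝ} (hε : Antitone ε) (hε0 : Tendsto ε atTop (𝓝 0)) (hρ : Antitone ρ) {ρ₀ : ℝ}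
    (hρ0 : 0 ≤ ρ₀) (hρ₀ : ∀ n, ρ₀ ≤ ρ n) (hρl : Tendsto ρ atTop (𝓝 ρ₀)) :
    Tendsto (fun n => radialTime d γ (V + ε n) R u (ρ n)) atTop
      (𝓝 (radialTime d γ V R u ρ₀)) := by
  simp only [radialTime]
  simp_rw [← lintegral_indicator measurableSet_Ioo]
  refine lintegral_tendsto_of_tendsto_of_monotone (fun n => ?_) ?_ ?_
  · refine (Measurable.indicator ?_ measurableSet_Ioo).aemeasurable
    have := measurable_radialDenom (d := d) (γ := γ) (V := V + ε n) (R := R) hu hC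
    fun_prop
  · refine Eventually.of_forall fun z i j hij => ?_
    refine indicator_le_indicator_of_subset (Ioo_subset_Ioo_left (hρ hij)) (fun _ => zero_le) z
      |>.trans ?_
    refine indicator_le_indicator (ENNReal.div_le_div_left (ENNReal.ofReal_le_ofReal ?_) _)
    rw [radialDenom_add, radialDenom_add]
    have := hε hij
    gcongr
  · refine Eventually.of_forall fun z => ?_
    by_cases hz : z ∈ Ioo ρ₀ R
    · have hz0 : 0 < z := hρ0.trans_lt hz.1
      have h1 : Tendsto (fun n => ENNReal.ofReal (z ^ (d - 1)) /
          ENNReal.ofReal (radialDenom d γ (V + ε n) R u z)) atTop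
          (𝓝 (ENNReal.ofReal (z ^ (d - 1)) / ENNReal.ofReal (radialDenom d γ V R u z))) := by
        -- This includes the radii at which the limiting denominator vanishes: there the numerator
        -- is positive and the quotients tend to `⊤`.
        refine ENNReal.Tendsto.const_div (ENNReal.tendsto_ofReal ?_)
          (Or.inr ENNReal.ofReal_ne_top)
        simp_rw [radialDenom_add]
        simpa using (hε0.mul_const (R ^ (d - 1))).const_add (radialDenom d γ V R u z)
      rw [indicator_of_mem hz]
      refine h1.congr' ?_
      filter_upwards [hρl.eventually_lt_const hz.1] with n hn
      rw [indicator_of_mem (by exact ⟨hn, hz.2⟩)]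
    · rw [indicator_of_notMem hz]
      refine tendsto_const_nhds.congr fun n => ?_
      rw [indicator_of_notMem]
      exact fun h => hz ⟨(hρ₀ n).trans_lt h.1, h.2⟩

theorem measurable_radialArrival : Measurable (radialArrival d γ V R u) := by
  have h := (radialTime_antitone (d := d) (γ := γ) (V := V) (R := R) (u := u)).measurable
  unfold radialArrival
  refine Measurable.ite (measurableSet_le measurable_const measurable_norm) measurable_const ?_
  exact Measurable.ite (measurableSet_le measurable_const measurable_norm)
    (h.comp measurable_norm) measurable_const

end radial

/-! ### Convergence of the arrival times and minimality. -/

theorem measurable_capped {d : ℕ} {w : E d → ℝ≥0∞} (hw : Measurable w) (T : ℝ) :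
    Measurable (capped w T) := (hw.min measurable_const).ennreal_toReal

theorem capped_mem_Icc {d : ℕ} (w : E d → ℝ≥0∞) {T : ℝ} (hT : 0 ≤ T) (x : E d) :
    capped w T x ∈ Icc 0 T := by
  refine ⟨ENNReal.toReal_nonneg, ENNReal.toReal_le_of_le_ofReal hT (min_le_right _ _)⟩

theorem tendsto_lintegral_capped {d : ℕ} {w : E d → ℝ≥0∞} {W : ℕ → E d → ℝ≥0∞}
    (hw : Measurable w) (hW : ∀ n, Measurable (W n))
    (h : ∀ᵐ x : E d, Tendsto (fun n => W n x) atTop (𝓝 (w x))) {T : ℝ} (hT : 0 ≤ T)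
    {K : Set (E d)} (hK : IsCompact K) :
    Tendsto (fun n => ∫⁻ x in K, ‖capped (W n) T x - capped w T x‖ₑ) atTop (𝓝 0) := by
  have h1 := tendsto_lintegral_of_dominated_convergence (μ := volume.restrict K)
    (F := fun n x => ‖capped (W n) T x - capped w T x‖ₑ) (f := fun _ => 0)
    (fun _ => ENNReal.ofReal T)
    (fun n => ((measurable_capped (hW n) T).sub (measurable_capped hw T)).enorm)
    (fun n => Eventually.of_forall fun x => ?_) ?_ ?_
  · simpa using h1
  · simp only
    rw [← ofReal_norm, Real.norm_eq_abs]
    refine ENNReal.ofReal_le_ofReal (abs_le.2 ?_)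
    have h2 := capped_mem_Icc (W n) hT x
    have h3 := capped_mem_Icc w hT x
    constructor <;> linarith [h2.1, h2.2, h3.1, h3.2]
  · rw [lintegral_const, Measure.restrict_apply_univ]
    exact ENNReal.mul_ne_top ENNReal.ofReal_ne_top hK.measure_lt_top.ne
  · filter_upwards [ae_restrict_of_ae h] with x hx
    have h2 : Tendsto (fun n => capped (W n) T x) atTop (𝓝 (capped w T x)) := by
      refine (ENNReal.tendsto_toReal ?_).comp (hx.min tendsto_const_nhds)
      exact (min_le_right _ _).trans_lt ENNReal.ofReal_lt_top |>.ne
    have h3 := (h2.sub_const (capped w T x)).enorm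
    simpa using h3

/-- In polar coordinates a null set of radii gives a null set of points. As `P` need not be
measurable, its exceptional set is first enlarged to a measurable null set. -/
theorem ae_comp_norm {d : ℕ} (hd : 0 < d) {P : ℝ → Prop}
    (h : ∀ᵐ r ∂volume.restrict (Ioi (0 : ℝ)), P r) : ∀ᵐ x : E d, P ‖x‖ := by
  set S := toMeasurable (volume.restrict (Ioi (0 : ℝ))) {r | ¬ P r} with hS
  have hSm : MeasurableSet S := measurableSet_toMeasurable _ _
  have hS0 : volume.restrict (Ioi (0 : ℝ)) S = 0 := by
    rw [hS, measure_toMeasurable]; exact ae_iff.1 h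
  have hpre : MeasurableSet {x : E d | ‖x‖ ∈ S} := hSm.preimage measurable_norm
  have h0 : volume {x : E d | ‖x‖ ∈ S} = 0 := by
    rw [← lintegral_indicator_one hpre, lintegral_polar hd (measurable_one.indicator hpre)]
    refine (lintegral_congr fun e => ?_).trans lintegral_zero
    rw [lintegral_eq_zero_of_ae_eq_zero]
    filter_upwards [measure_eq_zero_iff_ae_notMem.1 hS0, ae_restrict_mem measurableSet_Ioi]
      with r hr hr0
    rw [indicator_of_notMem, mul_zero, Pi.zero_apply]
    rw [mem_ofPred_eq, FluxData.norm_smul_sphere (le_of_lt hr0)]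
    exact hr
  rw [ae_iff]
  exact measure_mono_null (fun x hx => show ‖x‖ ∈ S from
    subset_toMeasurable (volume.restrict (Ioi (0 : ℝ))) {r | ¬ P r} hx) h0

theorem Triple.excess_congr {d : ℕ} {Γ : Set (E d)} {f g : E d → ℝ} (h : f =ᵐ[volume] g) :
    Triple.excess (Γ := Γ) f = Triple.excess g := by
  funext c A
  rw [Triple.excess, Triple.excess, integral_congr_ae (ae_restrict_of_ae
    (h.mono fun x hx => congrArg (1 + ·) hx : (fun x => 1 + f x) =ᵐ[volume] fun x => 1 + g x))]

theorem IsMinimalSolution.congr {d : ℕ} {γ : ℝ} {Γ : Set (E d)} {f g V : E d → ℝ} {w : E d → ℝ≥0∞}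
    (h : f =ᵐ[volume] g) (hg : IsMinimalSolution γ Γ g V w) : IsMinimalSolution γ Γ f V w := by
  unfold IsMinimalSolution Triple.ExcessNonneg Triple.cumExcess at *
  rwa [Triple.excess_congr h]

theorem isMinimalSolution_of_measurable {d : ℕ} (hd : 0 < d) {γ V₀ R₀ : ℝ} (hγ : 0 < γ)
    (hV₀ : 0 ≤ V₀) (hR₀ : 0 < R₀) {u : ℝ → ℝ} (hu : Measurable u) {C : ℝ} (hC : ∀ r, |u r| ≤ C)
    (hdiv : radialTime d γ V₀ R₀ u (radiusStar d γ V₀ R₀ u) = ⊤) :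
    IsMinimalSolution γ (Metric.ball (0 : E d) R₀)ᶜ (fun x => u ‖x‖)
      (fun _ => V₀) (radialArrival d γ V₀ R₀ u) := by
  have : Nontrivial (E d) := Module.nontrivial_of_finrank_pos (R := ℝ) (by simpa using hd)
  set ρ₀ := radiusStar d γ V₀ R₀ u with hρ₀
  have hρ₀0 : 0 ≤ ρ₀ := le_max_right _ _
  -- Otherwise the divergent integral would be over an empty interval.
  have hρ₀R : ρ₀ < R₀ := by
    by_contra hcon
    rw [radialTime, Ioo_eq_empty hcon, Measure.restrict_empty, lintegral_zero_measure] at hdiv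
    exact ENNReal.zero_ne_top hdiv
  set ε : ℕ → ℝ := fun n => 1 / ((n : ℝ) + 1) with hε
  have hε0 : ∀ n, 0 < ε n := fun n => by positivity
  have hεa : Antitone ε := fun i j hij =>
    one_div_le_one_div_of_le (by positivity) (by gcongr)
  have hεl : Tendsto ε atTop (𝓝 0) := tendsto_one_div_add_atTop_nhds_zero_nat
  -- Strictly above `ρ₀`, because `ρ₀` may be zero and `F` is only known to be nonnegative beyond
  -- it; the added `ε n` in the velocity makes the denominator positive on `[ρ n, R₀]`.
  set ρ : ℕ → ℝ := fun n => ρ₀ + ε n * ((R₀ - ρ₀) / 2) with hρ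
  have hdiff : 0 < (R₀ - ρ₀) / 2 := by linarith
  have hρ1 : ∀ n, ρ₀ < ρ n := fun n => lt_add_of_pos_right _ (mul_pos (hε0 n) hdiff)
  have hρ2 : ∀ n, ρ n < R₀ := fun n => by
    have h1 : ε n ≤ 1 := by
      rw [hε]; exact (div_le_one (by positivity)).2 (by linarith [(Nat.cast_nonneg n : (0 : ℝ) ≤ n)])
    have : ε n * ((R₀ - ρ₀) / 2) ≤ 1 * ((R₀ - ρ₀) / 2) := by gcongr
    simp only [hρ]
    linarith
  have hρa : Antitone ρ := fun i j hij => by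
    have := hεa hij
    simp only [hρ]
    gcongr
  have hρl : Tendsto ρ atTop (𝓝 ρ₀) := by
    simpa using (hεl.mul_const ((R₀ - ρ₀) / 2)).const_add ρ₀
  have hF : ∀ n, ∀ r ∈ Icc (ρ n) R₀, 0 < radialDenom d γ (V₀ + ε n) R₀ u r := by
    intro n r hr
    rw [radialDenom_add]
    have h1 := radialDenom_nonneg (u := u) (d := d) (γ := γ) hV₀ hR₀ (r := r)
      ⟨(hρ1 n).trans_le hr.1, hr.2⟩
    have h2 := mul_pos (hε0 n) (pow_pos hR₀ (d - 1))
    linarith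
  set D : ℕ → FluxData := fun n =>
    radialFlux d hγ (hρ₀0.trans_lt (hρ1 n)) (hρ2 n) hu hC (hF n) with hD
  set c : ℕ → Triple (Metric.ball (0 : E d) R₀)ᶜ := fun n => (D n).triple d with hc
  have hmass : ∀ n, ∀ A : Set (E d), MeasurableSet A → (c n).boundaryMass A =
      ENNReal.ofReal ((γ + (V₀ + ε n)) * R₀ ^ (d - 1)) *
        sphereMeasure d {e | R₀ • (e : E d) ∈ A} := by
    intro n A hA
    rw [← radialFlux_m_R hγ (hρ₀0.trans_lt (hρ1 n)) (hρ2 n) hu hC (hF n)]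
    exact (D n).triple_boundaryMass hd hA
  have henergy : ∀ A : Set (E d), MeasurableSet A →
      boundaryEnergy γ (Metric.ball (0 : E d) R₀)ᶜ (fun _ => V₀) A =
      ENNReal.ofReal ((γ + V₀) * R₀ ^ (d - 1)) * sphereMeasure d {e | R₀ • (e : E d) ∈ A} :=
    fun A hA => boundaryEnergy_compl_ball hd (by positivity) hR₀ hA
  have hcoef : ∀ n, (γ + V₀) * R₀ ^ (d - 1) < (γ + (V₀ + ε n)) * R₀ ^ (d - 1) := fun n =>
    mul_lt_mul_of_pos_right (by linarith [hε0 n]) (by positivity)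
  have hexcess : ∀ n, ∀ A : Set (E d), MeasurableSet A →
      (c n).excess (fun x => u ‖x‖) A = (D n).m0 * (sphereMeasure d).real {e | ρ n • (e : E d) ∈ A} :=
    fun n A hA => (D n).triple_excess hd rfl hu hC (fun _ => rfl) hA
  have htime : ∀ n r, ρ n ≤ r → (D n).time r = radialTime d γ (V₀ + ε n) R₀ u r := fun n r hr =>
    radialFlux_time hγ (hρ₀0.trans_lt (hρ1 n)) (hρ2 n) hu hC (hF n) hr
  -- The divergence hypothesis enters here: the front needs longer and longer to reach the sphere
  -- that carries the excess.
  have hblow : Tendsto (fun n => (D n).time (ρ n)) atTop (𝓝 ⊤) := by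
    rw [← hdiv]
    refine (tendsto_radialTime hR₀ hu hC hεa hεl hρa hρ₀0 (fun n => (hρ1 n).le) hρl).congr
      fun n => (htime n _ le_rfl).symm
  have harr : ∀ n, Measurable (c n).arrival := fun n =>
    (c n).measurable_arrival Metric.isOpen_ball.isClosed_compl
  have hlim : ∀ᵐ x : E d, Tendsto (fun n => (c n).arrival x) atTop
      (𝓝 (radialArrival d γ V₀ R₀ u x)) := by
    have hnull : ∀ᵐ x : E d, x ∉ Metric.sphere (0 : E d) ρ₀ :=
      measure_eq_zero_iff_ae_notMem.1 (Measure.addHaar_sphere _ _ _)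
    filter_upwards [hnull] with x hx
    rw [mem_sphere_zero_iff_norm] at hx
    rw [radialArrival]
    split_ifs with h1 h2
    · exact tendsto_const_nhds.congr fun n => ((D n).arrival_of_ge h1).symm
    · have h3 : ρ₀ < ‖x‖ := lt_of_le_of_ne h2 (Ne.symm hx)
      have h4 := tendsto_radialTime (d := d) (γ := γ) (V := V₀) (ρ := fun _ => ‖x‖) hR₀ hu hC hεa hεl
        antitone_const (norm_nonneg x) (fun _ => le_rfl) tendsto_const_nhds
      refine h4.congr' ?_
      filter_upwards [hρl.eventually_lt_const h3] with n hn
      rw [← htime n _ hn.le]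
      exact ((D n).arrival_of_mem hd ⟨hn.le, not_le.1 h1⟩).symm
    · refine tendsto_const_nhds.congr fun n => ((D n).arrival_of_lt ?_).symm
      exact (not_le.1 h2).trans (hρ1 n)
  refine ⟨measurable_radialArrival.aemeasurable, c,
    fun n => (D n).isAnyEquilibrium_triple hd rfl, fun T hT => ⟨⟨?_, ?_, ?_, ?_⟩, ?_⟩⟩
  · intro n A hA
    rw [hmass n A hA, henergy A hA]
    refine ⟨by gcongr; linarith [hε0 n], fun hpos => ?_⟩
    have h1 : sphereMeasure d {e | R₀ • (e : E d) ∈ A} ≠ 0 := fun h => by simp [h] at hpos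
    refine (ENNReal.mul_lt_mul_iff_left h1 (measure_ne_top _ _)).2 ?_
    exact (ENNReal.ofReal_lt_ofReal_iff_of_nonneg (by positivity)).2 (hcoef n)
  · intro n A hA
    rw [hexcess n A hA]
    exact mul_nonneg (D n).m0_pos.le measureReal_nonneg
  · exact fun K hK => tendsto_lintegral_capped measurable_radialArrival harr hlim hT.le hK
  · simp_rw [hmass _ _ MeasurableSet.univ, henergy _ MeasurableSet.univ]
    refine ENNReal.Tendsto.mul_const (ENNReal.tendsto_ofReal ?_) (Or.inr (measure_ne_top _ _))
    simpa using ((hεl.const_add V₀).const_add γ).mul_const (R₀ ^ (d - 1))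
  · intro c' _ _ hc' _ r t hr hrt htT
    refine le_liminf_of_le (by isBoundedDefault) ?_
    -- Once the innermost sphere is reached only after time `r`, the cumulative excess at `r` is
    -- zero, and the competitor contributes a nonnegative term. Of the competitor only the
    -- nonnegativity of its excess is needed.
    filter_upwards [hblow.eventually_const_lt (ENNReal.ofReal_lt_top (r := r))] with n hn
    have h1 : (c n).cumExcess (fun x => u ‖x‖) r = 0 :=
      (D n).cumExcess_eq_zero hd rfl hu hC (fun _ => rfl) hn
    have h2 : 0 ≤ (c' n).cumExcess (fun x => u ‖x‖) t := hc' n _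
      (measurableSet_le ((c' n).measurable_arrival Metric.isOpen_ball.isClosed_compl)
        measurable_const)
    rw [h1, sub_zero]
    exact_mod_cast h2

/-! ### Reduction to a Borel measurable, everywhere bounded `u`. -/

theorem integral_source_congr {d : ℕ} {R : ℝ} {u v : ℝ → ℝ}
    (h : ∀ᵐ r ∂volume.restrict (Ioi (0 : ℝ)), u r = v r) (hR : 0 < R) {r : ℝ} (hr : 0 < r) :
    ∫ z in r..R, (1 + u z) * z ^ (d - 1) = ∫ z in r..R, (1 + v z) * z ^ (d - 1) := by
  refine intervalIntegral.integral_congr_ae ?_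
  filter_upwards [(ae_restrict_iff' measurableSet_Ioi).1 h] with z hz hmem
  rw [hz ((lt_min hr hR).trans hmem.1)]

end Cascade

theorem proposition5p4 (d : ℕ) (hd : 2 ≤ d) (γ V₀ R₀ : ℝ) (hγ : 0 < γ) (hV₀ : 0 ≤ V₀)
    (hR₀ : 0 < R₀) (u : ℝ → ℝ) (hu : AEMeasurable u (volume.restrict (Ioi 0)))
    (hub : ∃ C : ℝ, ∀ r : ℝ, 0 ≤ r → |u r| ≤ C)
    (hdiv : Cascade.radialTime d γ V₀ R₀ u (Cascade.radiusStar d γ V₀ R₀ u) = ⊤) :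
    Cascade.IsMinimalSolution γ (Metric.ball (0 : Cascade.E d) R₀)ᶜ (fun x => u ‖x‖)
      (fun _ => V₀) (Cascade.radialArrival d γ V₀ R₀ u) := by
  obtain ⟨C, hC⟩ := hub
  have hC0 : 0 ≤ C := (abs_nonneg _).trans (hC 0 le_rfl)
  have hd0 : 0 < d := by omega
  -- A Borel version of `u`, truncated because the bound on `u` concerns only nonnegative radii
  -- while `v` must be bounded everywhere. Radius, travel time and arrival time see `u` only through
  -- integrals over positive radii.
  set v : ℝ → ℝ := fun r => max (-C) (min C (hu.mk u r)) with hv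
  have hvm : Measurable v :=
    measurable_const.max (measurable_const.min hu.measurable_mk)
  have hvC : ∀ r, |v r| ≤ C := fun r =>
    abs_le.2 ⟨le_max_left _ _, max_le (by linarith) (min_le_left _ _)⟩
  have huv : ∀ᵐ r ∂volume.restrict (Ioi (0 : ℝ)), u r = v r := by
    filter_upwards [hu.ae_eq_mk, ae_restrict_mem measurableSet_Ioi] with r hr hr0
    have h1 := abs_le.1 (hC r (le_of_lt hr0))
    simp only [hv]
    rw [← hr, min_eq_right h1.2, max_eq_right h1.1]
  have hint : ∀ r : ℝ, 0 < r → ∫ z in r..R₀, (1 + u z) * z ^ (d - 1) =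
      ∫ z in r..R₀, (1 + v z) * z ^ (d - 1) := fun r hr =>
    Cascade.integral_source_congr huv hR₀ hr
  have hstar : Cascade.radiusStar d γ V₀ R₀ u = Cascade.radiusStar d γ V₀ R₀ v := by
    unfold Cascade.radiusStar
    congr 2
    ext r
    refine and_congr_right fun hr => ?_
    rw [hint r hr]
  have htime : ∀ ρ : ℝ, 0 ≤ ρ →
      Cascade.radialTime d γ V₀ R₀ u ρ = Cascade.radialTime d γ V₀ R₀ v ρ := by
    intro ρ hρ
    refine setLIntegral_congr_fun measurableSet_Ioo fun r hr => ?_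
    rw [Cascade.radialDenom, Cascade.radialDenom, hint r (hρ.trans_lt hr.1)]
  have harr : Cascade.radialArrival d γ V₀ R₀ u = Cascade.radialArrival d γ V₀ R₀ v := by
    funext x
    rw [Cascade.radialArrival, Cascade.radialArrival, hstar, htime _ (norm_nonneg x)]
  rw [htime _ (show 0 ≤ Cascade.radiusStar d γ V₀ R₀ u from le_max_right _ _), hstar] at hdiv
  rw [harr]
  exact (Cascade.isMinimalSolution_of_measurable hd0 hγ hV₀ hR₀ hvm hvC hdiv).congr
    (Cascade.ae_comp_norm hd0 huv)
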